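/- Let $(\zeta_i)_{i\ge 0}$ be i.i.d. random vectors with values in $\mathbb{Z}^2$ on a probability space $(\Omega,\mathbb{P})$, with $\mathbb{E}\|\zeta_0\|^2<\infty$, $\mathbb{E}\,\zeta_0=0$ and covariance matrix $\Sigma$, and assume that the walk is aperiodic, i.e. that the support $\{\ell\in\mathbb{Z}^2:\mathbb{P}(\zeta_0=\ell)>0\}$ generates $\mathbb{Z}^2$ as a group. Let $Z_0=0$ and $Z_n=\zeta_0+\dots+\zeta_{n-1}$ for $n\ge 1$. Let $(X_\ell)_{\ell\in\mathbb{Z}^2}$ be i.i.d. centered real random variables on a probability space $(E,\mu)$ with $\|X_0\|_{L^2(\mu)}=1$, and let $(a_q)_{q\in\mathbb{Z}^2}$ be real numbers with $\sum_{q}|a_q|<\infty$ and $\sum_q a_q\neq 0$. Put $\Xi_\ell=\sum_{q\in\mathbb{Z}^2}a_q X_{\ell-q}$ and, for $\omega\in\Omega$ and $n\ge 0$, $S_n^{\omega,\Xi}=\sum_{k=0}^{n-1}\Xi_{Z_k(\omega)}$. Then the quenched functional central limit theorem holds with asymptotic variance $$\sigma^2=\Bigl|\sum_{q\in\mathbb{Z}^2}a_q\Bigr|^2\,\bigl(\pi\sqrt{\det\Sigma}\bigr)^{-1}:$$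 for $\mathbb{P}$-a.e. $\omega$, the processes $$\Bigl(\frac{S^{\omega,\Xi}_{\lfloor nt\rfloor}}{\sqrt{n\log n}}\Bigr)_{t\ge 0},$$ as random elements on $(E,\mu)$ of the space $D[0,\infty)$ of real c\`adl\`ag functions with the topology of uniform convergence on compact sets, converge in distribution, as $n\to\infty$, to $(\sigma W_t)_{t\ge0}$, where $W$ is a standard Brownian motion. -/

import Mathlib

open MeasureTheory ProbabilityTheory Filter Topology
open scoped NNReal

noncomputable section

/-- The lattice `ℤ²`. -/
abbrev ZSq : Type := Fin 2 → ℤ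

/-- `Z_n = ζ_0 + ... + ζ_{n-1}` (so `Z_0 = 0`). -/
def randomWalk {Ω : Type*} (ζ : ℕ → Ω → ZSq) (n : ℕ) (ω : Ω) : ZSq :=
  ∑ i ∈ Finset.range n, ζ i ω

/-- The random walk with step `ξ` is aperiodic: the subgroup of `ℤ²` generated by the support
of the law of `ξ` is the whole of `ℤ²`. -/
def IsAperiodicStep {Ω : Type*} [MeasurableSpace Ω] (P : Measure Ω) (ξ : Ω → ZSq) : Prop :=
  AddSubgroup.closure {l : ZSq | P {ω | ξ ω = l} ≠ 0} = ⊤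

/-- The covariance matrix of a `ℤ²`-valued random vector. -/
def stepCov {Ω : Type*} [MeasurableSpace Ω] (P : Measure Ω) (ξ : Ω → ZSq) :
    Matrix (Fin 2) (Fin 2) ℝ :=
  Matrix.of fun i j => covariance (fun ω => (ξ ω i : ℝ)) (fun ω => (ξ ω j : ℝ)) P

/-- The moving average `Ξ_l = ∑_q a_q X_{l-q}`. -/
def movingAverage {E : Type*} (a : ZSq → ℝ) (X : ZSq → E → ℝ) (l : ZSq) (x : E) : ℝ :=
  ∑' q, a q * X (l - q) x

/-- The sum `∑_{k < n} Ξ_{z k}` of a random field along a path `z` in `ℤ²`. -/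
def sumAlong {E : Type*} (Ξ : ZSq → E → ℝ) (z : ℕ → ZSq) (n : ℕ) (x : E) : ℝ :=
  ∑ k ∈ Finset.range n, Ξ (z k) x

/-- Right continuity and existence of (finite) left limits. At `t = 0` the second condition is
void, as `𝓝[<] 0 = ⊥` in `ℝ≥0`. -/
def IsCadlag (f : ℝ≥0 → ℝ) : Prop :=
  ∀ t, ContinuousWithinAt f (Set.Ici t) t ∧ ∃ y, Tendsto f (𝓝[<] t) (𝓝 y)

/-- The space `D[0, ∞)`. -/
def CadlagPath : Type := {f : ℝ≥0 → ℝ // IsCadlag f}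

namespace CadlagPath

instance : CoeFun CadlagPath (fun _ => ℝ≥0 → ℝ) := ⟨Subtype.val⟩

/-- The topology of uniform convergence on compact sets (equivalently, uniform convergence on
each `[0, T]`). -/
instance : TopologicalSpace CadlagPath :=
  TopologicalSpace.induced
    (fun f : CadlagPath => UniformOnFun.ofFun {K : Set ℝ≥0 | IsCompact K} f.1) inferInstance

instance : MeasurableSpace CadlagPath := borel CadlagPath

instance : BorelSpace CadlagPath := ⟨rfl⟩

/-- The path `t ↦ c * f t`. -/
def scale (c : ℝ) (f : CadlagPath) : CadlagPath :=
  ⟨fun t => c * f t, fun t =>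
    ⟨continuousWithinAt_const.mul (f.2 t).1,
      let ⟨y, hy⟩ := (f.2 t).2
      ⟨c * y, hy.const_mul c⟩⟩⟩

theorem isCadlag_floor (s : ℕ → ℝ) (n : ℕ) : IsCadlag fun t : ℝ≥0 => s ⌊(n : ℝ≥0) * t⌋₊ := by
  intro t
  have hmul : Continuous fun u : ℝ≥0 => (n : ℝ≥0) * u := by fun_prop
  have hmono : Monotone fun u : ℝ≥0 => ⌊(n : ℝ≥0) * u⌋₊ := fun u v h => by
    dsimp only; gcongr
  constructor
  · have h : ∀ᶠ u in 𝓝[≥] t, ⌊(n : ℝ≥0) * u⌋₊ = ⌊(n : ℝ≥0) * t⌋₊ := by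
      have h1 : ∀ᶠ u in 𝓝[≥] t, (n : ℝ≥0) * u < ⌊(n : ℝ≥0) * t⌋₊ + 1 :=
        (hmul.continuousAt.eventually_lt continuousAt_const
          (Nat.lt_floor_add_one _)).filter_mono nhdsWithin_le_nhds
      filter_upwards [h1, self_mem_nhdsWithin] with u hu htu
      refine le_antisymm ?_ (hmono htu)
      exact Nat.lt_succ_iff.mp ((Nat.floor_lt zero_le).2 (by exact_mod_cast hu))
    refine (tendsto_const_nhds (x := s ⌊(n : ℝ≥0) * t⌋₊)).congr' ?_
    filter_upwards [h] with u hu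
    rw [hu]
  · rcases eq_or_ne ((n : ℝ≥0) * t) 0 with h0 | h0
    · refine ⟨s 0, tendsto_const_nhds.congr' ?_⟩
      filter_upwards [self_mem_nhdsWithin] with u hu
      have : ⌊(n : ℝ≥0) * u⌋₊ ≤ ⌊(n : ℝ≥0) * t⌋₊ := hmono (le_of_lt hu)
      rw [h0, Nat.floor_zero] at this
      rw [Nat.le_zero.mp this]
    · have hn : (0 : ℝ≥0) < n := pos_iff_ne_zero.2 (left_ne_zero_of_mul h0)
      obtain ⟨m, hm⟩ : ∃ m, ⌈(n : ℝ≥0) * t⌉₊ = m + 1 :=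
        Nat.exists_eq_succ_of_ne_zero (Nat.ceil_pos.2 (pos_iff_ne_zero.2 h0)).ne'
      have hmt : (m : ℝ≥0) < n * t := Nat.lt_ceil.1 (by omega)
      have htm : (n : ℝ≥0) * t ≤ m + 1 := by exact_mod_cast Nat.ceil_le.1 hm.le
      refine ⟨s m, tendsto_const_nhds.congr' ?_⟩
      have h1 : ∀ᶠ u in 𝓝[<] t, (m : ℝ≥0) < n * u :=
        (continuousAt_const.eventually_lt hmul.continuousAt hmt).filter_mono nhdsWithin_le_nhds
      filter_upwards [h1, self_mem_nhdsWithin] with u hu hut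
      have h2 : (n : ℝ≥0) * u < m + 1 := lt_of_lt_of_le (mul_lt_mul_of_pos_left hut hn) htm
      rw [(Nat.floor_eq_iff zero_le).2 ⟨hu.le, h2⟩]

/-- The step path `t ↦ s ⌊n t⌋`. -/
def step (s : ℕ → ℝ) (n : ℕ) : CadlagPath := ⟨fun t => s ⌊(n : ℝ≥0) * t⌋₊, isCadlag_floor s n⟩

end CadlagPath

/-- The functional central limit theorem with asymptotic variance `v` for a sequence `Y` of
random càdlàg paths on `(E, μ)`: `Y_n` converges in distribution to `√v W`, where `W` is a
standard Brownian motion. -/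
def SatisfiesFCLT {E : Type*} [MeasurableSpace E] (μ : Measure E) [IsProbabilityMeasure μ]
    (Y : ℕ → E → CadlagPath) (v : ℝ) : Prop :=
  ∃ (Ω' : Type) (_ : MeasurableSpace Ω') (P' : Measure Ω') (_ : IsProbabilityMeasure P')
    (W : Ω' → CadlagPath),
    IsBrownianReal (fun t w => W w t) P' ∧
    TendstoInDistribution Y atTop (fun w => (W w).scale (√v)) (fun _ => μ) P'

/-- The path `t ↦ S_{⌊nt⌋}(x) / √(n log n)`, where `S` are the sums of the field `Ξ` along `z`. -/
def normalizedSum {E : Type*} (Ξ : ZSq → E → ℝ) (z : ℕ → ZSq) (n : ℕ) (x : E) :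
    CadlagPath :=
  CadlagPath.step (fun m => sumAlong Ξ z m x / √(n * Real.log n)) n

end

set_option linter.unusedSectionVars false

/-! ### Characteristic functions on the torus and Fourier inversion for the walk. -/

noncomputable section

/-! The path of the walk is frozen, and all that is used of it is one deterministic property,
`IsRegularPath`: for every `q` and all `s ≤ t`, the number of pairs of times `i, j` between `ns` and
`nt` with `z j - z i = q` is asymptotic to `c (t - s) n log n`, with the same `c` for all `q`. The
proof splits into the almost sure regularity of the walk (`ae_isRegularPath`, with `c = (π √det
Σ)⁻¹`) and a functional limit theorem along any regular path (`satisfiesFCLT`).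

Regularity. The mean number of pairs is governed by the Green function `∑_{k<n} P(Z_k = q)`, which
grows like `log n / (2π √det Σ)` for every `q` (`tendsto_green`). Its Abel sums are integrals of
`exp(-iθ·q) / (1 - r φ(θ))`, where `φ` is the characteristic function of a step. Aperiodicity makes
`θ = 0` the only zero of `1 - φ`, and near it the Gaussian approximation of `φ` produces the
logarithm. Points with `|φ| = 1` and `φ ≠ 1` are harmless, so no local limit theorem is needed. The
bound `P(Z_k = x) ≤ C / (k + 1)`, which also holds for periodic walks, passes from Abel sums to
partial sums. The variance of the count over an interval of length `N` is `O(N²)`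
(`exists_variance_upCount_le`): cutting the interval in two gives independent halves and a cross
term of second moment `O(N²)`. Relative to the squared mean this is `O(1 / log² n)`, summable along
`n = exp(k^(3/4))`. Consecutive terms of this sequence have ratio tending to one, and monotonicity
fills the gaps.

Limit theorem. Along a fixed path the sums are `∑_l L(l) X_l` with `L` the local time, and their
variance is the number of self-intersections. As this number is asymptotically linear in the length
of the time interval, disjoint blocks share only `o(n log n)` intersections: block sums are
asymptotically uncorrelated. Cutting finely also gives `sup L² = o(n log n)`, which is the
negligibility needed for the central limit theorem for weighted sums. This yields joint Gaussian
limits (`tendsto_charFun_blocks`).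

Tightness. The sums are not a martingale along the path, since sites are revisited. But the event
that they have reached a level is increasing in each `X_l`, hence positively correlated with it, and
this is enough for a Doob inequality (`mul_upEvent_le`). Its truncated form controls oscillations by
a second moment over large values, asymptotically of order `v²` on a block of limiting variance `v`,
so that `O(m)` blocks of variance `c / m` contribute `O(1 / m)` (`exists_oscEvent_le`).

Moving averages. The sums of the field and of its translate by `q` differ in `L²` by twice the
number of pairs for `0` minus that for `q`, which is `o(n log n)` because `c` does not depend on
`q`. With tightness the difference is uniformly small, and a bound uniform in `q` allows summation
against `a` (`tendsto_movingAverage_sub`): the moving average acts as multiplication by `∑ a_q`.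

Weak convergence is tested on bounded uniformly continuous functionals, by comparison with polygonal
paths on a grid. The limiting Brownian motion is built from an isonormal process as the locally
uniform limit of its dyadic polygons. -/

/-- The random walk with steps `ζ` is i.i.d., centered, aperiodic, with second moments. -/
structure IsCenteredWalk {Ω : Type*} [MeasurableSpace Ω] (P : Measure Ω) (ζ : ℕ → Ω → ZSq) :
    Prop where
  meas : ∀ i, Measurable (ζ i)
  indep : iIndepFun ζ P
  ident : ∀ i, IdentDistrib (ζ i) (ζ 0) P P
  moment : ∀ j, MemLp (fun ω => (ζ 0 ω j : ℝ)) 2 P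
  mean : ∀ j, ∫ ω, (ζ 0 ω j : ℝ) ∂P = 0
  aper : IsAperiodicStep P (ζ 0)

/-- The pairing of the torus and the lattice. -/
def dotZ (θ : ℝ × ℝ) (x : ZSq) : ℝ := θ.1 * x 0 + θ.2 * x 1

theorem dotZ_add (θ : ℝ × ℝ) (x y : ZSq) : dotZ θ (x + y) = dotZ θ x + dotZ θ y := by
  simp only [dotZ, Pi.add_apply, Int.cast_add]; ring

theorem dotZ_sub (θ : ℝ × ℝ) (x y : ZSq) : dotZ θ (x - y) = dotZ θ x - dotZ θ y := by
  simp only [dotZ, Pi.sub_apply, Int.cast_sub]; ring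

theorem dotZ_zero (θ : ℝ × ℝ) : dotZ θ 0 = 0 := by simp [dotZ]

theorem measurable_dotZ : Measurable fun p : (ℝ × ℝ) × ZSq => dotZ p.1 p.2 := by
  have h : ∀ j : Fin 2, Measurable fun x : ZSq => (x j : ℝ) := fun j =>
    (measurable_from_top (f := fun n : ℤ => (n : ℝ))).comp (measurable_pi_apply j)
  exact ((measurable_fst.comp measurable_fst).mul ((h 0).comp measurable_snd)).add
    ((measurable_snd.comp measurable_fst).mul ((h 1).comp measurable_snd))

theorem measurable_dotZ_right (θ : ℝ × ℝ) : Measurable (dotZ θ) :=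
  measurable_dotZ.comp (measurable_const.prodMk measurable_id)

theorem continuous_dotZ_left (x : ZSq) : Continuous fun θ => dotZ θ x := by
  unfold dotZ; fun_prop

/-- The characteristic function of a lattice-valued random vector. -/
def stepCF {Ω : Type*} [MeasurableSpace Ω] (P : Measure Ω) (ξ : Ω → ZSq) (θ : ℝ × ℝ) : ℂ :=
  ∫ ω, Complex.exp (dotZ θ (ξ ω) * Complex.I) ∂P

/-- The box `(-π, π]²`. -/
def torusBox : Set (ℝ × ℝ) := Set.Ioc (-Real.pi) Real.pi ×ˢ Set.Ioc (-Real.pi) Real.pi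

/-- Lebesgue measure on the box `(-π, π]²`. -/
def torus : Measure (ℝ × ℝ) := volume.restrict torusBox

theorem torus_eq_prod : torus = (volume.restrict (Set.Ioc (-Real.pi) Real.pi)).prod
    (volume.restrict (Set.Ioc (-Real.pi) Real.pi)) := by
  rw [Measure.prod_restrict]; rfl

instance : IsFiniteMeasure torus := by
  rw [torus_eq_prod]; infer_instance

theorem integral_exp_int_mul (m : ℤ) :
    ∫ t in Set.Ioc (-Real.pi) Real.pi, Complex.exp ((t * m : ℝ) * Complex.I) =
      if m = 0 then (2 * Real.pi : ℂ) else 0 := by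
  rw [← intervalIntegral.integral_of_le (by linarith [Real.pi_pos])]
  split_ifs with h
  · simp [h]; ring
  · have hc : (m : ℂ) * Complex.I ≠ 0 := by simp [h]
    have : ∀ t : ℝ, Complex.exp ((t * m : ℝ) * Complex.I) =
        Complex.exp ((m * Complex.I) * t) := fun t => by push_cast; ring_nf
    simp_rw [this]
    rw [integral_exp_mul_complex hc, div_eq_zero_iff]
    left
    rw [sub_eq_zero, Complex.exp_eq_exp_iff_exists_int]
    exact ⟨m, by push_cast; ring⟩

theorem integral_torus_exp (x : ZSq) :
    ∫ θ, Complex.exp (dotZ θ x * Complex.I) ∂torus =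
      if x = 0 then (4 * Real.pi ^ 2 : ℂ) else 0 := by
  have h : ∀ θ : ℝ × ℝ, Complex.exp (dotZ θ x * Complex.I) =
      Complex.exp ((θ.1 * (x 0) : ℝ) * Complex.I) *
        Complex.exp ((θ.2 * (x 1) : ℝ) * Complex.I) := by
    intro θ
    rw [← Complex.exp_add]; simp only [dotZ]; push_cast; ring_nf
  simp_rw [h]
  rw [torus_eq_prod, integral_prod_mul (fun t : ℝ => Complex.exp ((t * (x 0) : ℝ) * Complex.I))
    (fun t : ℝ => Complex.exp ((t * (x 1) : ℝ) * Complex.I)), integral_exp_int_mul,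
    integral_exp_int_mul]
  have hx : x = 0 ↔ x 0 = 0 ∧ x 1 = 0 := by
    rw [funext_iff, Fin.forall_fin_two]; rfl
  by_cases h0 : x 0 = 0 <;> by_cases h1 : x 1 = 0 <;> simp [hx, h0, h1]
  ring

variable {Ω : Type*} [MeasurableSpace Ω] {P : Measure Ω} [IsProbabilityMeasure P]
  {ζ : ℕ → Ω → ZSq}

theorem norm_exp_dotZ (θ : ℝ × ℝ) (x : ZSq) : ‖Complex.exp (dotZ θ x * Complex.I)‖ = 1 :=
  Complex.norm_exp_ofReal_mul_I _

theorem measurable_exp_dotZ (θ : ℝ × ℝ) :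
    Measurable fun x : ZSq => Complex.exp (dotZ θ x * Complex.I) :=
  Complex.measurable_exp.comp
    ((Complex.measurable_ofReal.comp (measurable_dotZ_right θ)).mul_const _)

theorem integrable_exp_dotZ {ξ : Ω → ZSq} (hξ : Measurable ξ) (θ : ℝ × ℝ) :
    Integrable (fun ω => Complex.exp (dotZ θ (ξ ω) * Complex.I)) P :=
  Integrable.of_bound ((measurable_exp_dotZ θ).comp hξ).aestronglyMeasurable 1
    (ae_of_all _ fun ω => (norm_exp_dotZ θ (ξ ω)).le)

theorem norm_stepCF_le (ξ : Ω → ZSq) (θ : ℝ × ℝ) : ‖stepCF P ξ θ‖ ≤ 1 := by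
  refine (norm_integral_le_integral_norm _).trans ?_
  simp

theorem continuous_stepCF {ξ : Ω → ZSq} (hξ : Measurable ξ) : Continuous (stepCF P ξ) := by
  refine continuous_of_dominated (bound := fun _ => 1)
    (fun θ => (integrable_exp_dotZ hξ θ).aestronglyMeasurable)
    (fun θ => ae_of_all _ fun ω => (norm_exp_dotZ θ (ξ ω)).le) (integrable_const _)
    (ae_of_all _ fun ω => ?_)
  have := continuous_dotZ_left (ξ ω)
  fun_prop

namespace IsCenteredWalk

theorem measurable_walk (h : IsCenteredWalk P ζ) (k : ℕ) : Measurable (randomWalk ζ k) :=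
  Finset.measurable_sum _ fun i _ => h.meas i

theorem stepCF_walk (h : IsCenteredWalk P ζ) (θ : ℝ × ℝ) (k : ℕ) :
    stepCF P (randomWalk ζ k) θ = stepCF P (ζ 0) θ ^ k := by
  induction k with
  | zero => simp [stepCF, randomWalk, dotZ_zero]
  | succ k ih =>
    have hi : IndepFun (randomWalk ζ k) (ζ k) P := by
      have := h.indep.indepFun_finsetSum_of_notMem h.meas (Finset.notMem_range_self (n := k))
      convert this using 1
      ext ω : 1
      simp [randomWalk]
    have h1 : stepCF P (randomWalk ζ (k + 1)) θ =
        ∫ ω, Complex.exp (dotZ θ (randomWalk ζ k ω) * Complex.I) *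
          Complex.exp (dotZ θ (ζ k ω) * Complex.I) ∂P := by
      refine integral_congr_ae (ae_of_all _ fun ω => ?_)
      simp only [randomWalk, Finset.sum_range_succ, dotZ_add, ← Complex.exp_add]
      push_cast; ring_nf
    rw [h1, hi.integral_fun_comp_mul_comp (f := fun x => Complex.exp (dotZ θ x * Complex.I))
      (g := fun x => Complex.exp (dotZ θ x * Complex.I)) (h.measurable_walk k).aemeasurable
      (h.meas k).aemeasurable (measurable_exp_dotZ θ).aestronglyMeasurable
      (measurable_exp_dotZ θ).aestronglyMeasurable, pow_succ, ← ih]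
    congr 1
    exact ((h.ident k).comp (measurable_exp_dotZ θ)).integral_eq

/-- Fourier inversion for the law of the walk at time `k`. -/
theorem fourier_inversion (h : IsCenteredWalk P ζ) (k : ℕ) (x : ZSq) :
    ((P.real {ω | randomWalk ζ k ω = x} : ℝ) : ℂ) * (4 * Real.pi ^ 2) =
      ∫ θ, Complex.exp (-dotZ θ x * Complex.I) * stepCF P (ζ 0) θ ^ k ∂torus := by
  have h1 : ∀ θ : ℝ × ℝ, Complex.exp (-dotZ θ x * Complex.I) * stepCF P (ζ 0) θ ^ k =
      ∫ ω, Complex.exp (dotZ θ (randomWalk ζ k ω - x) * Complex.I) ∂P := by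
    intro θ
    rw [← h.stepCF_walk, stepCF, ← integral_const_mul]
    refine integral_congr_ae (ae_of_all _ fun ω => ?_)
    simp only [← Complex.exp_add, dotZ_sub]
    push_cast; ring_nf
  simp_rw [h1]
  -- After Fubini the inner integral is that of the character at `Z_k - x`, which is `4π²` on the
  -- event `Z_k = x` and zero elsewhere.
  rw [integral_integral_swap]
  · simp_rw [integral_torus_exp, sub_eq_zero]
    have hm : MeasurableSet {ω | randomWalk ζ k ω = x} :=
      h.measurable_walk k (measurableSet_singleton x)
    have : ∀ ω, (if randomWalk ζ k ω = x then (4 * Real.pi ^ 2 : ℂ) else 0) =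
        {ω | randomWalk ζ k ω = x}.indicator (fun _ => (4 * Real.pi ^ 2 : ℂ)) ω := by
      intro ω; simp [Set.indicator_apply]
    simp_rw [this]
    rw [integral_indicator_const _ hm]
    simp
  · refine Integrable.of_bound (C := 1) (Measurable.aestronglyMeasurable ?_)
      (ae_of_all _ fun p => (norm_exp_dotZ _ _).le)
    refine Complex.measurable_exp.comp ((Complex.measurable_ofReal.comp
      (measurable_dotZ.comp (f := fun p : (ℝ × ℝ) × Ω => (p.1, randomWalk ζ k p.2 - x))
        ?_)).mul_const _)
    exact measurable_fst.prodMk (((h.measurable_walk k).comp measurable_snd).sub_const x)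

end IsCenteredWalk

end

/-! ### The on-diagonal heat kernel bound. -/

noncomputable section

theorem one_sub_cos_eq (x : ℝ) : 1 - Real.cos x = 2 * Real.sin (x / 2) ^ 2 := by
  have := Real.cos_sq' (x / 2)
  have h2 := Real.cos_two_mul (x / 2)
  rw [show 2 * (x / 2) = x by ring] at h2
  linarith

/-- Since `1 - cos x = 2 sin² (x / 2)`, this is `(p + q)² ≤ 2p² + 2q²`. Together with
`one_sub_cos_int_mul_le` it makes `1 - cos` behave like a squared distance on the circle, so that
bounds pass through integer linear combinations of angles. -/
theorem one_sub_cos_add_le (x y : ℝ) :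
    1 - Real.cos (x + y) ≤ 2 * (1 - Real.cos x) + 2 * (1 - Real.cos y) := by
  simp only [one_sub_cos_eq]
  rw [add_div, Real.sin_add]
  set a := Real.sin (x / 2)
  set b := Real.sin (y / 2)
  set c := Real.cos (x / 2)
  set e := Real.cos (y / 2)
  have h1 : c ^ 2 ≤ 1 := Real.cos_sq_le_one _
  have h2 : e ^ 2 ≤ 1 := Real.cos_sq_le_one _
  have h3 : a ^ 2 * e ^ 2 ≤ a ^ 2 := mul_le_of_le_one_right (sq_nonneg _) h2
  have h4 : b ^ 2 * c ^ 2 ≤ b ^ 2 := mul_le_of_le_one_right (sq_nonneg _) h1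
  nlinarith [sq_nonneg (a * e - c * b)]

theorem abs_sin_nat_mul_le (n : ℕ) (x : ℝ) : |Real.sin (n * x)| ≤ n * |Real.sin x| := by
  induction n with
  | zero => simp
  | succ n ih =>
    push_cast
    rw [add_mul, one_mul, Real.sin_add, add_mul, one_mul]
    refine (abs_add_le _ _).trans (add_le_add ?_ ?_)
    · rw [abs_mul]
      exact (mul_le_of_le_one_right (abs_nonneg _) (Real.abs_cos_le_one _)).trans ih
    · rw [abs_mul]
      exact mul_le_of_le_one_left (abs_nonneg _) (Real.abs_cos_le_one _)

theorem one_sub_cos_int_mul_le (m : ℤ) (x : ℝ) :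
    1 - Real.cos (m * x) ≤ m ^ 2 * (1 - Real.cos x) := by
  have key : ∀ n : ℕ, 1 - Real.cos (n * x) ≤ n ^ 2 * (1 - Real.cos x) := by
    intro n
    simp only [one_sub_cos_eq, mul_div_assoc]
    have := abs_sin_nat_mul_le n (x / 2)
    have h2 : Real.sin (n * (x / 2)) ^ 2 ≤ (n * |Real.sin (x / 2)|) ^ 2 := by
      rw [← sq_abs]; gcongr
    rw [mul_pow, sq_abs] at h2
    linarith
  obtain ⟨n, rfl | rfl⟩ := m.eq_nat_or_neg
  · exact_mod_cast key n
  · simpa using key n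

/-- The factor `d` only winds the circle `d` times, so by periodicity it disappears; on one period
`1 - cos t ≥ 2t² / π²` gives a Gaussian bound. -/
theorem integral_exp_neg_one_sub_cos_le {b : ℝ} (hb : 0 < b) {d : ℤ} (hd : d ≠ 0) :
    ∫ t in Set.Ioc (-Real.pi) Real.pi, Real.exp (-b * (1 - Real.cos (d * t))) ≤
      √(Real.pi ^ 3 / (2 * b)) := by
  have hd' : (d : ℝ) ≠ 0 := by exact_mod_cast hd
  have hpi := Real.pi_pos
  rw [← intervalIntegral.integral_of_le (by linarith)]
  rw [intervalIntegral.integral_comp_mul_left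
    (f := fun t => Real.exp (-b * (1 - Real.cos t))) hd']
  have hper : Function.Periodic (fun t => Real.exp (-b * (1 - Real.cos t))) (2 * Real.pi) := by
    intro t; simp
  have h1 := hper.intervalIntegral_add_zsmul_eq d (-(d * Real.pi))
  have h2 := hper.intervalIntegral_add_eq (-(d * Real.pi)) (-Real.pi)
  rw [show -(d * Real.pi) + d • (2 * Real.pi) = d * Real.pi by simp; ring] at h1
  rw [show (-Real.pi) + 2 * Real.pi = Real.pi by ring] at h2
  rw [show (d : ℝ) * -Real.pi = -(d * Real.pi) by ring, h1 fun a b =>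
    Continuous.intervalIntegrable (by fun_prop) _ _, h2, zsmul_eq_mul, smul_eq_mul,
    inv_mul_cancel_left₀ hd']
  have hg : Integrable fun t : ℝ => Real.exp (-(2 * b / Real.pi ^ 2) * t ^ 2) :=
    integrable_exp_neg_mul_sq (by positivity)
  calc ∫ t in (-Real.pi)..Real.pi, Real.exp (-b * (1 - Real.cos t))
      ≤ ∫ t in (-Real.pi)..Real.pi, Real.exp (-(2 * b / Real.pi ^ 2) * t ^ 2) := by
        refine intervalIntegral.integral_mono_on (by linarith)
          (Continuous.intervalIntegrable (by fun_prop) _ _) hg.intervalIntegrable ?_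
        intro t ht
        have := Real.cos_le_one_sub_mul_cos_sq (x := t) (abs_le.2 ht)
        refine Real.exp_le_exp.2 ?_
        have h3 : b * (2 / Real.pi ^ 2 * t ^ 2) ≤ b * (1 - Real.cos t) := by
          gcongr; linarith
        calc -b * (1 - Real.cos t) ≤ -(b * (2 / Real.pi ^ 2 * t ^ 2)) := by linarith
          _ = _ := by ring
    _ ≤ ∫ t, Real.exp (-(2 * b / Real.pi ^ 2) * t ^ 2) := by
        rw [intervalIntegral.integral_of_le (by linarith)]
        exact setIntegral_le_integral hg (ae_of_all _ fun t => (Real.exp_pos _).le)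
    _ = √(Real.pi ^ 3 / (2 * b)) := by
        rw [integral_gaussian]; congr 1; field_simp

variable {Ω : Type*} [MeasurableSpace Ω] {P : Measure Ω} [IsProbabilityMeasure P]
  {ζ : ℕ → Ω → ZSq}

/-- The support of the law of a lattice-valued random vector. -/
def stepSupport (P : Measure Ω) (ξ : Ω → ZSq) : Set ZSq := {l | P {ω | ξ ω = l} ≠ 0}

theorem ae_mem_stepSupport (ξ : Ω → ZSq) : ∀ᵐ ω ∂P, ξ ω ∈ stepSupport P ξ := by
  have : {ω | ¬ ξ ω ∈ stepSupport P ξ} ⊆ ⋃ l ∈ (stepSupport P ξ)ᶜ, {ω | ξ ω = l} := by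
    intro ω hω; simp only [Set.mem_iUnion]; exact ⟨ξ ω, hω, rfl⟩
  refine measure_mono_null this ((measure_biUnion_null_iff (Set.to_countable _)).2 ?_)
  intro l hl
  simpa [stepSupport] using hl

theorem forall_stepSupport_of_ae {ξ : Ω → ZSq} {p : ZSq → Prop} (h : ∀ᵐ ω ∂P, p (ξ ω)) :
    ∀ l ∈ stepSupport P ξ, p l := by
  intro l hl
  by_contra hp
  exact hl (measure_mono_null (fun ω (hω : ξ ω = l) => by simpa [hω] using hp) h)

/-- Aperiodicity in the form in which it is used: with `M = ℝ` it gives nondegeneracy of the walk,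
and with `M = ℝ / 2πℤ` it locates the zeros of one minus the characteristic function. -/
theorem IsCenteredWalk.hom_eq_zero (h : IsCenteredWalk P ζ) {M : Type*} [AddCommGroup M]
    (f : ZSq →+ M) (hf : ∀ l ∈ stepSupport P (ζ 0), f l = 0) (x : ZSq) : f x = 0 := by
  have hx : x ∈ AddSubgroup.closure (stepSupport P (ζ 0)) := by
    have := h.aper
    unfold IsAperiodicStep at this
    rw [stepSupport, this]; trivial
  have : AddSubgroup.closure (stepSupport P (ζ 0)) ≤ f.ker :=
    (AddSubgroup.closure_le _).2 hf
  exact this hx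

/-- `dotZ θ` as an additive homomorphism. -/
def dotZHom (θ : ℝ × ℝ) : ZSq →+ ℝ where
  toFun := dotZ θ
  map_zero' := dotZ_zero θ
  map_add' := dotZ_add θ

theorem IsCenteredWalk.dotZ_eq_zero (h : IsCenteredWalk P ζ) {θ : ℝ × ℝ}
    (hθ : ∀ l ∈ stepSupport P (ζ 0), dotZ θ l = 0) : θ = 0 := by
  have h0 := h.hom_eq_zero (dotZHom θ) hθ ![1, 0]
  have h1 := h.hom_eq_zero (dotZHom θ) hθ ![0, 1]
  simp [dotZHom, dotZ] at h0 h1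
  exact Prod.ext h0 h1

theorem IsCenteredWalk.integral_dotZ (h : IsCenteredWalk P ζ) (θ : ℝ × ℝ) :
    ∫ ω, dotZ θ (ζ 0 ω) ∂P = 0 := by
  have hi : ∀ j, Integrable (fun ω => (ζ 0 ω j : ℝ)) P := fun j =>
    (h.moment j).integrable (by norm_num)
  simp only [dotZ]
  rw [integral_add ((hi 0).const_mul _) ((hi 1).const_mul _), integral_const_mul,
    integral_const_mul, h.mean, h.mean]
  simp

/-- Two differences of support points are linearly independent. -/
theorem IsCenteredWalk.exists_det_ne_zero (h : IsCenteredWalk P ζ) :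
    ∃ a ∈ stepSupport P (ζ 0), ∃ b ∈ stepSupport P (ζ 0), ∃ a' ∈ stepSupport P (ζ 0),
      ∃ b' ∈ stepSupport P (ζ 0),
        (a - b) 0 * (a' - b') 1 - (a - b) 1 * (a' - b') 0 ≠ 0 := by
  by_contra! hcon
  -- If all differences of support points are parallel, some nonzero `θ` annihilates them: the
  -- rotation by a right angle of one nonzero difference, or any vector when the support is a single
  -- point.
  have hw : ∃ θ : ℝ × ℝ, θ ≠ 0 ∧ ∀ a ∈ stepSupport P (ζ 0), ∀ b ∈ stepSupport P (ζ 0),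
      dotZ θ (a - b) = 0 := by
    by_cases hex : ∃ a ∈ stepSupport P (ζ 0), ∃ b ∈ stepSupport P (ζ 0), a ≠ b
    · obtain ⟨a, ha, b, hb, hab⟩ := hex
      refine ⟨(-((a - b) 1 : ℝ), ((a - b) 0 : ℝ)), ?_, fun a' ha' b' hb' => ?_⟩
      · intro h0
        rw [Prod.mk_eq_zero] at h0
        refine hab (sub_eq_zero.1 (funext fun j => ?_))
        have h1 : (a - b) 1 = 0 := by exact_mod_cast neg_eq_zero.1 h0.1
        have h2 : (a - b) 0 = 0 := by exact_mod_cast h0.2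
        fin_cases j
        · exact h2
        · exact h1
      · have := hcon a ha b hb a' ha' b' hb'
        simp only [dotZ]
        have h3 : (((a - b) 0 * (a' - b') 1 - (a - b) 1 * (a' - b') 0 : ℤ) : ℝ) = 0 := by
          rw [this]; simp
        push_cast at h3
        linarith
    · push Not at hex
      refine ⟨(1, 0), by simp, fun a ha b hb => ?_⟩
      rw [hex a ha b hb, sub_self, dotZ_zero]
  -- The pairing with `θ` is then constant on the support; centering makes the constant zero, and
  -- aperiodicity makes `θ` zero.
  obtain ⟨θ, hθ0, hθ⟩ := hw
  refine hθ0 (h.dotZ_eq_zero fun l hl => ?_)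
  have h1 : ∀ᵐ ω ∂P, dotZ θ (ζ 0 ω) = dotZ θ l := by
    filter_upwards [ae_mem_stepSupport (P := P) (ζ 0)] with ω hω
    have := hθ _ hω _ hl
    rw [dotZ_sub] at this
    linarith
  have h2 := h.integral_dotZ θ
  rw [integral_congr_ae h1] at h2
  simpa using h2

/-- With an independent copy `ξ'`, `|φ|² = E cos (θ·(ξ - ξ'))`, and only the event `ξ = a`, `ξ' = b`
is kept in `E (1 - cos)`. Symmetrization removes the phase of `φ`, so periodicity of the walk does
no harm. -/
theorem sq_norm_stepCF_le {ξ : Ω → ZSq} (hξ : Measurable ξ) (θ : ℝ × ℝ) (a b : ZSq) :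
    ‖stepCF P ξ θ‖ ^ 2 ≤ 1 - P.real {ω | ξ ω = a} * P.real {ω | ξ ω = b} *
      (1 - Real.cos (dotZ θ (a - b))) := by
  have hA : MeasurableSet {ω | ξ ω = a} := hξ (measurableSet_singleton a)
  have hB : MeasurableSet {ω | ξ ω = b} := hξ (measurableSet_singleton b)
  have h1 : ((‖stepCF P ξ θ‖ ^ 2 : ℝ) : ℂ) = ∫ p : Ω × Ω,
      Complex.exp (dotZ θ (ξ p.1 - ξ p.2) * Complex.I) ∂(P.prod P) := by
    have : ∀ p : Ω × Ω, Complex.exp (dotZ θ (ξ p.1 - ξ p.2) * Complex.I) =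
        Complex.exp (dotZ θ (ξ p.1) * Complex.I) *
          (starRingEnd ℂ) (Complex.exp (dotZ θ (ξ p.2) * Complex.I)) := by
      intro p
      rw [← Complex.exp_conj, ← Complex.exp_add, dotZ_sub]
      simp only [map_mul, Complex.conj_ofReal, Complex.conj_I]
      push_cast; ring_nf
    simp_rw [this]
    rw [integral_prod_mul (fun ω => Complex.exp (dotZ θ (ξ ω) * Complex.I))
      (fun ω => (starRingEnd ℂ) (Complex.exp (dotZ θ (ξ ω) * Complex.I))), integral_conj]
    change _ = stepCF P ξ θ * (starRingEnd ℂ) (stepCF P ξ θ)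
    rw [Complex.mul_conj, Complex.normSq_eq_norm_sq]
  have hmeas : Measurable fun p : Ω × Ω => ξ p.1 - ξ p.2 :=
    (hξ.comp measurable_fst).sub (hξ.comp measurable_snd)
  have h2 : ‖stepCF P ξ θ‖ ^ 2 = ∫ p : Ω × Ω, Real.cos (dotZ θ (ξ p.1 - ξ p.2)) ∂(P.prod P) := by
    have h3 := congrArg Complex.re h1
    rw [Complex.ofReal_re] at h3
    have h4 : ∫ p : Ω × Ω, (Complex.exp (dotZ θ (ξ p.1 - ξ p.2) * Complex.I)).re ∂(P.prod P) =
        (∫ p : Ω × Ω, Complex.exp (dotZ θ (ξ p.1 - ξ p.2) * Complex.I) ∂(P.prod P)).re :=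
      integral_re (𝕜 := ℂ) (integrable_exp_dotZ (P := P.prod P) hmeas θ)
    rw [h3]
    refine h4.symm.trans (integral_congr_ae (ae_of_all _ fun p => ?_))
    simp only
    exact Complex.exp_ofReal_mul_I_re _
  have hcos : Integrable (fun p : Ω × Ω => Real.cos (dotZ θ (ξ p.1 - ξ p.2))) (P.prod P) :=
    Integrable.of_bound (Real.measurable_cos.comp ((measurable_dotZ_right θ).comp
      hmeas)).aestronglyMeasurable 1 (ae_of_all _ fun p => Real.abs_cos_le_one _)
  have h5 : P.real {ω | ξ ω = a} * P.real {ω | ξ ω = b} * (1 - Real.cos (dotZ θ (a - b))) ≤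
      ∫ p : Ω × Ω, (1 - Real.cos (dotZ θ (ξ p.1 - ξ p.2))) ∂(P.prod P) := by
    have h6 : P.real {ω | ξ ω = a} * P.real {ω | ξ ω = b} * (1 - Real.cos (dotZ θ (a - b))) =
        ∫ p : Ω × Ω, ({ω | ξ ω = a} ×ˢ {ω | ξ ω = b}).indicator
          (fun _ => 1 - Real.cos (dotZ θ (a - b))) p ∂(P.prod P) := by
      rw [integral_indicator_const _ (hA.prod hB), measureReal_prod_prod, smul_eq_mul]
    rw [h6]
    refine integral_mono ((integrable_const _).indicator (hA.prod hB))
      ((integrable_const _).sub hcos) fun p => ?_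
    rw [Set.indicator_apply]
    split_ifs with hp
    · obtain ⟨hpa, hpb⟩ := hp
      simp only [Set.mem_ofPred_eq] at hpa hpb
      simp [hpa, hpb]
    · simpa using Real.cos_le_one _
  rw [integral_sub (integrable_const _) hcos, ← h2] at h5
  simp at h5
  linarith

/-- Two linearly independent differences `u, v` of support points have determinant `d`, and by
Cramer's rule `d θ₁` and `d θ₂` are integer combinations of `θ·u` and `θ·v`. The loss in `|φ|²`
along `u` and `v` thus controls both coordinates, in a form that factorizes. -/
theorem IsCenteredWalk.exists_norm_stepCF_pow_le (h : IsCenteredWalk P ζ) :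
    ∃ κ > 0, ∃ d : ℤ, d ≠ 0 ∧ ∀ θ : ℝ × ℝ, ∀ k : ℕ, ‖stepCF P (ζ 0) θ‖ ^ k ≤
      Real.exp (-(k * κ) * (1 - Real.cos (d * θ.1))) *
        Real.exp (-(k * κ) * (1 - Real.cos (d * θ.2))) := by
  obtain ⟨a, ha, b, hb, a', ha', b', hb', hdet⟩ := h.exists_det_ne_zero
  have hpos : ∀ l ∈ stepSupport P (ζ 0), 0 < P.real {ω | ζ 0 ω = l} := fun l hl =>
    ENNReal.toReal_pos hl (measure_ne_top _ _)
  set u := a - b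
  set v := a' - b'
  set d := u 0 * v 1 - u 1 * v 0 with hd
  set p := P.real {ω | ζ 0 ω = a} * P.real {ω | ζ 0 ω = b} with hp
  set p' := P.real {ω | ζ 0 ω = a'} * P.real {ω | ζ 0 ω = b'} with hp'
  have hp0 : 0 < min p p' := lt_min (mul_pos (hpos a ha) (hpos b hb))
    (mul_pos (hpos a' ha') (hpos b' hb'))
  set K : ℝ := 2 * ((u 0 : ℝ) ^ 2 + u 1 ^ 2 + v 0 ^ 2 + v 1 ^ 2) + 1
  have hK : 0 < K := by positivity
  -- The square of the norm loses `min p p' / (4 * K)`; taking the square root halves the constant.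
  refine ⟨min p p' / (8 * K), by positivity, d, hdet, fun θ k => ?_⟩
  set x := dotZ θ u with hx
  set y := dotZ θ v with hy
  have hcx : 0 ≤ 1 - Real.cos x := by linarith [Real.cos_le_one x]
  have hcy : 0 ≤ 1 - Real.cos y := by linarith [Real.cos_le_one y]
  have e1 : (d : ℝ) * θ.1 = (v 1 : ℤ) * x + ((-u 1 : ℤ) : ℝ) * y := by
    simp only [hx, hy, dotZ, hd]; push_cast; ring
  have e2 : (d : ℝ) * θ.2 = ((-v 0 : ℤ) : ℝ) * x + (u 0 : ℤ) * y := by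
    simp only [hx, hy, dotZ, hd]; push_cast; ring
  have b1 : 1 - Real.cos (d * θ.1) ≤ K * ((1 - Real.cos x) + (1 - Real.cos y)) := by
    rw [e1]
    refine (one_sub_cos_add_le _ _).trans ?_
    have q1 := one_sub_cos_int_mul_le (v 1) x
    have q2 := one_sub_cos_int_mul_le (-u 1) y
    push_cast at q1 q2 ⊢
    have q3 : 2 * (v 1 : ℝ) ^ 2 ≤ K := by simp only [K]; nlinarith [sq_nonneg (u 0 : ℝ), sq_nonneg (u 1 : ℝ), sq_nonneg (v 0 : ℝ)]
    have q4 : 2 * (-(u 1 : ℝ)) ^ 2 ≤ K := by simp only [K]; nlinarith [sq_nonneg (u 0 : ℝ), sq_nonneg (v 1 : ℝ), sq_nonneg (v 0 : ℝ)]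
    nlinarith [mul_le_mul_of_nonneg_right q3 hcx, mul_le_mul_of_nonneg_right q4 hcy]
  have b2 : 1 - Real.cos (d * θ.2) ≤ K * ((1 - Real.cos x) + (1 - Real.cos y)) := by
    rw [e2]
    refine (one_sub_cos_add_le _ _).trans ?_
    have q1 := one_sub_cos_int_mul_le (-v 0) x
    have q2 := one_sub_cos_int_mul_le (u 0) y
    push_cast at q1 q2 ⊢
    have q3 : 2 * (-(v 0 : ℝ)) ^ 2 ≤ K := by simp only [K]; nlinarith [sq_nonneg (u 0 : ℝ), sq_nonneg (u 1 : ℝ), sq_nonneg (v 1 : ℝ)]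
    have q4 : 2 * (u 0 : ℝ) ^ 2 ≤ K := by simp only [K]; nlinarith [sq_nonneg (u 1 : ℝ), sq_nonneg (v 1 : ℝ), sq_nonneg (v 0 : ℝ)]
    nlinarith [mul_le_mul_of_nonneg_right q3 hcx, mul_le_mul_of_nonneg_right q4 hcy]
  set s := (1 - Real.cos (d * θ.1)) + (1 - Real.cos (d * θ.2)) with hs
  have c1 := sq_norm_stepCF_le (P := P) (h.meas 0) θ a b
  have c2 := sq_norm_stepCF_le (P := P) (h.meas 0) θ a' b'
  have c3 : ‖stepCF P (ζ 0) θ‖ ^ 2 ≤ 1 - min p p' / (4 * K) * s := by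
    have m1 : min p p' * (1 - Real.cos x) ≤ p * (1 - Real.cos x) := by gcongr; exact min_le_left _ _
    have m2 : min p p' * (1 - Real.cos y) ≤ p' * (1 - Real.cos y) := by gcongr; exact min_le_right _ _
    have m3 : s ≤ 2 * K * ((1 - Real.cos x) + (1 - Real.cos y)) := by linarith
    have m4 : min p p' / (4 * K) * s ≤
        min p p' / (4 * K) * (2 * K * ((1 - Real.cos x) + (1 - Real.cos y))) := by gcongr
    have m5 : min p p' / (4 * K) * (2 * K * ((1 - Real.cos x) + (1 - Real.cos y))) =
        (min p p' * (1 - Real.cos x) + min p p' * (1 - Real.cos y)) / 2 := by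
      field_simp; ring
    linarith
  have c4 : ‖stepCF P (ζ 0) θ‖ ≤ Real.exp (-(min p p' / (8 * K)) * s) := by
    refine (pow_le_pow_iff_left₀ (norm_nonneg _) (Real.exp_pos _).le two_ne_zero).1 ?_
    refine c3.trans ?_
    rw [← Real.exp_nat_mul]
    have := Real.add_one_le_exp (-(min p p' / (4 * K) * s))
    refine (le_trans (by linarith) this).trans (Real.exp_le_exp.2 (le_of_eq ?_))
    push_cast; field_simp; ring
  calc ‖stepCF P (ζ 0) θ‖ ^ k ≤ Real.exp (-(min p p' / (8 * K)) * s) ^ k := by gcongr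
    _ = _ := by
      rw [← Real.exp_nat_mul, ← Real.exp_add]; congr 1; simp only [hs]; ring

/-- The integral is bounded by the square of a one-dimensional integral of order `k ^ (-1/2)`. The
case `k = 0` is the total mass `4π²`. -/
theorem IsCenteredWalk.integral_norm_stepCF_pow_le (h : IsCenteredWalk P ζ) :
    ∃ C > 0, ∀ k : ℕ, ∫ θ, ‖stepCF P (ζ 0) θ‖ ^ k ∂torus ≤ C / (k + 1) := by
  obtain ⟨κ, hκ, d, hd, hb⟩ := h.exists_norm_stepCF_pow_le
  have hpi := Real.pi_pos
  refine ⟨4 * Real.pi ^ 2 + Real.pi ^ 3 / κ, by positivity, fun k => ?_⟩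
  rcases Nat.eq_zero_or_pos k with rfl | hk
  · have : torus.real Set.univ = 4 * Real.pi ^ 2 := by
      rw [torus_eq_prod, measureReal_def, ← Set.univ_prod_univ, Measure.prod_prod]
      simp [Real.volume_Ioc]
      rw [ENNReal.toReal_ofReal (by linarith)]; ring
    simp [this]; positivity
  have hk' : (0 : ℝ) < k := by exact_mod_cast hk
  have hint : Integrable (fun θ : ℝ × ℝ => Real.exp (-(k * κ) * (1 - Real.cos (d * θ.1))) *
        Real.exp (-(k * κ) * (1 - Real.cos (d * θ.2)))) torus := by
    refine Integrable.of_bound (C := 1) (by fun_prop) (ae_of_all _ fun θ => ?_)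
    rw [← Real.exp_add, Real.norm_eq_abs, Real.abs_exp, Real.exp_le_one_iff]
    have := Real.cos_le_one (d * θ.1)
    have := Real.cos_le_one (d * θ.2)
    have : 0 ≤ k * κ := by positivity
    nlinarith
  have hint0 : Integrable (fun θ : ℝ × ℝ => ‖stepCF P (ζ 0) θ‖ ^ k) torus := by
    have := continuous_stepCF (P := P) (h.meas 0)
    refine Integrable.of_bound (C := 1) (by fun_prop) (ae_of_all _ fun θ => ?_)
    rw [Real.norm_eq_abs, abs_of_nonneg (by positivity)]
    exact pow_le_one₀ (norm_nonneg _) (norm_stepCF_le _ _)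
  have hp : (0 : ℝ) < k * κ := by positivity
  calc ∫ θ, ‖stepCF P (ζ 0) θ‖ ^ k ∂torus
      ≤ ∫ θ : ℝ × ℝ, Real.exp (-(k * κ) * (1 - Real.cos (d * θ.1))) *
        Real.exp (-(k * κ) * (1 - Real.cos (d * θ.2))) ∂torus :=
        integral_mono hint0 hint fun θ => hb θ k
    _ = (∫ t in Set.Ioc (-Real.pi) Real.pi, Real.exp (-(k * κ) * (1 - Real.cos (d * t)))) *
        (∫ t in Set.Ioc (-Real.pi) Real.pi, Real.exp (-(k * κ) * (1 - Real.cos (d * t)))) := by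
        rw [torus_eq_prod]
        exact integral_prod_mul (fun t : ℝ => Real.exp (-(k * κ) * (1 - Real.cos (d * t))))
          (fun t : ℝ => Real.exp (-(k * κ) * (1 - Real.cos (d * t))))
    _ ≤ √(Real.pi ^ 3 / (2 * (k * κ))) * √(Real.pi ^ 3 / (2 * (k * κ))) := by
        have := integral_exp_neg_one_sub_cos_le hp hd
        gcongr
    _ = Real.pi ^ 3 / (2 * (k * κ)) := Real.mul_self_sqrt (by positivity)
    _ ≤ (Real.pi ^ 3 / κ) / (k + 1) := by
        rw [div_div]
        have : (1 : ℝ) ≤ k := by exact_mod_cast hk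
        refine div_le_div_of_nonneg_left (by positivity) (by positivity) ?_
        nlinarith
    _ ≤ _ := by gcongr; linarith [sq_nonneg Real.pi]

/-- The on-diagonal heat kernel bound. -/
theorem IsCenteredWalk.exists_walk_prob_le (h : IsCenteredWalk P ζ) :
    ∃ C > 0, ∀ (k : ℕ) (x : ZSq), P.real {ω | randomWalk ζ k ω = x} ≤ C / (k + 1) := by
  obtain ⟨C, hC, hb⟩ := h.integral_norm_stepCF_pow_le
  refine ⟨C, hC, fun k x => ?_⟩
  have h1 := congrArg norm (h.fourier_inversion k x)
  have h2 : ‖∫ θ, Complex.exp (-dotZ θ x * Complex.I) * stepCF P (ζ 0) θ ^ k ∂torus‖ ≤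
      C / (k + 1) := by
    refine (norm_integral_le_integral_norm _).trans (le_trans (le_of_eq ?_) (hb k))
    refine integral_congr_ae (ae_of_all _ fun θ => ?_)
    simp only [norm_mul, norm_pow]
    rw [show (-(dotZ θ x : ℂ)) = ((-dotZ θ x : ℝ) : ℂ) by push_cast; rfl,
      Complex.norm_exp_ofReal_mul_I, one_mul]
  rw [← h1, norm_mul, Complex.norm_real, Real.norm_eq_abs, abs_of_nonneg measureReal_nonneg] at h2
  have h3 : (1 : ℝ) ≤ ‖(4 * (Real.pi : ℂ) ^ 2)‖ := by
    rw [norm_mul, norm_pow, Complex.norm_real, Real.norm_eq_abs, abs_of_pos Real.pi_pos]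
    norm_num
    nlinarith [Real.pi_gt_three]
  exact (le_mul_of_one_le_right measureReal_nonneg h3).trans h2

end

noncomputable section

/-! ### Planar Gaussian integrals -/

/-- The binary quadratic form `a x² + 2 b x y + c y²`. -/
def quadForm (a b c : ℝ) (θ : ℝ × ℝ) : ℝ := a * θ.1 ^ 2 + 2 * b * θ.1 * θ.2 + c * θ.2 ^ 2

theorem continuous_quadForm (a b c : ℝ) : Continuous (quadForm a b c) := by
  unfold quadForm; fun_prop

/-- Determinant over trace is at most the smallest eigenvalue of a positive definite matrix. -/
theorem quadForm_lower_bound {a b c : ℝ} (ha : 0 < a) (hd : 0 < a * c - b ^ 2) (θ : ℝ × ℝ) :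
    (a * c - b ^ 2) / (a + c) * (θ.1 ^ 2 + θ.2 ^ 2) ≤ quadForm a b c θ := by
  have hc : 0 < c := by
    by_contra hc
    nlinarith [sq_nonneg b]
  rw [div_mul_eq_mul_div, div_le_iff₀ (by positivity), quadForm]
  nlinarith [sq_nonneg (a * θ.1 + b * θ.2), sq_nonneg (b * θ.1 + c * θ.2)]

theorem integrable_exp_neg_quadForm {a b c s : ℝ} (ha : 0 < a) (hd : 0 < a * c - b ^ 2)
    (hs : 0 < s) : Integrable fun θ : ℝ × ℝ => Real.exp (-(s * quadForm a b c θ / 2)) := by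
  have hc : 0 < c := by
    by_contra hc
    nlinarith [sq_nonneg b]
  set ε := (a * c - b ^ 2) / (a + c) with hε
  have hε0 : 0 < ε := by positivity
  have h1 : Integrable fun x : ℝ => Real.exp (-(s * ε / 2) * x ^ 2) :=
    integrable_exp_neg_mul_sq (by positivity)
  refine (h1.mul_prod h1).mono' ?_ (ae_of_all _ fun θ => ?_)
  · have := continuous_quadForm a b c
    exact Continuous.aestronglyMeasurable (by fun_prop)
  · rw [Real.norm_eq_abs, Real.abs_exp, ← Real.exp_add]
    refine Real.exp_le_exp.2 ?_
    have := mul_le_mul_of_nonneg_left (quadForm_lower_bound ha hd θ) hs.le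
    rw [← hε] at this
    linarith

theorem integral_exp_neg_quadForm {a b c s : ℝ} (ha : 0 < a) (hd : 0 < a * c - b ^ 2)
    (hs : 0 < s) : ∫ θ : ℝ × ℝ, Real.exp (-(s * quadForm a b c θ / 2)) =
      2 * Real.pi / (s * √(a * c - b ^ 2)) := by
  have hi := integrable_exp_neg_quadForm ha hd hs
  have hpi := Real.pi_pos
  rw [Measure.volume_eq_prod] at hi ⊢
  rw [integral_prod_symm _ hi]
  have h1 : ∀ y : ℝ, ∫ x : ℝ, Real.exp (-(s * quadForm a b c (x, y) / 2)) =
      √(Real.pi / (s * a / 2)) * Real.exp (-(s * ((a * c - b ^ 2) / a) / 2) * y ^ 2) := by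
    intro y
    have h2 : ∀ x : ℝ, Real.exp (-(s * quadForm a b c (x, y) / 2)) =
        Real.exp (-(s * a / 2) * (x + b * y / a) ^ 2) *
          Real.exp (-(s * ((a * c - b ^ 2) / a) / 2) * y ^ 2) := by
      intro x
      rw [← Real.exp_add]; congr 1; simp only [quadForm]; field_simp; ring
    simp_rw [h2]
    rw [integral_mul_const,
      integral_add_right_eq_self (fun x : ℝ => Real.exp (-(s * a / 2) * x ^ 2)), integral_gaussian]
  simp_rw [h1]
  rw [integral_const_mul, integral_gaussian, ← Real.sqrt_mul (by positivity),
    show Real.pi / (s * a / 2) * (Real.pi / (s * ((a * c - b ^ 2) / a) / 2)) =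
      (2 * Real.pi / s) ^ 2 / (a * c - b ^ 2) by field_simp,
    Real.sqrt_div (by positivity), Real.sqrt_sq (by positivity)]
  field_simp

/-! ### Second-order expansion of the characteristic function -/

/-- The Taylor remainder is cubic for small `x` and quadratic for large `x`. The truncation `min 1
|x|` keeps it integrable when only second moments exist. -/
theorem norm_exp_mul_I_sub_le (x : ℝ) :
    ‖Complex.exp (x * Complex.I) - (1 + x * Complex.I - x ^ 2 / 2)‖ ≤
      4 * (x ^ 2 * min 1 |x|) := by
  rcases le_total |x| 1 with hx | hx
  · rw [min_eq_right hx]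
    have h1 := Complex.exp_bound (x := x * Complex.I) (by simpa using hx) (n := 3) (by norm_num)
    have h2 : ∑ m ∈ Finset.range 3, (x * Complex.I) ^ m / (m.factorial : ℂ) =
        1 + x * Complex.I - x ^ 2 / 2 := by
      simp [Finset.sum_range_succ, mul_pow]; ring
    rw [h2] at h1
    refine h1.trans ?_
    simp only [norm_mul, Complex.norm_real, Complex.norm_I, mul_one, Real.norm_eq_abs]
    have : |x| ^ 3 = x ^ 2 * |x| := by rw [pow_succ, sq_abs]
    rw [this]
    have h0 : 0 ≤ x ^ 2 * |x| := by positivity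
    norm_num [Nat.factorial]
    nlinarith
  · rw [min_eq_left hx]
    have h1 : ‖Complex.exp (x * Complex.I)‖ = 1 := Complex.norm_exp_ofReal_mul_I x
    have h2 : ‖(1 + x * Complex.I - x ^ 2 / 2 : ℂ)‖ ≤ 1 + |x| + x ^ 2 / 2 := by
      refine (norm_sub_le _ _).trans (add_le_add ((norm_add_le _ _).trans ?_) ?_)
      · simp
      · simp
    have h3 := norm_sub_le (Complex.exp (x * Complex.I)) (1 + x * Complex.I - x ^ 2 / 2)
    have h4 : 1 ≤ |x| ^ 2 := one_le_pow₀ hx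
    rw [sq_abs] at h4
    have h5 : |x| ≤ x ^ 2 := by rw [← sq_abs]; nlinarith
    linarith

theorem abs_exp_neg_sub_le {x : ℝ} (h0 : 0 ≤ x) (h1 : x ≤ 1) :
    |Real.exp (-x) - (1 - x)| ≤ x ^ 2 := by
  have := Real.abs_exp_sub_one_sub_id_le (x := -x) (by rw [abs_neg, abs_of_nonneg h0]; exact h1)
  rw [neg_sq] at this
  refine le_trans (le_of_eq ?_) this
  congr 1; ring

variable {Ω : Type*} [MeasurableSpace Ω] {P : Measure Ω} [IsProbabilityMeasure P]
  {ζ : ℕ → Ω → ZSq}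

/-- The quadratic form of the covariance matrix of a centered step. -/
def stepQ (P : Measure Ω) (ξ : Ω → ZSq) (θ : ℝ × ℝ) : ℝ := ∫ ω, dotZ θ (ξ ω) ^ 2 ∂P

/-- Second moments of the step. -/
def stepM (P : Measure Ω) (ξ : Ω → ZSq) (i j : Fin 2) : ℝ := ∫ ω, (ξ ω i : ℝ) * (ξ ω j : ℝ) ∂P

namespace IsCenteredWalk

theorem integrable_mul (h : IsCenteredWalk P ζ) (i j : Fin 2) :
    Integrable (fun ω => (ζ 0 ω i : ℝ) * (ζ 0 ω j : ℝ)) P :=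
  (h.moment i).integrable_mul (h.moment j)

theorem integrable_dotZ_sq (h : IsCenteredWalk P ζ) (θ : ℝ × ℝ) :
    Integrable (fun ω => dotZ θ (ζ 0 ω) ^ 2) P := by
  have : (fun ω => dotZ θ (ζ 0 ω) ^ 2) = fun ω => θ.1 ^ 2 * ((ζ 0 ω 0 : ℝ) * (ζ 0 ω 0 : ℝ)) +
      2 * θ.1 * θ.2 * ((ζ 0 ω 0 : ℝ) * (ζ 0 ω 1 : ℝ)) +
      θ.2 ^ 2 * ((ζ 0 ω 1 : ℝ) * (ζ 0 ω 1 : ℝ)) := by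
    ext ω; simp only [dotZ]; ring
  rw [this]
  exact (((h.integrable_mul 0 0).const_mul _).add ((h.integrable_mul 0 1).const_mul _)).add
    ((h.integrable_mul 1 1).const_mul _)

theorem stepQ_eq (h : IsCenteredWalk P ζ) : stepQ P (ζ 0) =
    quadForm (stepM P (ζ 0) 0 0) (stepM P (ζ 0) 0 1) (stepM P (ζ 0) 1 1) := by
  ext θ
  have : (fun ω => dotZ θ (ζ 0 ω) ^ 2) = fun ω => θ.1 ^ 2 * ((ζ 0 ω 0 : ℝ) * (ζ 0 ω 0 : ℝ)) +
      2 * θ.1 * θ.2 * ((ζ 0 ω 0 : ℝ) * (ζ 0 ω 1 : ℝ)) +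
      θ.2 ^ 2 * ((ζ 0 ω 1 : ℝ) * (ζ 0 ω 1 : ℝ)) := by
    ext ω; simp only [dotZ]; ring
  have i1 : Integrable (fun ω => θ.1 ^ 2 * ((ζ 0 ω 0 : ℝ) * (ζ 0 ω 0 : ℝ)) +
      2 * θ.1 * θ.2 * ((ζ 0 ω 0 : ℝ) * (ζ 0 ω 1 : ℝ))) P :=
    ((h.integrable_mul 0 0).const_mul _).add ((h.integrable_mul 0 1).const_mul _)
  rw [stepQ, this, integral_add i1 ((h.integrable_mul 1 1).const_mul _),
    integral_add ((h.integrable_mul 0 0).const_mul _) ((h.integrable_mul 0 1).const_mul _),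
    integral_const_mul, integral_const_mul, integral_const_mul, quadForm]
  simp only [stepM]
  ring

theorem stepCov_det (h : IsCenteredWalk P ζ) : (stepCov P (ζ 0)).det =
    stepM P (ζ 0) 0 0 * stepM P (ζ 0) 1 1 - stepM P (ζ 0) 0 1 ^ 2 := by
  have hc : ∀ i j, stepCov P (ζ 0) i j = stepM P (ζ 0) i j := by
    intro i j
    simp only [stepCov, Matrix.of_apply]
    rw [covariance_eq_sub (h.moment i) (h.moment j), h.mean i, h.mean j]
    simp [stepM]
  have hs : stepM P (ζ 0) 1 0 = stepM P (ζ 0) 0 1 := by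
    simp only [stepM, mul_comm]
  rw [Matrix.det_fin_two]
  simp only [hc, hs]; ring

theorem stepQ_pos (h : IsCenteredWalk P ζ) {θ : ℝ × ℝ} (hθ : θ ≠ 0) : 0 < stepQ P (ζ 0) θ := by
  refine lt_of_le_of_ne (integral_nonneg fun ω => sq_nonneg _) fun h0 => hθ ?_
  have h1 := (integral_eq_zero_iff_of_nonneg (fun ω => sq_nonneg _)
    (h.integrable_dotZ_sq θ)).1 h0.symm
  refine h.dotZ_eq_zero (forall_stepSupport_of_ae (p := fun l => dotZ θ l = 0) ?_)
  filter_upwards [h1] with ω hω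
  simpa using hω

theorem stepM_pos (h : IsCenteredWalk P ζ) : 0 < stepM P (ζ 0) 0 0 := by
  have := h.stepQ_pos (θ := (1, 0)) (by simp)
  simpa [h.stepQ_eq, quadForm] using this

theorem det_pos (h : IsCenteredWalk P ζ) :
    0 < stepM P (ζ 0) 0 0 * stepM P (ζ 0) 1 1 - stepM P (ζ 0) 0 1 ^ 2 := by
  have h0 := h.stepM_pos
  have := h.stepQ_pos (θ := (-stepM P (ζ 0) 0 1, stepM P (ζ 0) 0 0)) (by simp [h0.ne'])
  rw [h.stepQ_eq, quadForm] at this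
  refine pos_of_mul_pos_right (a := stepM P (ζ 0) 0 0) ?_ h0.le
  linarith

/-- Neighbourhoods of the origin can thus be measured by the covariance form, whose sublevel sets
fit the Gaussian integrals below. -/
theorem exists_norm_sq_le (h : IsCenteredWalk P ζ) :
    ∃ K > 0, ∀ θ : ℝ × ℝ, ‖θ‖ ^ 2 ≤ K * stepQ P (ζ 0) θ := by
  have h0 := h.stepM_pos
  have hd := h.det_pos
  have hc : 0 < stepM P (ζ 0) 1 1 := by
    by_contra hc
    nlinarith [sq_nonneg (stepM P (ζ 0) 0 1)]
  set ε := (stepM P (ζ 0) 0 0 * stepM P (ζ 0) 1 1 - stepM P (ζ 0) 0 1 ^ 2) /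
    (stepM P (ζ 0) 0 0 + stepM P (ζ 0) 1 1) with hε
  have hε0 : 0 < ε := by positivity
  refine ⟨ε⁻¹, by positivity, fun θ => ?_⟩
  have h1 := quadForm_lower_bound h0 hd θ
  rw [← h.stepQ_eq, ← hε] at h1
  have h2 : ‖θ‖ ^ 2 ≤ θ.1 ^ 2 + θ.2 ^ 2 := by
    rw [Prod.norm_def]
    rcases max_cases ‖θ.1‖ ‖θ.2‖ with ⟨h, _⟩ | ⟨h, _⟩ <;> rw [h, Real.norm_eq_abs, sq_abs] <;>
      nlinarith [sq_nonneg θ.1, sq_nonneg θ.2]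
  rw [inv_mul_eq_div, le_div_iff₀ hε0]
  nlinarith

theorem continuous_stepQ (h : IsCenteredWalk P ζ) : Continuous (stepQ P (ζ 0)) := by
  rw [h.stepQ_eq]; exact continuous_quadForm _ _ _

theorem stepQ_nonneg (ξ : Ω → ZSq) (θ : ℝ × ℝ) : 0 ≤ stepQ P ξ θ :=
  integral_nonneg fun ω => sq_nonneg _

/-- The linear term vanishes by centering. The remainder is at most `4 ‖θ‖² E[W² min(1, ‖θ‖ W)]`,
and the expectation tends to zero by dominated convergence, with `W²` as dominating function. -/
theorem norm_stepCF_sub_le (h : IsCenteredWalk P ζ) {η : ℝ} (hη : 0 < η) :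
    ∃ δ > 0, ∀ θ : ℝ × ℝ, ‖θ‖ < δ →
      ‖stepCF P (ζ 0) θ - (1 - stepQ P (ζ 0) θ / 2)‖ ≤ η * ‖θ‖ ^ 2 := by
  set W : Ω → ℝ := fun ω => |(ζ 0 ω 0 : ℝ)| + |(ζ 0 ω 1 : ℝ)| with hW
  have hW2 : MemLp W 2 P := (h.moment 0).abs.add (h.moment 1).abs
  have hWi : Integrable (fun ω => W ω ^ 2) P := hW2.integrable_sq
  have hWm : AEStronglyMeasurable W P := hW2.1
  have hW0 : ∀ ω, 0 ≤ W ω := fun _ => by positivity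
  have hbound : ∀ r : ℝ, Integrable (fun ω => W ω ^ 2 * min 1 |r * W ω|) P := by
    intro r
    refine hWi.mono' (hWm.pow 2 |>.mul ?_) (ae_of_all _ fun ω => ?_)
    · exact (continuous_const.min continuous_abs).comp_aestronglyMeasurable (hWm.const_mul r)
    · rw [Real.norm_eq_abs, abs_of_nonneg (by positivity)]
      exact mul_le_of_le_one_right (sq_nonneg _) (min_le_left _ _)
  have hlim : Tendsto (fun r : ℝ => ∫ ω, W ω ^ 2 * min 1 |r * W ω| ∂P) (𝓝 0)
      (𝓝 (∫ ω, W ω ^ 2 * min 1 |0 * W ω| ∂P)) := by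
    refine tendsto_integral_filter_of_dominated_convergence (fun ω => W ω ^ 2)
      (Eventually.of_forall fun r => (hbound r).aestronglyMeasurable)
      (Eventually.of_forall fun r => ae_of_all _ fun ω => ?_) hWi (ae_of_all _ fun ω => ?_)
    · rw [Real.norm_eq_abs, abs_of_nonneg (by positivity)]
      exact mul_le_of_le_one_right (sq_nonneg _) (min_le_left _ _)
    · have : Continuous fun r : ℝ => W ω ^ 2 * min 1 |r * W ω| := by fun_prop
      exact this.tendsto 0
  simp only [zero_mul, abs_zero, min_eq_right zero_le_one, mul_zero, integral_zero] at hlim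
  obtain ⟨δ, hδ, hlt⟩ := Metric.eventually_nhds_iff.1 (hlim.eventually_lt_const
    (show (0 : ℝ) < η / 4 by positivity))
  refine ⟨δ, hδ, fun θ hθ => ?_⟩
  have hs := @hlt ‖θ‖ (by simpa using hθ)
  have hdot : ∀ ω, |dotZ θ (ζ 0 ω)| ≤ ‖θ‖ * W ω := by
    intro ω
    have h1 : |θ.1| ≤ ‖θ‖ := norm_fst_le θ
    have h2 : |θ.2| ≤ ‖θ‖ := norm_snd_le θ
    calc |dotZ θ (ζ 0 ω)| ≤ |θ.1| * |(ζ 0 ω 0 : ℝ)| + |θ.2| * |(ζ 0 ω 1 : ℝ)| := by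
          rw [← abs_mul, ← abs_mul]; exact abs_add_le _ _
      _ ≤ ‖θ‖ * |(ζ 0 ω 0 : ℝ)| + ‖θ‖ * |(ζ 0 ω 1 : ℝ)| := by gcongr
      _ = _ := by simp only [hW]; ring
  have hi1 : Integrable (fun ω => dotZ θ (ζ 0 ω)) P :=
    (((h.moment 0).integrable (by norm_num)).const_mul _).add
      (((h.moment 1).integrable (by norm_num)).const_mul _)
  have hcomb : Integrable (fun ω => (1 + dotZ θ (ζ 0 ω) * Complex.I -
      (dotZ θ (ζ 0 ω) : ℂ) ^ 2 / 2 : ℂ)) P := by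
    have := (h.integrable_dotZ_sq θ).ofReal (𝕜 := ℂ)
    simp only [Complex.coe_algebraMap, Complex.ofReal_pow] at this
    exact ((integrable_const _).add (hi1.ofReal.mul_const _)).sub (by simpa using this.div_const 2)
  have heq : stepCF P (ζ 0) θ - (1 - stepQ P (ζ 0) θ / 2) =
      ∫ ω, (Complex.exp (dotZ θ (ζ 0 ω) * Complex.I) - (1 + dotZ θ (ζ 0 ω) * Complex.I -
        (dotZ θ (ζ 0 ω) : ℂ) ^ 2 / 2)) ∂P := by
    rw [integral_sub (integrable_exp_dotZ (h.meas 0) θ) hcomb]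
    congr 1
    have e1 : ∫ ω, ((dotZ θ (ζ 0 ω) : ℂ) ^ 2 / 2) ∂P = (stepQ P (ζ 0) θ : ℂ) / 2 := by
      rw [integral_div, stepQ, ← integral_complex_ofReal]; simp
    have e2 : ∫ ω, (dotZ θ (ζ 0 ω) * Complex.I : ℂ) ∂P = 0 := by
      rw [integral_mul_const, integral_complex_ofReal, h.integral_dotZ]; simp
    have i2 : Integrable (fun ω => ((dotZ θ (ζ 0 ω) : ℂ) ^ 2 / 2)) P := by
      have := (h.integrable_dotZ_sq θ).ofReal (𝕜 := ℂ)
      simpa using this.div_const 2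
    have i3 : Integrable (fun ω => (1 + dotZ θ (ζ 0 ω) * Complex.I : ℂ)) P :=
      (integrable_const _).add (hi1.ofReal.mul_const _)
    rw [integral_sub i3 i2, e1, integral_add (integrable_const _) (hi1.ofReal.mul_const _), e2]
    simp
  rw [heq]
  calc ‖∫ ω, (Complex.exp (dotZ θ (ζ 0 ω) * Complex.I) - (1 + dotZ θ (ζ 0 ω) * Complex.I -
        (dotZ θ (ζ 0 ω) : ℂ) ^ 2 / 2)) ∂P‖
      ≤ ∫ ω, (4 * ‖θ‖ ^ 2) * (W ω ^ 2 * min 1 |‖θ‖ * W ω|) ∂P := by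
        refine norm_integral_le_of_norm_le ((hbound ‖θ‖).const_mul _) (ae_of_all _ fun ω => ?_)
        refine (norm_exp_mul_I_sub_le _).trans ?_
        have h3 := hdot ω
        have h4 : dotZ θ (ζ 0 ω) ^ 2 ≤ ‖θ‖ ^ 2 * W ω ^ 2 := by
          rw [← sq_abs, ← mul_pow]; gcongr
        have h5 : min 1 |dotZ θ (ζ 0 ω)| ≤ min 1 |‖θ‖ * W ω| :=
          min_le_min_left _ (h3.trans (le_abs_self _))
        calc 4 * (dotZ θ (ζ 0 ω) ^ 2 * min 1 |dotZ θ (ζ 0 ω)|)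
            ≤ 4 * ((‖θ‖ ^ 2 * W ω ^ 2) * min 1 |‖θ‖ * W ω|) := by gcongr
          _ = _ := by ring
    _ = (4 * ‖θ‖ ^ 2) * ∫ ω, W ω ^ 2 * min 1 |‖θ‖ * W ω| ∂P := integral_const_mul _ _
    _ ≤ (4 * ‖θ‖ ^ 2) * (η / 4) := by gcongr
    _ = _ := by ring

/-- Near the origin the characteristic function is that of the Gaussian law with the same
covariance, up to a relative error. -/
theorem norm_stepCF_sub_exp_le (h : IsCenteredWalk P ζ) {η : ℝ} (hη : 0 < η) :
    ∃ δ > 0, ∀ θ : ℝ × ℝ, stepQ P (ζ 0) θ < δ →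
      ‖stepCF P (ζ 0) θ - Real.exp (-(stepQ P (ζ 0) θ / 2))‖ ≤ η * stepQ P (ζ 0) θ := by
  obtain ⟨K, hK, hKb⟩ := h.exists_norm_sq_le
  obtain ⟨δ, hδ, hb⟩ := h.norm_stepCF_sub_le (η := η / (2 * K)) (by positivity)
  refine ⟨min (δ ^ 2 / K) (min 1 η), by positivity, fun θ hθ => ?_⟩
  set Q := stepQ P (ζ 0) θ with hQ
  have hQ0 : 0 ≤ Q := stepQ_nonneg _ _
  obtain ⟨hq1, hq2⟩ := lt_min_iff.1 hθ
  obtain ⟨hq2, hq3⟩ := lt_min_iff.1 hq2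
  have hθδ : ‖θ‖ < δ := by
    refine lt_of_pow_lt_pow_left₀ 2 hδ.le ((hKb θ).trans_lt ?_)
    rw [lt_div_iff₀ hK] at hq1; linarith
  have h1 := hb θ hθδ
  have h2 : η / (2 * K) * ‖θ‖ ^ 2 ≤ η / 2 * Q := by
    calc η / (2 * K) * ‖θ‖ ^ 2 ≤ η / (2 * K) * (K * Q) := by gcongr; exact hKb θ
      _ = _ := by field_simp
  have h3 := abs_exp_neg_sub_le (x := Q / 2) (by positivity) (by linarith)
  have h4 : ‖((1 - Q / 2 : ℝ) : ℂ) - (Real.exp (-(Q / 2)) : ℂ)‖ ≤ η / 2 * Q := by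
    rw [← Complex.ofReal_sub, Complex.norm_real, Real.norm_eq_abs, abs_sub_comm]
    refine h3.trans ?_
    nlinarith
  have h5 := norm_sub_le_norm_sub_add_norm_sub (stepCF P (ζ 0) θ) ((1 - Q / 2 : ℝ) : ℂ)
    (Real.exp (-(Q / 2)) : ℂ)
  push_cast at h1 h4 h5 ⊢
  linarith

end IsCenteredWalk

end

/-! ### Logarithmic growth of the Green function. -/

noncomputable section

variable {Ω : Type*} [MeasurableSpace Ω] {P : Measure Ω} [IsProbabilityMeasure P]
  {ζ : ℕ → Ω → ZSq}

theorem measurableSet_torusBox : MeasurableSet torusBox := measurableSet_Ioc.prod measurableSet_Ioc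

theorem torus_real_univ : torus.real Set.univ = 4 * Real.pi ^ 2 := by
  have hpi := Real.pi_pos
  rw [torus_eq_prod, measureReal_def, ← Set.univ_prod_univ, Measure.prod_prod]
  simp [Real.volume_Ioc]
  rw [ENNReal.toReal_ofReal (by linarith)]; ring

/-- `dotZ θ` modulo `2π`. -/
def angleHom (θ : ℝ × ℝ) : ZSq →+ Real.Angle := Real.Angle.coeHom.comp (dotZHom θ)

namespace IsCenteredWalk

/-- If `φ(θ) = 1` then `cos (θ·ζ) = 1` almost surely, so `θ·l ∈ 2πℤ` on the support, hence on all of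
`ℤ²`. Nothing is claimed about points where only `|φ| = 1`. -/
theorem eq_zero_of_stepCF_eq_one (h : IsCenteredWalk P ζ) {θ : ℝ × ℝ}
    (h1 : |θ.1| ≤ Real.pi) (h2 : |θ.2| ≤ Real.pi) (hθ : stepCF P (ζ 0) θ = 1) : θ = 0 := by
  have hpi := Real.pi_pos
  have hre : ∫ ω, (1 - Real.cos (dotZ θ (ζ 0 ω))) ∂P = 0 := by
    have hi := integrable_exp_dotZ (P := P) (h.meas 0) θ
    have h4 : ∫ ω, (Complex.exp (dotZ θ (ζ 0 ω) * Complex.I)).re ∂P = (stepCF P (ζ 0) θ).re :=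
      integral_re (𝕜 := ℂ) hi
    have hc : Integrable (fun ω => Real.cos (dotZ θ (ζ 0 ω))) P := by
      have := hi.re
      simpa only [Complex.exp_ofReal_mul_I_re, RCLike.re_eq_complex_re] using this
    simp only [Complex.exp_ofReal_mul_I_re] at h4
    rw [integral_sub (integrable_const _) hc, h4, hθ]
    simp
  have hc : Integrable (fun ω => 1 - Real.cos (dotZ θ (ζ 0 ω))) P := by
    have := (integrable_exp_dotZ (P := P) (h.meas 0) θ).re
    simp only [Complex.exp_ofReal_mul_I_re, RCLike.re_eq_complex_re] at this
    exact (integrable_const _).sub this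
  rw [integral_eq_zero_iff_of_nonneg
    (fun ω => by simpa using Real.cos_le_one _) hc] at hre
  have hs : ∀ l ∈ stepSupport P (ζ 0), angleHom θ l = 0 := by
    refine forall_stepSupport_of_ae (p := fun l => angleHom θ l = 0) ?_
    filter_upwards [hre] with ω hω
    have hω' : Real.cos (dotZ θ (ζ 0 ω)) = 1 := by
      simp only [Pi.zero_apply] at hω; linarith
    obtain ⟨n, hn⟩ := (Real.cos_eq_one_iff _).1 hω'
    change ((dotZ θ (ζ 0 ω) : ℝ) : Real.Angle) = 0
    rw [Real.Angle.coe_eq_zero_iff]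
    exact ⟨n, by rw [zsmul_eq_mul]; exact hn⟩
  have key : ∀ t : ℝ, |t| ≤ Real.pi → (t : Real.Angle) = 0 → t = 0 := by
    intro t ht h0
    obtain ⟨n, hn⟩ := Real.Angle.coe_eq_zero_iff.1 h0
    rw [zsmul_eq_mul] at hn
    have hn0 : n = 0 := by
      by_contra hne
      have : (1 : ℝ) ≤ |(n : ℝ)| := by exact_mod_cast Int.one_le_abs hne
      rw [← hn, abs_mul, abs_of_pos (by linarith : 0 < 2 * Real.pi)] at ht
      nlinarith
    simpa [hn0] using hn.symm
  have a0 := h.hom_eq_zero (angleHom θ) hs ![1, 0]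
  have a1 := h.hom_eq_zero (angleHom θ) hs ![0, 1]
  change ((dotZ θ ![1, 0] : ℝ) : Real.Angle) = 0 at a0
  change ((dotZ θ ![0, 1] : ℝ) : Real.Angle) = 0 at a1
  simp only [dotZ, Matrix.cons_val_zero, Matrix.cons_val_one, Int.cast_one, Int.cast_zero,
    mul_one, mul_zero, add_zero, zero_add] at a0 a1
  exact Prod.ext (key _ h1 a0) (key _ h2 a1)

/-- Compactness in `(r, θ)`: the equation `r φ(θ) = 1` with `|φ| ≤ 1` forces `r = 1` and `φ(θ) = 1`,
hence `θ = 0`. The endpoint `r = 1` is included, so the bound is uniform as `r` increases to one. -/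
theorem exists_far_bound (h : IsCenteredWalk P ζ) {δ : ℝ} (hδ : 0 < δ) :
    ∃ c > 0, ∀ r ∈ Set.Icc (0 : ℝ) 1, ∀ θ ∈ torusBox, δ ≤ stepQ P (ζ 0) θ →
      c ≤ ‖1 - r * stepCF P (ζ 0) θ‖ := by
  have hφ := continuous_stepCF (P := P) (h.meas 0)
  have hpos : ∀ r ∈ Set.Icc (0 : ℝ) 1, ∀ θ ∈ Set.Icc (-Real.pi) Real.pi ×ˢ
      Set.Icc (-Real.pi) Real.pi, δ ≤ stepQ P (ζ 0) θ → 1 - r * stepCF P (ζ 0) θ ≠ 0 := by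
    intro r hr θ hθ h3 h0
    have e1 : (r : ℂ) * stepCF P (ζ 0) θ = 1 := (sub_eq_zero.1 h0).symm
    have hn := congrArg norm e1
    rw [norm_mul, norm_one, Complex.norm_real, Real.norm_eq_abs, abs_of_nonneg hr.1] at hn
    have hle := norm_stepCF_le (P := P) (ζ 0) θ
    have hr1 : r = 1 := by
      refine le_antisymm hr.2 ?_
      rw [← hn]; exact mul_le_of_le_one_right hr.1 hle
    rw [hr1, Complex.ofReal_one, one_mul] at e1
    have := h.eq_zero_of_stepCF_eq_one (abs_le.2 hθ.1) (abs_le.2 hθ.2) e1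
    rw [this] at h3
    have h0 : stepQ P (ζ 0) 0 = 0 := by simp [stepQ, dotZ]
    linarith
  have hKc : IsCompact ((Set.Icc (0 : ℝ) 1) ×ˢ
      ((Set.Icc (-Real.pi) Real.pi ×ˢ Set.Icc (-Real.pi) Real.pi) ∩
        {θ | δ ≤ stepQ P (ζ 0) θ})) :=
    isCompact_Icc.prod ((isCompact_Icc.prod isCompact_Icc).inter_right
      (isClosed_le continuous_const h.continuous_stepQ))
  have hf : Continuous fun p : ℝ × (ℝ × ℝ) => ‖1 - p.1 * stepCF P (ζ 0) p.2‖ := by fun_prop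
  have hbox : ∀ θ ∈ torusBox, θ ∈ Set.Icc (-Real.pi) Real.pi ×ˢ Set.Icc (-Real.pi) Real.pi :=
    fun θ hθ => ⟨Set.Ioc_subset_Icc_self hθ.1, Set.Ioc_subset_Icc_self hθ.2⟩
  rcases Set.eq_empty_or_nonempty ((Set.Icc (0 : ℝ) 1) ×ˢ
      ((Set.Icc (-Real.pi) Real.pi ×ˢ Set.Icc (-Real.pi) Real.pi) ∩
        {θ | δ ≤ stepQ P (ζ 0) θ})) with he | hne
  · refine ⟨1, one_pos, fun r hr θ hθ hQ => ?_⟩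
    have hm : (r, θ) ∈ (Set.Icc (0 : ℝ) 1) ×ˢ
        ((Set.Icc (-Real.pi) Real.pi ×ˢ Set.Icc (-Real.pi) Real.pi) ∩
          {θ | δ ≤ stepQ P (ζ 0) θ}) := ⟨hr, hbox θ hθ, hQ⟩
    rw [he] at hm
    exact hm.elim
  · obtain ⟨p, hp, hmin⟩ := hKc.exists_isMinOn hne hf.continuousOn
    exact ⟨_, norm_pos_iff.2 (hpos p.1 hp.1 p.2 hp.2.1 hp.2.2), fun r hr θ hθ hQ =>
      hmin (show (r, θ) ∈ _ from ⟨hr, hbox θ hθ, hQ⟩)⟩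

/-- The denominators `1 - r φ` and `b = 1 - r exp(-Q/2)` differ by a small multiple of `Q`, and `b ≥
Q / 8`. The error is therefore relative, and survives integration against the singularity. -/
theorem exists_near_bound (h : IsCenteredWalk P ζ) (q : ZSq) {η : ℝ} (hη : 0 < η) :
    ∃ δ > 0, (∀ θ, stepQ P (ζ 0) θ < δ → θ ∈ torusBox) ∧
      ∀ r ∈ Set.Ico (1 / 2 : ℝ) 1, ∀ θ, stepQ P (ζ 0) θ < δ →
        ‖Complex.exp (-dotZ θ q * Complex.I) / (1 - r * stepCF P (ζ 0) θ) -
          ((1 - r * Real.exp (-(stepQ P (ζ 0) θ / 2)))⁻¹ : ℝ)‖ ≤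
            η * (1 - r * Real.exp (-(stepQ P (ζ 0) θ / 2)))⁻¹ := by
  obtain ⟨K, hK, hKb⟩ := h.exists_norm_sq_le
  set ε := min η 1 with hε
  have hε0 : 0 < ε := by positivity
  obtain ⟨δ₁, hδ₁, hb⟩ := h.norm_stepCF_sub_exp_le (η := ε / 32) (by positivity)
  set m : ℝ := |(q 0 : ℝ)| + |(q 1 : ℝ)| + 1 with hm
  have hm0 : 0 < m := by positivity
  -- The four terms give the expansion of the characteristic function, the estimate of `1 -
  -- exp(-Q/2)`, the inclusion `‖θ‖ < 3 < π` in the box, and the closeness of `exp(-iθ·q)` to one.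
  refine ⟨min δ₁ (min 1 (min (9 / K) ((ε / (4 * m)) ^ 2 / K))), by positivity, ?_, ?_⟩
  · intro θ hθ
    have h3 : stepQ P (ζ 0) θ < 9 / K :=
      hθ.trans_le ((min_le_right _ _).trans ((min_le_right _ _).trans (min_le_left _ _)))
    rw [lt_div_iff₀ hK] at h3
    have h4 : ‖θ‖ < 3 := by
      refine lt_of_pow_lt_pow_left₀ 2 (by norm_num) ((hKb θ).trans_lt ?_)
      linarith
    have h5 := abs_lt.1 ((norm_fst_le θ).trans_lt h4)
    have h6 := abs_lt.1 ((norm_snd_le θ).trans_lt h4)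
    have := Real.pi_gt_three
    exact ⟨⟨by linarith, by linarith⟩, ⟨by linarith, by linarith⟩⟩
  · intro r hr θ hθ
    set Q := stepQ P (ζ 0) θ with hQ
    have hQ0 : 0 ≤ Q := stepQ_nonneg _ _
    have q1 : Q < δ₁ := hθ.trans_le (min_le_left _ _)
    have q2 : Q < 1 := hθ.trans_le ((min_le_right _ _).trans (min_le_left _ _))
    have q3 : Q < (ε / (4 * m)) ^ 2 / K :=
      hθ.trans_le ((min_le_right _ _).trans ((min_le_right _ _).trans (min_le_right _ _)))
    have hθn : ‖θ‖ < ε / (4 * m) := by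
      rw [lt_div_iff₀ hK] at q3
      refine lt_of_pow_lt_pow_left₀ 2 (by positivity) ((hKb θ).trans_lt ?_)
      linarith
    have hdot : |dotZ θ q| ≤ ε / 4 := by
      have h1 : |θ.1| ≤ ‖θ‖ := norm_fst_le θ
      have h2 : |θ.2| ≤ ‖θ‖ := norm_snd_le θ
      calc |dotZ θ q| ≤ |θ.1| * |(q 0 : ℝ)| + |θ.2| * |(q 1 : ℝ)| := by
            rw [← abs_mul, ← abs_mul]; exact abs_add_le _ _
        _ ≤ ‖θ‖ * |(q 0 : ℝ)| + ‖θ‖ * |(q 1 : ℝ)| := by gcongr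
        _ ≤ ‖θ‖ * m := by simp only [hm]; nlinarith [norm_nonneg θ]
        _ ≤ ε / (4 * m) * m := by gcongr
        _ = ε / 4 := by field_simp
    set E := Complex.exp (-dotZ θ q * Complex.I) with hE
    have hE1 : ‖E - 1‖ ≤ ε / 4 := by
      have := Real.norm_exp_I_mul_ofReal_sub_one_le (x := -dotZ θ q)
      rw [norm_neg, Real.norm_eq_abs] at this
      refine le_trans (le_of_eq ?_) (this.trans hdot)
      rw [hE]; push_cast; ring_nf
    set e := Real.exp (-(Q / 2)) with he
    set b := 1 - r * e with hbdef
    have he1 : e ≤ 1 := Real.exp_le_one_iff.2 (by linarith)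
    have he0 : 0 < e := Real.exp_pos _
    have hr0 : 0 < r := by linarith [hr.1]
    have hb0 : 0 < b := by
      have : r * e < 1 := by nlinarith [hr.2]
      linarith
    -- Here `r ≥ 1/2` is used, through `1 - r e ≥ r (1 - e) ≥ Q / 8`.
    have hbQ : Q / 8 ≤ b := by
      have h3 := abs_le.1 (abs_exp_neg_sub_le (x := Q / 2) (by positivity) (by linarith))
      have h4 : Q / 4 ≤ 1 - e := by nlinarith [h3.2]
      have h5 : 1 / 2 * (1 - e) ≤ r * (1 - e) := by
        have := hr.1; gcongr
      have h6 := hr.2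
      nlinarith
    set w : ℂ := 1 - r * stepCF P (ζ 0) θ with hw
    have hwb : ‖(b : ℂ) - w‖ ≤ ε / 4 * b := by
      have : (b : ℂ) - w = r * (stepCF P (ζ 0) θ - e) := by
        rw [hbdef, hw]; push_cast; ring
      rw [this, norm_mul, Complex.norm_real, Real.norm_eq_abs, abs_of_pos hr0]
      have h7 := hb θ q1
      calc r * ‖stepCF P (ζ 0) θ - e‖ ≤ 1 * (ε / 32 * Q) := by
            have := hr.2; gcongr
        _ ≤ ε / 4 * b := by nlinarith
    have hεle : ε ≤ 1 := min_le_right _ _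
    have hwn : b / 2 ≤ ‖w‖ := by
      have h8 := norm_sub_norm_le (b : ℂ) w
      rw [Complex.norm_real, Real.norm_eq_abs, abs_of_pos hb0] at h8
      nlinarith
    have hw0 : w ≠ 0 := by
      intro h0; rw [h0, norm_zero] at hwn; linarith
    have hbc : (b : ℂ) ≠ 0 := by exact_mod_cast hb0.ne'
    have heq : E / w - ((b⁻¹ : ℝ) : ℂ) = ((E - 1) * b + (b - w)) / (w * b) := by
      push_cast; field_simp; ring
    rw [heq, norm_div, norm_mul, Complex.norm_real, Real.norm_eq_abs, abs_of_pos hb0,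
      div_le_iff₀ (by positivity)]
    have hnum : ‖(E - 1) * b + (b - w)‖ ≤ ε / 2 * b := by
      refine (norm_add_le _ _).trans ?_
      rw [norm_mul, Complex.norm_real, Real.norm_eq_abs, abs_of_pos hb0]
      nlinarith
    calc ‖(E - 1) * b + (b - w)‖ ≤ ε / 2 * b := hnum
      _ ≤ η / 2 * b := by gcongr; exact min_le_left _ _
      _ = η * b⁻¹ * (b / 2 * b) := by field_simp
      _ ≤ η * b⁻¹ * (‖w‖ * b) := by gcongr

/-- The constant `2π / √det`. -/
def gaussMass (P : Measure Ω) (ξ : Ω → ZSq) : ℝ := 2 * Real.pi / √(stepCov P ξ).det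

theorem gaussMass_pos (h : IsCenteredWalk P ζ) : 0 < gaussMass P (ζ 0) := by
  rw [gaussMass, h.stepCov_det]
  have := h.det_pos
  have := Real.pi_pos
  positivity

theorem integrable_exp_stepQ (h : IsCenteredWalk P ζ) {s : ℝ} (hs : 0 < s) :
    Integrable fun θ : ℝ × ℝ => Real.exp (-(s * stepQ P (ζ 0) θ / 2)) := by
  rw [h.stepQ_eq]; exact integrable_exp_neg_quadForm h.stepM_pos h.det_pos hs

theorem integral_exp_stepQ (h : IsCenteredWalk P ζ) {s : ℝ} (hs : 0 < s) :
    ∫ θ : ℝ × ℝ, Real.exp (-(s * stepQ P (ζ 0) θ / 2)) = gaussMass P (ζ 0) / s := by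
  rw [h.stepQ_eq, integral_exp_neg_quadForm h.stepM_pos h.det_pos hs, gaussMass, h.stepCov_det]
  have := Real.sqrt_pos.2 h.det_pos
  field_simp

/-- Off the neighbourhood `Q < δ` one has `exp(-(k+1)Q/2) ≤ exp(-δ/2)^k exp(-Q/2)`. The error of
replacing the neighbourhood by the plane is geometric in `k`, hence summable. -/
theorem abs_integral_exp_stepQ_sub_le (h : IsCenteredWalk P ζ) {δ : ℝ} (k : ℕ) :
    |(∫ θ in {θ | stepQ P (ζ 0) θ < δ}, Real.exp (-((k + 1 : ℕ) * stepQ P (ζ 0) θ / 2))) -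
      gaussMass P (ζ 0) / (k + 1 : ℕ)| ≤ gaussMass P (ζ 0) * Real.exp (-(δ / 2)) ^ k := by
  have hB : MeasurableSet {θ | stepQ P (ζ 0) θ < δ} :=
    (isOpen_lt h.continuous_stepQ continuous_const).measurableSet
  have hk : (0 : ℝ) < (k + 1 : ℕ) := by positivity
  have hi := h.integrable_exp_stepQ hk
  rw [← h.integral_exp_stepQ hk, ← integral_add_compl hB hi, sub_add_cancel_left, abs_neg,
    abs_of_nonneg (integral_nonneg fun θ => (Real.exp_pos _).le)]
  have h1 := h.integral_exp_stepQ one_pos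
  have hi1 := h.integrable_exp_stepQ one_pos
  rw [div_one] at h1
  rw [← h1, mul_comm, ← integral_const_mul]
  calc _ ≤ ∫ θ in {θ | stepQ P (ζ 0) θ < δ}ᶜ,
        Real.exp (-(δ / 2)) ^ k * Real.exp (-(1 * stepQ P (ζ 0) θ / 2)) := by
        refine setIntegral_mono_on hi.integrableOn (hi1.const_mul _).integrableOn hB.compl ?_
        intro θ hθ
        rw [← Real.exp_nat_mul, ← Real.exp_add]
        refine Real.exp_le_exp.2 ?_
        have hθ' : δ ≤ stepQ P (ζ 0) θ := by simpa using hθ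
        have : (k : ℝ) * δ ≤ k * stepQ P (ζ 0) θ := by gcongr
        push_cast; linarith
    _ ≤ _ := setIntegral_le_integral (hi1.const_mul _) (ae_of_all _ fun θ => by positivity)

/-- Expanding `(1 - r exp(-Q/2))⁻¹` in a geometric series turns the integral into `∑ r^k ∫
exp(-kQ/2)`. The Gaussian integrals are `gaussMass / k` up to summable errors, and `∑ r^k / k = -log
(1 - r)`. -/
theorem exists_near_integral (h : IsCenteredWalk P ζ) {δ : ℝ} (hδ : 0 < δ)
    (hbox : ∀ θ, stepQ P (ζ 0) θ < δ → θ ∈ torusBox) :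
    ∃ C, ∀ r ∈ Set.Ico (0 : ℝ) 1,
      |(∫ θ in {θ | stepQ P (ζ 0) θ < δ}, (1 - r * Real.exp (-(stepQ P (ζ 0) θ / 2)))⁻¹) -
        gaussMass P (ζ 0) * (-Real.log (1 - r))| ≤ C := by
  set G := gaussMass P (ζ 0) with hG
  have hG0 : 0 < G := h.gaussMass_pos
  set B := {θ | stepQ P (ζ 0) θ < δ} with hBdef
  set ρ := Real.exp (-(δ / 2)) with hρ
  have hρ1 : ρ < 1 := Real.exp_lt_one_iff.2 (by linarith)
  have hρ0 : 0 < ρ := Real.exp_pos _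
  have hBfin : volume B ≠ ⊤ := by
    have : volume B ≤ volume torusBox := measure_mono hbox
    refine (this.trans_lt ?_).ne
    have := measure_lt_top torus Set.univ
    rwa [torus, Measure.restrict_apply_univ] at this
  have : IsFiniteMeasure (volume.restrict B) := ⟨by
    rw [Measure.restrict_apply_univ]; exact hBfin.lt_top⟩
  have hQc := h.continuous_stepQ
  set a : ℕ → ℝ := fun k => ∫ θ in B, Real.exp (-(k * stepQ P (ζ 0) θ / 2)) with ha
  refine ⟨|a 0| + G * (1 - ρ)⁻¹, fun r hr => ?_⟩
  have hexp1 : ∀ k : ℕ, ∀ θ, Real.exp (-(k * stepQ P (ζ 0) θ / 2)) ≤ 1 := by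
    intro k θ
    have := stepQ_nonneg (P := P) (ζ 0) θ
    exact Real.exp_le_one_iff.2 (by simp; positivity)
  have hFi : ∀ k : ℕ, Integrable (fun θ => r ^ k * Real.exp (-(k * stepQ P (ζ 0) θ / 2)))
      (volume.restrict B) := by
    intro k
    refine Integrable.of_bound (C := r ^ k) (by fun_prop) (ae_of_all _ fun θ => ?_)
    have hr0 := hr.1
    rw [Real.norm_eq_abs, abs_of_nonneg (by positivity)]
    exact mul_le_of_le_one_right (by positivity) (hexp1 k θ)
  have hsum : HasSum (fun k : ℕ => r ^ k * a k)
      (∫ θ in B, (1 - r * Real.exp (-(stepQ P (ζ 0) θ / 2)))⁻¹) := by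
    have h1 := hasSum_integral_of_summable_integral_norm (μ := volume.restrict B)
      (F := fun (k : ℕ) θ => r ^ k * Real.exp (-(k * stepQ P (ζ 0) θ / 2))) hFi (by
        refine Summable.of_nonneg_of_le (fun k => integral_nonneg fun θ => norm_nonneg _)
          (fun k => ?_) ((summable_geometric_of_lt_one hr.1 hr.2).mul_right
            ((volume.restrict B).real Set.univ))
        have hr0 := hr.1
        calc _ ≤ ∫ _ in B, r ^ k := by
              refine integral_mono (hFi k).norm (integrable_const _) fun θ => ?_
              simp only
              rw [Real.norm_eq_abs, abs_of_nonneg (by positivity)]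
              exact mul_le_of_le_one_right (by positivity) (hexp1 k θ)
          _ = _ := by simp [mul_comm])
    have e1 : (fun k : ℕ => r ^ k * a k) = fun k : ℕ =>
        ∫ θ in B, r ^ k * Real.exp (-(k * stepQ P (ζ 0) θ / 2)) :=
      funext fun k => (integral_const_mul _ _).symm
    have e2 : ∫ θ in B, (1 - r * Real.exp (-(stepQ P (ζ 0) θ / 2)))⁻¹ =
        ∫ θ in B, ∑' k : ℕ, r ^ k * Real.exp (-(k * stepQ P (ζ 0) θ / 2)) := by
      refine integral_congr_ae (ae_of_all _ fun θ => ?_)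
      have hr0 := hr.1
      have he1 : Real.exp (-(stepQ P (ζ 0) θ / 2)) ≤ 1 := by simpa using hexp1 1 θ
      have hlt : r * Real.exp (-(stepQ P (ζ 0) θ / 2)) < 1 :=
        (mul_le_of_le_one_right hr0 he1).trans_lt hr.2
      simp only
      rw [← tsum_geometric_of_lt_one (by positivity) hlt]
      refine tsum_congr fun k => ?_
      rw [mul_pow, ← Real.exp_nat_mul]; congr 2; ring
    rw [e1, e2]; exact h1
  have hlog := (Real.hasSum_pow_div_log_of_abs_lt_one
    (x := r) (by rw [abs_of_nonneg hr.1]; exact hr.2)).mul_left G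
  -- The term `k = 0` is set aside, since it has no Gaussian counterpart on the plane; it is bounded
  -- by the finite area of the neighbourhood.
  have hsum' := (hasSum_nat_add_iff' 1).2 hsum
  simp only [Finset.range_one, Finset.sum_singleton, pow_zero, one_mul] at hsum'
  have hdiff := hsum'.sub hlog
  have hterm : ∀ k : ℕ, |r ^ (k + 1) * a (k + 1) - G * (r ^ (k + 1) / (k + 1))| ≤ G * ρ ^ k := by
    intro k
    have h2 := h.abs_integral_exp_stepQ_sub_le (δ := δ) k
    have hr0 := hr.1
    rw [show r ^ (k + 1) * a (k + 1) - G * (r ^ (k + 1) / (k + 1)) =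
      r ^ (k + 1) * (a (k + 1) - G / (k + 1 : ℕ)) by push_cast; ring, abs_mul,
      abs_of_nonneg (by positivity)]
    exact (mul_le_of_le_one_left (abs_nonneg _) (pow_le_one₀ hr0 hr.2.le)).trans h2
  have hgeo : HasSum (fun k : ℕ => G * ρ ^ k) (G * (1 - ρ)⁻¹) :=
    (hasSum_geometric_of_lt_one hρ0.le hρ1).mul_left G
  have hle : |(∫ θ in B, (1 - r * Real.exp (-(stepQ P (ζ 0) θ / 2)))⁻¹) - a 0 -
      G * (-Real.log (1 - r))| ≤ G * (1 - ρ)⁻¹ := by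
    rw [← hdiff.tsum_eq, ← hgeo.tsum_eq, ← Real.norm_eq_abs]
    exact tsum_of_norm_bounded hgeo hterm |>.trans (le_of_eq hgeo.tsum_eq.symm)
  have := abs_add_le ((∫ θ in B, (1 - r * Real.exp (-(stepQ P (ζ 0) θ / 2)))⁻¹) - a 0 -
      G * (-Real.log (1 - r))) (a 0)
  rw [show (∫ θ in B, (1 - r * Real.exp (-(stepQ P (ζ 0) θ / 2)))⁻¹) - a 0 -
      G * (-Real.log (1 - r)) + a 0 = (∫ θ in B, (1 - r * Real.exp (-(stepQ P (ζ 0) θ / 2)))⁻¹) -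
      G * (-Real.log (1 - r)) by ring] at this
  linarith

/-- Geometric series in `r φ(θ)` combined with Fourier inversion; the damping `r < 1` makes the
interchange of sum and integral absolutely convergent. -/
theorem hasSum_green (h : IsCenteredWalk P ζ) (q : ZSq) {r : ℝ} (hr : r ∈ Set.Ico (0 : ℝ) 1) :
    HasSum (fun k : ℕ => ((r ^ k * P.real {ω | randomWalk ζ k ω = q} * (4 * Real.pi ^ 2) : ℝ) : ℂ))
      (∫ θ, Complex.exp (-dotZ θ q * Complex.I) / (1 - r * stepCF P (ζ 0) θ) ∂torus) := by
  have hφ := continuous_stepCF (P := P) (h.meas 0)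
  have hd := continuous_dotZ_left q
  have hr0 := hr.1
  have hn : ∀ (k : ℕ) θ, ‖(r : ℂ) ^ k * (Complex.exp (-dotZ θ q * Complex.I) *
      stepCF P (ζ 0) θ ^ k)‖ ≤ r ^ k := by
    intro k θ
    rw [norm_mul, norm_mul, norm_pow, norm_pow, Complex.norm_real, Real.norm_eq_abs,
      abs_of_nonneg hr0, show (-(dotZ θ q : ℂ)) = ((-dotZ θ q : ℝ) : ℂ) by push_cast; rfl,
      Complex.norm_exp_ofReal_mul_I, one_mul]
    exact mul_le_of_le_one_right (by positivity)
      (pow_le_one₀ (norm_nonneg _) (norm_stepCF_le _ _))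
  have hFi : ∀ k : ℕ, Integrable (fun θ => (r : ℂ) ^ k * (Complex.exp (-dotZ θ q * Complex.I) *
      stepCF P (ζ 0) θ ^ k)) torus := fun k =>
    Integrable.of_bound (C := r ^ k) (by fun_prop) (ae_of_all _ (hn k))
  have h1 := hasSum_integral_of_summable_integral_norm hFi (by
    refine Summable.of_nonneg_of_le (fun k => integral_nonneg fun θ => norm_nonneg _)
      (fun k => ?_) ((summable_geometric_of_lt_one hr.1 hr.2).mul_right (torus.real Set.univ))
    calc _ ≤ ∫ _, r ^ k ∂torus := integral_mono (hFi k).norm (integrable_const _) (hn k)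
      _ = _ := by simp [mul_comm])
  have e1 : (fun k : ℕ =>
      ((r ^ k * P.real {ω | randomWalk ζ k ω = q} * (4 * Real.pi ^ 2) : ℝ) : ℂ)) = fun k : ℕ =>
        ∫ θ, (r : ℂ) ^ k * (Complex.exp (-dotZ θ q * Complex.I) * stepCF P (ζ 0) θ ^ k) ∂torus := by
    ext k
    rw [integral_const_mul, ← h.fourier_inversion]; push_cast; ring
  have e2 : ∫ θ, Complex.exp (-dotZ θ q * Complex.I) / (1 - r * stepCF P (ζ 0) θ) ∂torus =
      ∫ θ, ∑' k : ℕ, (r : ℂ) ^ k * (Complex.exp (-dotZ θ q * Complex.I) *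
        stepCF P (ζ 0) θ ^ k) ∂torus := by
    refine integral_congr_ae (ae_of_all _ fun θ => ?_)
    have hlt : ‖(r : ℂ) * stepCF P (ζ 0) θ‖ < 1 := by
      rw [norm_mul, Complex.norm_real, Real.norm_eq_abs, abs_of_nonneg hr0]
      exact (mul_le_of_le_one_right hr0 (norm_stepCF_le _ _)).trans_lt hr.2
    simp only
    rw [div_eq_mul_inv, ← tsum_geometric_of_norm_lt_one hlt, ← tsum_mul_left]
    refine tsum_congr fun k => ?_
    rw [mul_pow]; ring
  rw [e1, e2]; exact h1

/-- The torus integral splits into the neighbourhood `Q < δ`, where comparison with the Gaussian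
kernel gives the logarithm up to a relative error, and its complement, where the integrand is
bounded uniformly in `r`. -/
theorem exists_green_bound (h : IsCenteredWalk P ζ) (q : ZSq) {η : ℝ} (hη : 0 < η) :
    ∃ C, ∀ r ∈ Set.Ico (1 / 2 : ℝ) 1,
      |∑' k : ℕ, r ^ k * P.real {ω | randomWalk ζ k ω = q} * (4 * Real.pi ^ 2) -
        gaussMass P (ζ 0) * (-Real.log (1 - r))| ≤ η * (-Real.log (1 - r)) + C := by
  set G := gaussMass P (ζ 0) with hG
  have hG0 : 0 < G := h.gaussMass_pos
  obtain ⟨δ, hδ, hbox, hnear⟩ := h.exists_near_bound q (η := η / G) (by positivity)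
  obtain ⟨c, hc, hfar⟩ := h.exists_far_bound hδ
  obtain ⟨C₁, hC₁⟩ := h.exists_near_integral hδ hbox
  set B := {θ | stepQ P (ζ 0) θ < δ} with hBdef
  have hB : MeasurableSet B := (isOpen_lt h.continuous_stepQ continuous_const).measurableSet
  refine ⟨η / G * C₁ + C₁ + c⁻¹ * (4 * Real.pi ^ 2), fun r hr => ?_⟩
  have hr0 : 0 < r := by linarith [hr.1]
  have hr' : r ∈ Set.Ico (0 : ℝ) 1 := ⟨hr0.le, hr.2⟩
  set L := -Real.log (1 - r) with hL
  have hs := h.hasSum_green q hr'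
  have hs' := hs.tsum_eq
  rw [← Complex.ofReal_tsum] at hs'
  have hφ := continuous_stepCF (P := P) (h.meas 0)
  have hd := continuous_dotZ_left q
  have hQc := h.continuous_stepQ
  set f : ℝ × ℝ → ℂ := fun θ => Complex.exp (-dotZ θ q * Complex.I) /
    (1 - r * stepCF P (ζ 0) θ) with hf
  set g : ℝ × ℝ → ℝ := fun θ => (1 - r * Real.exp (-(stepQ P (ζ 0) θ / 2)))⁻¹ with hg
  have hEn : ∀ θ, ‖Complex.exp (-dotZ θ q * Complex.I)‖ = 1 := fun θ => by
    rw [show (-(dotZ θ q : ℂ)) = ((-dotZ θ q : ℝ) : ℂ) by push_cast; rfl,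
      Complex.norm_exp_ofReal_mul_I]
  have hden : ∀ θ, 1 - r ≤ ‖1 - r * stepCF P (ζ 0) θ‖ := fun θ => by
    have h1 := norm_sub_norm_le (1 : ℂ) (r * stepCF P (ζ 0) θ)
    rw [norm_one, norm_mul, Complex.norm_real, Real.norm_eq_abs, abs_of_pos hr0] at h1
    have := mul_le_of_le_one_right hr0.le (norm_stepCF_le (P := P) (ζ 0) θ)
    linarith
  have h1r : 0 < 1 - r := by linarith [hr.2]
  have hfc : Continuous f := by
    refine Continuous.div (by fun_prop) (by fun_prop) fun θ h0 => ?_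
    have := hden θ
    rw [h0, norm_zero] at this
    linarith
  have hfi : Integrable f torus := by
    refine Integrable.of_bound (C := (1 - r)⁻¹) hfc.aestronglyMeasurable (ae_of_all _ fun θ => ?_)
    rw [hf, norm_div, hEn, one_div]
    exact inv_anti₀ h1r (hden θ)
  have hexp1 : ∀ θ, Real.exp (-(stepQ P (ζ 0) θ / 2)) ≤ 1 := fun θ => by
    have := stepQ_nonneg (P := P) (ζ 0) θ
    exact Real.exp_le_one_iff.2 (by linarith)
  have hgden : ∀ θ, 1 - r ≤ 1 - r * Real.exp (-(stepQ P (ζ 0) θ / 2)) := fun θ => by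
    have := mul_le_of_le_one_right hr0.le (hexp1 θ)
    linarith
  have hgc : Continuous g := by
    refine Continuous.inv₀ (by fun_prop) fun θ h0 => ?_
    have := hgden θ
    rw [h0] at this
    linarith
  have hres : torus.restrict B = volume.restrict B := by
    rw [torus, Measure.restrict_restrict hB, Set.inter_eq_left.2 (fun θ hθ => hbox θ hθ : B ⊆ torusBox)]
  have hgi : Integrable g (torus.restrict B) := by
    refine Integrable.of_bound (C := (1 - r)⁻¹) hgc.aestronglyMeasurable (ae_of_all _ fun θ => ?_)
    have h2 := hgden θ
    rw [hg, Real.norm_eq_abs, abs_of_nonneg (inv_nonneg.2 (h1r.le.trans h2))]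
    exact inv_anti₀ h1r h2
  have hgi' : IntegrableOn g B := by rwa [hres] at hgi
  have hJ := hC₁ r hr'
  set J := ∫ θ in B, g θ with hJdef
  have hnearI : ‖(∫ θ in B, f θ ∂torus) - (J : ℂ)‖ ≤ η / G * J := by
    have e1 : (J : ℂ) = ∫ θ in B, (g θ : ℂ) ∂torus := by
      rw [hJdef, ← hres, ← integral_complex_ofReal]
    have hgC : Integrable (fun θ => (g θ : ℂ)) (torus.restrict B) := hgi.ofReal
    have hfB : Integrable f (torus.restrict B) := hfi.integrableOn
    rw [e1, ← integral_sub hfB hgC]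
    calc _ ≤ ∫ θ in B, η / G * g θ ∂torus := by
          refine norm_integral_le_of_norm_le (hgi.const_mul _) ?_
          filter_upwards [ae_restrict_mem hB] with θ hθ
          exact hnear r hr θ hθ
      _ = η / G * J := by rw [integral_const_mul, hres]
  have hfarI : ‖∫ θ in Bᶜ, f θ ∂torus‖ ≤ c⁻¹ * (4 * Real.pi ^ 2) := by
    calc _ ≤ ∫ _ in Bᶜ, c⁻¹ ∂torus := by
          refine norm_integral_le_of_norm_le (integrable_const _) ?_
          have hT : ∀ᵐ θ ∂torus, θ ∈ torusBox := ae_restrict_mem measurableSet_torusBox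
          filter_upwards [ae_restrict_mem hB.compl, ae_restrict_of_ae hT] with θ hθ hθT
          rw [hf, norm_div, hEn, one_div]
          exact inv_anti₀ hc (hfar r ⟨hr0.le, hr.2.le⟩ θ hθT (not_lt.1 hθ))
      _ ≤ c⁻¹ * (4 * Real.pi ^ 2) := by
          rw [setIntegral_const, smul_eq_mul, mul_comm, ← torus_real_univ]
          gcongr
          · exact measure_ne_top _ _
          · exact Set.subset_univ _
  have htot : ‖((∑' k : ℕ, r ^ k * P.real {ω | randomWalk ζ k ω = q} * (4 * Real.pi ^ 2) - J : ℝ)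
      : ℂ)‖ ≤ η / G * J + c⁻¹ * (4 * Real.pi ^ 2) := by
    rw [Complex.ofReal_sub, hs', ← integral_add_compl hB hfi,
      show (∫ θ in B, f θ ∂torus) + (∫ θ in Bᶜ, f θ ∂torus) - (J : ℂ) =
        ((∫ θ in B, f θ ∂torus) - (J : ℂ)) + ∫ θ in Bᶜ, f θ ∂torus by ring]
    exact (norm_add_le _ _).trans (add_le_add hnearI hfarI)
  rw [Complex.norm_real, Real.norm_eq_abs] at htot
  have hJ' : J ≤ G * L + C₁ := by linarith [(abs_le.1 hJ).2]
  have hJ'' : η / G * J ≤ η * L + η / G * C₁ := by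
    calc η / G * J ≤ η / G * (G * L + C₁) := by gcongr
      _ = _ := by field_simp
  have := abs_sub_le (∑' k : ℕ, r ^ k * P.real {ω | randomWalk ζ k ω = q} * (4 * Real.pi ^ 2)) J
    (G * L)
  linarith

/-- The truncated Green function of the walk grows like `log n / (2π √det)`. -/
theorem tendsto_green (h : IsCenteredWalk P ζ) (q : ZSq) :
    Tendsto (fun n : ℕ => (∑ k ∈ Finset.range n, P.real {ω | randomWalk ζ k ω = q}) / Real.log n)
      atTop (𝓝 (gaussMass P (ζ 0) / (4 * Real.pi ^ 2))) := by
  obtain ⟨C, hC, hp⟩ := h.exists_walk_prob_le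
  set p : ℕ → ℝ := fun k => P.real {ω | randomWalk ζ k ω = q} with hpdef
  have hp0 : ∀ k, 0 ≤ p k := fun k => measureReal_nonneg
  have hpi := Real.pi_pos
  -- The Tauberian step, with `r = 1 - 1/n` and `p k ≤ C / (k + 1)`. Below `n` each term changes by
  -- at most `(k/n) · C/(k+1) ≤ C/n`; beyond `n` the terms are at most `C/n` times a geometric
  -- series of sum `n`.
  have hcmp : ∀ n : ℕ, 2 ≤ n →
      |∑ k ∈ Finset.range n, p k - ∑' k, (1 - (n : ℝ)⁻¹) ^ k * p k| ≤ 2 * C := by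
    intro n hn
    have hn0 : (0 : ℝ) < n := by positivity
    have hn1 : (1 : ℝ) ≤ n := by exact_mod_cast (by omega : 1 ≤ n)
    set r := 1 - (n : ℝ)⁻¹ with hr
    have hr0 : 0 ≤ r := by rw [hr, sub_nonneg]; exact inv_le_one_of_one_le₀ hn1
    have hr1 : r < 1 := by rw [hr]; linarith [inv_pos.2 hn0]
    have hsm : Summable fun k => r ^ k * p k := by
      refine Summable.of_nonneg_of_le (fun k => by have := hp0 k; positivity) (fun k => ?_)
        (summable_geometric_of_lt_one hr0 hr1)
      exact mul_le_of_le_one_right (by positivity) measureReal_le_one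
    rw [← hsm.sum_add_tsum_nat_add n]
    have h1 : |∑ k ∈ Finset.range n, p k - ∑ k ∈ Finset.range n, r ^ k * p k| ≤ C := by
      rw [← Finset.sum_sub_distrib]
      refine (Finset.abs_sum_le_sum_abs _ _).trans ?_
      calc _ ≤ ∑ _k ∈ Finset.range n, (n : ℝ)⁻¹ * C := by
            refine Finset.sum_le_sum fun k _ => ?_
            have hb := one_add_mul_le_pow (a := r - 1) (by linarith) k
            rw [show 1 + (r - 1) = r by ring] at hb
            have hle : r ^ k ≤ 1 := pow_le_one₀ hr0 hr1.le
            rw [show p k - r ^ k * p k = (1 - r ^ k) * p k by ring,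
              abs_of_nonneg (mul_nonneg (by linarith) (hp0 k))]
            have hb' : 1 - r ^ k ≤ k * (n : ℝ)⁻¹ := by
              rw [hr] at hb ⊢; linarith
            calc (1 - r ^ k) * p k ≤ (k * (n : ℝ)⁻¹) * (C / (k + 1)) := by
                  gcongr; exact hp k q
              _ = (n : ℝ)⁻¹ * C * (k / (k + 1)) := by ring
              _ ≤ (n : ℝ)⁻¹ * C * 1 := by
                  gcongr; rw [div_le_one (by positivity)]; linarith
              _ = _ := mul_one _
        _ = C := by simp; field_simp
    have h2 : ∑' k, r ^ (k + n) * p (k + n) ≤ C := by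
      have hgeo := (hasSum_geometric_of_lt_one hr0 hr1).mul_right (C * (n : ℝ)⁻¹)
      have : (1 - r)⁻¹ * (C * (n : ℝ)⁻¹) = C := by rw [hr]; field_simp; simp
      rw [this] at hgeo
      rw [← hgeo.tsum_eq]
      refine Summable.tsum_le_tsum (fun k => ?_) ((summable_nat_add_iff n).2 hsm) hgeo.summable
      have h3 := hp (k + n) q
      have h4 : C / ((k + n : ℕ) + 1) ≤ C * (n : ℝ)⁻¹ := by
        rw [div_eq_mul_inv]; gcongr; push_cast; linarith [(Nat.cast_nonneg k : (0 : ℝ) ≤ k)]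
      have h5 : r ^ (k + n) ≤ r ^ k := pow_le_pow_of_le_one hr0 hr1.le (by omega)
      have := hp0 (k + n)
      exact mul_le_mul h5 (h3.trans h4) this (by positivity)
    have h3 : 0 ≤ ∑' k, r ^ (k + n) * p (k + n) :=
      tsum_nonneg fun k => by have := hp0 (k + n); positivity
    rw [← sub_sub]
    refine (abs_sub _ _).trans ?_
    rw [abs_of_nonneg h3]
    linarith
  rw [Metric.tendsto_atTop]
  intro ε hε
  obtain ⟨C₁, hC₁⟩ := h.exists_green_bound q (η := ε) hε
  have hlog : Tendsto (fun n : ℕ => Real.log n) atTop atTop :=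
    Real.tendsto_log_atTop.comp tendsto_natCast_atTop_atTop
  have hev := hlog.eventually_gt_atTop ((4 * Real.pi ^ 2 * (2 * C) + |C₁|) / ε + 1)
  obtain ⟨N, hN⟩ := (hev.and (eventually_ge_atTop 2)).exists_forall_of_atTop
  refine ⟨N, fun n hn => ?_⟩
  obtain ⟨hl, hn2⟩ := hN n hn
  have hn0 : (0 : ℝ) < n := by positivity
  have hn2' : (2 : ℝ) ≤ n := by exact_mod_cast hn2
  have hinv : (n : ℝ)⁻¹ ≤ 1 / 2 := by rw [one_div]; exact inv_anti₀ two_pos hn2'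
  have hb := hC₁ (1 - (n : ℝ)⁻¹) ⟨by linarith, by linarith [inv_pos.2 hn0]⟩
  rw [show 1 - (1 - (n : ℝ)⁻¹) = (n : ℝ)⁻¹ by ring, Real.log_inv, neg_neg, tsum_mul_right] at hb
  have hc := hcmp n hn2
  set S := ∑ k ∈ Finset.range n, p k
  set g := ∑' k, (1 - (n : ℝ)⁻¹) ^ k * p k
  set G := gaussMass P (ζ 0)
  have hl0 : 0 < Real.log n := lt_trans (by positivity) hl
  have hkey : |4 * Real.pi ^ 2 * S - G * Real.log n| ≤
      ε * Real.log n + (4 * Real.pi ^ 2 * (2 * C) + |C₁|) := by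
    have h1 : |4 * Real.pi ^ 2 * S - g * (4 * Real.pi ^ 2)| ≤ 4 * Real.pi ^ 2 * (2 * C) := by
      rw [show 4 * Real.pi ^ 2 * S - g * (4 * Real.pi ^ 2) = 4 * Real.pi ^ 2 * (S - g) by ring,
        abs_mul, abs_of_pos (by positivity : 0 < 4 * Real.pi ^ 2)]
      exact mul_le_mul_of_nonneg_left hc (by positivity)
    have h2 := abs_sub_le (4 * Real.pi ^ 2 * S) (g * (4 * Real.pi ^ 2)) (G * Real.log n)
    have h3 := le_abs_self C₁
    linarith
  rw [Real.dist_eq, show S / Real.log n - G / (4 * Real.pi ^ 2) =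
    (4 * Real.pi ^ 2 * S - G * Real.log n) / (4 * Real.pi ^ 2 * Real.log n) by field_simp,
    abs_div, abs_of_pos (by positivity : 0 < 4 * Real.pi ^ 2 * Real.log n),
    div_lt_iff₀ (by positivity)]
  have hl' : (4 * Real.pi ^ 2 * (2 * C) + |C₁|) < ε * Real.log n := by
    have : (4 * Real.pi ^ 2 * (2 * C) + |C₁|) / ε < Real.log n := by linarith
    rw [div_lt_iff₀ hε] at this
    linarith
  have hpi2 : 2 ≤ 4 * Real.pi ^ 2 := by nlinarith [Real.pi_gt_three]
  calc _ < 2 * (ε * Real.log n) := by linarith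
    _ ≤ 4 * Real.pi ^ 2 * (ε * Real.log n) := by gcongr
    _ = _ := by ring

end IsCenteredWalk

end

noncomputable section

variable {Ω : Type*} [MeasurableSpace Ω] {P : Measure Ω} [IsProbabilityMeasure P]
  {ζ : ℕ → Ω → ZSq}

/-! ### Sums of inverse square roots -/

/-- `1 / √(r + 1)`. -/
def invSqrt (r : ℕ) : ℝ := (√(r + 1))⁻¹

theorem invSqrt_nonneg (r : ℕ) : 0 ≤ invSqrt r := by unfold invSqrt; positivity

theorem invSqrt_anti {r s : ℕ} (h : r ≤ s) : invSqrt s ≤ invSqrt r := by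
  unfold invSqrt; gcongr

theorem invSqrt_mul_self (r : ℕ) : invSqrt r * invSqrt r = ((r : ℝ) + 1)⁻¹ := by
  rw [invSqrt, ← mul_inv, Real.mul_self_sqrt (by positivity)]

theorem sum_invSqrt_le (n : ℕ) : ∑ r ∈ Finset.range n, invSqrt r ≤ 2 * √n := by
  induction n with
  | zero => simp
  | succ n ih =>
    rw [Finset.sum_range_succ]
    have hs : 0 < √((n : ℝ) + 1) := by positivity
    have h1 : √(n : ℝ) * √n = n := Real.mul_self_sqrt (by positivity)
    have h2 : √((n : ℝ) + 1) * √((n : ℝ) + 1) = n + 1 := Real.mul_self_sqrt (by positivity)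
    have h3 : invSqrt n ≤ 2 * √((n : ℝ) + 1) - 2 * √n := by
      rw [invSqrt, inv_le_iff_one_le_mul₀ hs]
      nlinarith [sq_nonneg (√((n : ℝ) + 1) - √n)]
    push_cast
    linarith

/-- The distance of two natural numbers. -/
def ndist (x y : ℕ) : ℕ := (x - y) + (y - x)

theorem ndist_comm (x y : ℕ) : ndist x y = ndist y x := by unfold ndist; omega

theorem sum_invSqrt_ndist_le (a b y : ℕ) (hy : y ∈ Finset.Ico a b) :
    ∑ x ∈ Finset.Ico a b, invSqrt (ndist x y) ≤ 4 * √((b - a : ℕ) : ℝ) := by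
  rw [Finset.mem_Ico] at hy
  rw [← Finset.sum_Ico_consecutive _ hy.1 hy.2.le]
  have h1 : ∑ x ∈ Finset.Ico a y, invSqrt (ndist x y) ≤ 2 * √((b - a : ℕ) : ℝ) := by
    rw [Finset.sum_Ico_eq_sum_range]
    calc _ ≤ ∑ i ∈ Finset.range (y - a), invSqrt (y - a - 1 - i) := by
          refine Finset.sum_le_sum fun i hi => invSqrt_anti ?_
          rw [Finset.mem_range] at hi
          unfold ndist; omega
      _ = ∑ i ∈ Finset.range (y - a), invSqrt i := Finset.sum_range_reflect _ _
      _ ≤ 2 * √((y - a : ℕ) : ℝ) := sum_invSqrt_le _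
      _ ≤ _ := by gcongr; omega
  have h2 : ∑ x ∈ Finset.Ico y b, invSqrt (ndist x y) ≤ 2 * √((b - a : ℕ) : ℝ) := by
    rw [Finset.sum_Ico_eq_sum_range]
    calc _ = ∑ i ∈ Finset.range (b - y), invSqrt i := by
          refine Finset.sum_congr rfl fun i _ => ?_
          congr 1; unfold ndist; omega
      _ ≤ 2 * √((b - y : ℕ) : ℝ) := sum_invSqrt_le _
      _ ≤ _ := by gcongr; omega
  linarith

/-- The kernel sums to at most `4 √length` in either variable and the weights to at most `2
√length`, so the double sum is only linear in the length. -/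
theorem sum_invSqrt_ndist_mul_le (a b : ℕ) (w : ℕ → ℝ) (hw0 : ∀ x, 0 ≤ w x)
    (hw : ∑ x ∈ Finset.Ico a b, w x ≤ 2 * √((b - a : ℕ) : ℝ)) :
    ∑ x ∈ Finset.Ico a b, ∑ y ∈ Finset.Ico a b, invSqrt (ndist x y) * (w x + w y) ≤
      16 * (b - a : ℕ) := by
  have h1 : ∑ x ∈ Finset.Ico a b, ∑ y ∈ Finset.Ico a b, invSqrt (ndist x y) * w y ≤
      8 * (b - a : ℕ) := by
    rw [Finset.sum_comm]
    calc _ = ∑ y ∈ Finset.Ico a b, w y * ∑ x ∈ Finset.Ico a b, invSqrt (ndist x y) := by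
          refine Finset.sum_congr rfl fun y _ => ?_
          rw [Finset.mul_sum]
          exact Finset.sum_congr rfl fun x _ => mul_comm _ _
      _ ≤ ∑ y ∈ Finset.Ico a b, w y * (4 * √((b - a : ℕ) : ℝ)) :=
          Finset.sum_le_sum fun y hy =>
            mul_le_mul_of_nonneg_left (sum_invSqrt_ndist_le a b y hy) (hw0 y)
      _ = (∑ y ∈ Finset.Ico a b, w y) * (4 * √((b - a : ℕ) : ℝ)) := by rw [Finset.sum_mul]
      _ ≤ 2 * √((b - a : ℕ) : ℝ) * (4 * √((b - a : ℕ) : ℝ)) := by gcongr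
      _ = 8 * (√((b - a : ℕ) : ℝ) * √((b - a : ℕ) : ℝ)) := by ring
      _ = _ := by rw [Real.mul_self_sqrt (by positivity)]
  have h2 : ∑ x ∈ Finset.Ico a b, ∑ y ∈ Finset.Ico a b, invSqrt (ndist x y) * w x =
      ∑ x ∈ Finset.Ico a b, ∑ y ∈ Finset.Ico a b, invSqrt (ndist x y) * w y := by
    rw [Finset.sum_comm]
    refine Finset.sum_congr rfl fun x _ => Finset.sum_congr rfl fun y _ => ?_
    rw [ndist_comm]
  simp only [mul_add, Finset.sum_add_distrib]
  rw [h2]; linarith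

/-! ### Increments of the walk -/

/-- The increment of the walk between the times `i` and `j`. -/
def walkInc (ζ : ℕ → Ω → ZSq) (i j : ℕ) (ω : Ω) : ZSq := ∑ k ∈ Finset.Ico i j, ζ k ω

theorem walkInc_add (ζ : ℕ → Ω → ZSq) {i j k : ℕ} (hij : i ≤ j) (hjk : j ≤ k) (ω : Ω) :
    walkInc ζ i j ω + walkInc ζ j k ω = walkInc ζ i k ω :=
  Finset.sum_Ico_consecutive _ hij hjk

theorem randomWalk_sub (ζ : ℕ → Ω → ZSq) {i j : ℕ} (hij : i ≤ j) (ω : Ω) :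
    randomWalk ζ j ω - randomWalk ζ i ω = walkInc ζ i j ω := by
  rw [walkInc, Finset.sum_Ico_eq_sub _ hij]; rfl

/-- Functions of finitely many discrete random variables with disjoint index sets are
independent. -/
theorem indepFun_of_disjoint {α β : Type*} [MeasurableSpace α] [MeasurableSpace β]
    (hm : ∀ i, Measurable (ζ i)) (hi : iIndepFun ζ P) {S T : Finset ℕ} (hST : Disjoint S T)
    {X : Ω → α} {Y : Ω → β} (f : (S → ZSq) → α) (g : (T → ZSq) → β)
    (hX : ∀ ω, X ω = f fun i => ζ i ω) (hY : ∀ ω, Y ω = g fun i => ζ i ω) : IndepFun X Y P := by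
  have := (hi.indepFun_finset S T hST hm).comp (φ := f) (ψ := g)
    (measurable_of_countable f) (measurable_of_countable g)
  convert this using 1 <;> ext ω : 1
  · exact hX ω
  · exact hY ω

/-- A tuple of steps, extended by zero. -/
def extendZero {S : Finset ℕ} (z : S → ZSq) (k : ℕ) : ZSq := if h : k ∈ S then z ⟨k, h⟩ else 0

theorem walkInc_eq_extendZero {S : Finset ℕ} {i j : ℕ} (h : Finset.Ico i j ⊆ S) (ω : Ω) :
    walkInc ζ i j ω = ∑ k ∈ Finset.Ico i j, extendZero (fun i : S => ζ i ω) k := by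
  refine Finset.sum_congr rfl fun k hk => ?_
  simp [extendZero, h hk]

/-- Conditioning on `U`: given its value the target of `Y` is a fixed point, and independence makes
the bound on atoms of `Y` apply. -/
theorem measure_eq_comp_le {α β : Type*} [MeasurableSpace α] [Countable α]
    [MeasurableSingletonClass α] [MeasurableSpace β]
    [MeasurableSingletonClass β] {U : Ω → α} {Y : Ω → β} (hU : Measurable U)
    (hUY : IndepFun U Y P) (F : α → β) {c : ENNReal} (hc : ∀ y, P {ω | Y ω = y} ≤ c) :
    P {ω | Y ω = F (U ω)} ≤ c := by
  have hsub : {ω | Y ω = F (U ω)} ⊆ ⋃ u, (U ⁻¹' {u} ∩ Y ⁻¹' {F u}) := by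
    intro ω hω
    exact Set.mem_iUnion.2 ⟨U ω, rfl, hω⟩
  calc P {ω | Y ω = F (U ω)} ≤ ∑' u, P (U ⁻¹' {u} ∩ Y ⁻¹' {F u}) :=
        (measure_mono hsub).trans (measure_iUnion_le _)
    _ = ∑' u, P (U ⁻¹' {u}) * P (Y ⁻¹' {F u}) := by
        refine tsum_congr fun u => ?_
        exact hUY.measure_inter_preimage_eq_mul _ _ (measurableSet_singleton _)
          (measurableSet_singleton _)
    _ ≤ ∑' u, P (U ⁻¹' {u}) * c := ENNReal.tsum_le_tsum fun u => by
        gcongr; exact hc (F u)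
    _ = (∑' u, P (U ⁻¹' {u})) * c := ENNReal.tsum_mul_right
    _ = P Set.univ * c := by
        congr 1
        rw [← measure_iUnion]
        · congr 1; ext ω; simp
        · intro u v huv
          refine Set.disjoint_left.2 fun ω h1 h2 => huv ?_
          exact h1.symm.trans h2
        · exact fun u => hU (measurableSet_singleton u)
    _ = c := by simp

theorem measureReal_eq_comp_le {α β γ : Type*} [MeasurableSpace α] [Countable α]
    [MeasurableSingletonClass α] [MeasurableSpace β] [MeasurableSingletonClass β]
    [MeasurableSpace γ] [MeasurableSingletonClass γ]
    {U : Ω → α} {V : Ω → β} {W : Ω → γ} (hU : Measurable U)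
    (hU' : IndepFun U (fun ω => (V ω, W ω)) P) (hVW : IndepFun V W P) (f : α → β) (g : α → γ)
    {c d : ℝ} (hc0 : 0 ≤ c) (hd0 : 0 ≤ d) (hc : ∀ y, P.real {ω | V ω = y} ≤ c)
    (hd : ∀ y, P.real {ω | W ω = y} ≤ d) :
    P.real {ω | V ω = f (U ω) ∧ W ω = g (U ω)} ≤ c * d := by
  have h1 : P {ω | (V ω, W ω) = (f (U ω), g (U ω))} ≤ ENNReal.ofReal c * ENNReal.ofReal d := by
    refine measure_eq_comp_le hU hU' (fun u => (f u, g u)) ?_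
    rintro ⟨y, z⟩
    have h2 : {ω | (V ω, W ω) = (y, z)} = V ⁻¹' {y} ∩ W ⁻¹' {z} := by
      ext ω; simp
    rw [h2, hVW.measure_inter_preimage_eq_mul _ _ (measurableSet_singleton _)
      (measurableSet_singleton _)]
    gcongr
    · exact (ENNReal.le_ofReal_iff_toReal_le (measure_ne_top _ _) hc0).2 (hc y)
    · exact (ENNReal.le_ofReal_iff_toReal_le (measure_ne_top _ _) hd0).2 (hd z)
  have h3 := ENNReal.toReal_mono (by finiteness) h1
  rw [ENNReal.toReal_mul, ENNReal.toReal_ofReal hc0, ENNReal.toReal_ofReal hd0] at h3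
  simpa [measureReal_def, Prod.ext_iff] using h3

/-! ### Probabilities of pairs of self-intersections. -/

namespace IsCenteredWalk

theorem measurable_inc (h : IsCenteredWalk P ζ) (i j : ℕ) : Measurable (walkInc ζ i j) :=
  Finset.measurable_sum _ fun k _ => h.meas k

/-- Stationarity of the increments. -/
theorem prob_inc (h : IsCenteredWalk P ζ) (i j : ℕ) (x : ZSq) :
    P.real {ω | walkInc ζ i j ω = x} = P.real {ω | randomWalk ζ (j - i) ω = x} := by
  have h1 : IdentDistrib (fun ω (k : ℕ) => ζ (i + k) ω) (fun ω (k : ℕ) => ζ k ω) P P :=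
    IdentDistrib.pi (fun k => (h.ident (i + k)).trans (h.ident k).symm)
      (h.indep.precomp (add_right_injective i)) h.indep
  have hmeas : Measurable fun z : ℕ → ZSq => ∑ k ∈ Finset.range (j - i), z k :=
    Finset.measurable_sum _ fun k _ => measurable_pi_apply k
  have h2 := (h1.comp hmeas).measure_mem_eq (measurableSet_singleton x)
  rw [measureReal_def, measureReal_def]
  congr 1
  convert h2 using 2
  · ext ω
    simp [walkInc, Finset.sum_Ico_eq_sum_range]
  · ext ω
    simp [randomWalk]

theorem indep_inc_pair (h : IsCenteredWalk P ζ) {a b c d : ℕ} (hbc : b ≤ c) :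
    IndepFun (walkInc ζ a b) (walkInc ζ c d) P :=
  indepFun_of_disjoint h.meas h.indep (S := Finset.Ico a b) (T := Finset.Ico c d)
    (Finset.disjoint_left.2 fun x hx hy => by
      rw [Finset.mem_Ico] at hx hy; omega)
    (fun z => ∑ k ∈ Finset.Ico a b, extendZero z k)
    (fun z => ∑ k ∈ Finset.Ico c d, extendZero z k)
    (fun ω => walkInc_eq_extendZero subset_rfl ω) (fun ω => walkInc_eq_extendZero subset_rfl ω)

theorem indep_inc_right (h : IsCenteredWalk P ζ) {a b c d : ℕ} (hbc : b ≤ c) (hcd : c ≤ d) :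
    IndepFun (walkInc ζ a b) (fun ω => (walkInc ζ b c ω, walkInc ζ c d ω)) P :=
  indepFun_of_disjoint h.meas h.indep (S := Finset.Ico a b) (T := Finset.Ico b d)
    (Finset.Ico_disjoint_Ico_consecutive a b d)
    (fun z => ∑ k ∈ Finset.Ico a b, extendZero z k)
    (fun z => (∑ k ∈ Finset.Ico b c, extendZero z k, ∑ k ∈ Finset.Ico c d, extendZero z k))
    (fun ω => walkInc_eq_extendZero subset_rfl ω) (fun ω => Prod.ext
      (walkInc_eq_extendZero (Finset.Ico_subset_Ico le_rfl hcd) ω)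
      (walkInc_eq_extendZero (Finset.Ico_subset_Ico hbc le_rfl) ω))

theorem indep_inc_left (h : IsCenteredWalk P ζ) {a b c d : ℕ} (hab : a ≤ b) (hbc : b ≤ c) :
    IndepFun (walkInc ζ c d) (fun ω => (walkInc ζ b c ω, walkInc ζ a b ω)) P :=
  indepFun_of_disjoint h.meas h.indep (S := Finset.Ico c d) (T := Finset.Ico a c)
    (Finset.Ico_disjoint_Ico_consecutive a c d).symm
    (fun z => ∑ k ∈ Finset.Ico c d, extendZero z k)
    (fun z => (∑ k ∈ Finset.Ico b c, extendZero z k, ∑ k ∈ Finset.Ico a b, extendZero z k))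
    (fun ω => walkInc_eq_extendZero subset_rfl ω) (fun ω => Prod.ext
      (walkInc_eq_extendZero (Finset.Ico_subset_Ico hab le_rfl) ω)
      (walkInc_eq_extendZero (Finset.Ico_subset_Ico le_rfl hbc) ω))

/-- The heat kernel bound for increments, with the constant extracted. -/
theorem exists_inc_prob_le (h : IsCenteredWalk P ζ) :
    ∃ C > 0, ∀ (i j : ℕ) (x : ZSq),
      P.real {ω | walkInc ζ i j ω = x} ≤ C * (invSqrt (j - i) * invSqrt (j - i)) := by
  obtain ⟨C, hC, hp⟩ := h.exists_walk_prob_le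
  refine ⟨C, hC, fun i j x => ?_⟩
  rw [h.prob_inc, invSqrt_mul_self, ← div_eq_mul_inv]
  exact hp _ x

/-- Two bounds, one for each outer increment, are replaced by their geometric mean. This makes the
estimate symmetric and lets it factorize over the two sides of a cut. -/
theorem mul_invSqrt_of_le {C A u v w p : ℝ} (hA : 0 ≤ A) (hu : 0 ≤ u) (hv : 0 ≤ v)
    (h1 : p ≤ C * A * (C * (u * u))) (h2 : p ≤ C * A * (C * (v * v))) (hw : A ≤ w) :
    p ≤ C ^ 2 * (w * (u * v)) := by
  have hm : min (u * u) (v * v) ≤ u * v := by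
    rcases le_total u v with huv | huv
    · exact (min_le_left _ _).trans (by gcongr)
    · exact (min_le_right _ _).trans (by gcongr)
  have h3 : p ≤ C ^ 2 * A * min (u * u) (v * v) := by
    rcases min_choice (u * u) (v * v) with h | h <;> rw [h] <;> nlinarith
  calc p ≤ C ^ 2 * A * min (u * u) (v * v) := h3
    _ ≤ C ^ 2 * w * (u * v) := 
        mul_le_mul (mul_le_mul_of_nonneg_left hw (sq_nonneg C)) hm
          (le_min (mul_nonneg hu hu) (mul_nonneg hv hv)) (mul_nonneg (sq_nonneg C) (hA.trans hw))
    _ = _ := by ring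

/-- Crossing pairs of self-intersections. -/
theorem prob_cross_le (h : IsCenteredWalk P ζ) {C : ℝ} (hC : 0 < C)
    (hp : ∀ (i j : ℕ) (x : ZSq),
      P.real {ω | walkInc ζ i j ω = x} ≤ C * (invSqrt (j - i) * invSqrt (j - i)))
    {a b c d : ℕ} (hab : a ≤ b) (hbc : b ≤ c) (hcd : c ≤ d) (q : ZSq) {w : ℝ}
    (hw : invSqrt (c - b) * invSqrt (c - b) ≤ w) :
    P.real {ω | walkInc ζ a c ω = q ∧ walkInc ζ b d ω = q} ≤
      C ^ 2 * (w * (invSqrt (b - a) * invSqrt (d - c))) := by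
  have hn := invSqrt_nonneg
  have e : {ω | walkInc ζ a c ω = q ∧ walkInc ζ b d ω = q} =
      {ω | walkInc ζ a b ω + walkInc ζ b c ω = q ∧ walkInc ζ b c ω + walkInc ζ c d ω = q} := by
    ext ω
    simp only [Set.mem_ofPred_eq, walkInc_add ζ hab hbc, walkInc_add ζ hbc hcd]
  rw [e]
  have m0 : 0 ≤ C * (invSqrt (c - b) * invSqrt (c - b)) := by
    have := hn (c - b); positivity
  have m1 : 0 ≤ C * (invSqrt (b - a) * invSqrt (b - a)) := by
    have := hn (b - a); positivity
  have m2 : 0 ≤ C * (invSqrt (d - c) * invSqrt (d - c)) := by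
    have := hn (d - c); positivity
  refine mul_invSqrt_of_le (mul_nonneg (hn _) (hn _)) (hn _) (hn _) ?_ ?_ hw
  -- Given the last increment `u`, the middle one must be `q - u` and the first one must be `u`.
  · refine le_trans (measureReal_mono ?_ (measure_ne_top _ _)) (measureReal_eq_comp_le
      (h.measurable_inc c d) (h.indep_inc_left hab hbc)
      (h.indep_inc_pair (a := a) (b := b) (c := b) (d := c) le_rfl).symm
      (fun u => q - u) (fun u => u) m0 m1 (hp b c) (hp a b))
    rintro ω ⟨h1, h2⟩
    refine ⟨eq_sub_of_add_eq h2, ?_⟩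
    rw [add_comm, ← h2] at h1
    exact add_left_cancel h1
  -- The same with the first increment as the conditioning variable.
  · refine le_trans (measureReal_mono ?_ (measure_ne_top _ _)) (measureReal_eq_comp_le
      (h.measurable_inc a b) (h.indep_inc_right hbc hcd)
      (h.indep_inc_pair (a := b) (b := c) (c := c) (d := d) le_rfl)
      (fun u => q - u) (fun u => u) m0 m2 (hp b c) (hp c d))
    rintro ω ⟨h1, h2⟩
    rw [add_comm] at h1
    refine ⟨eq_sub_of_add_eq h1, ?_⟩
    rw [← h1] at h2
    exact add_left_cancel h2

/-- Nested pairs of self-intersections. -/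
theorem prob_nested_le (h : IsCenteredWalk P ζ) {C : ℝ} (hC : 0 < C)
    (hp : ∀ (i j : ℕ) (x : ZSq),
      P.real {ω | walkInc ζ i j ω = x} ≤ C * (invSqrt (j - i) * invSqrt (j - i)))
    {a b c d : ℕ} (hab : a ≤ b) (hbc : b ≤ c) (hcd : c ≤ d) (q : ZSq) {w : ℝ}
    (hw : invSqrt (c - b) * invSqrt (c - b) ≤ w) :
    P.real {ω | walkInc ζ a d ω = q ∧ walkInc ζ b c ω = q} ≤
      C ^ 2 * (w * (invSqrt (b - a) * invSqrt (d - c))) := by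
  have hn := invSqrt_nonneg
  have e : {ω | walkInc ζ a d ω = q ∧ walkInc ζ b c ω = q} =
      {ω | walkInc ζ a b ω + (walkInc ζ b c ω + walkInc ζ c d ω) = q ∧ walkInc ζ b c ω = q} := by
    ext ω
    simp only [Set.mem_ofPred_eq, walkInc_add ζ hbc hcd, walkInc_add ζ hab (hbc.trans hcd)]
  rw [e]
  have m0 : 0 ≤ C * (invSqrt (c - b) * invSqrt (c - b)) := by
    have := hn (c - b); positivity
  have m1 : 0 ≤ C * (invSqrt (b - a) * invSqrt (b - a)) := by
    have := hn (b - a); positivity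
  have m2 : 0 ≤ C * (invSqrt (d - c) * invSqrt (d - c)) := by
    have := hn (d - c); positivity
  refine mul_invSqrt_of_le (mul_nonneg (hn _) (hn _)) (hn _) (hn _) ?_ ?_ hw
  · refine le_trans (measureReal_mono ?_ (measure_ne_top _ _)) (measureReal_eq_comp_le
      (h.measurable_inc c d) (h.indep_inc_left hab hbc)
      (h.indep_inc_pair (a := a) (b := b) (c := b) (d := c) le_rfl).symm
      (fun _ => q) (fun u => -u) m0 m1 (hp b c) (hp a b))
    rintro ω ⟨h1, h2⟩
    refine ⟨h2, ?_⟩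
    rw [h2, add_left_comm, add_eq_left] at h1
    exact eq_neg_of_add_eq_zero_left h1
  · refine le_trans (measureReal_mono ?_ (measure_ne_top _ _)) (measureReal_eq_comp_le
      (h.measurable_inc a b) (h.indep_inc_right hbc hcd)
      (h.indep_inc_pair (a := b) (b := c) (c := c) (d := d) le_rfl)
      (fun _ => q) (fun u => -u) m0 m2 (hp b c) (hp c d))
    rintro ω ⟨h1, h2⟩
    refine ⟨h2, ?_⟩
    rw [h2, add_left_comm, add_eq_left] at h1
    exact eq_neg_of_add_eq_zero_right h1

/-- The four times are ordered as a crossing or a nested pair. Both have a middle increment that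
straddles the cut `m`, so the inverse of its length is at most a product of one inverse square root
on each side of `m`. The bound becomes a function of `i, i'` times a function of `j, j'`. -/
theorem prob_two_hits_le (h : IsCenteredWalk P ζ) {C : ℝ} (hC : 0 < C)
    (hp : ∀ (i j : ℕ) (x : ZSq),
      P.real {ω | walkInc ζ i j ω = x} ≤ C * (invSqrt (j - i) * invSqrt (j - i)))
    {m i i' j j' : ℕ} (hi : i < m) (hi' : i' < m) (hj : m ≤ j) (hj' : m ≤ j') (q : ZSq) :
    P.real {ω | walkInc ζ i j ω = q ∧ walkInc ζ i' j' ω = q} ≤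
      C ^ 2 * ((invSqrt (ndist i i') * (invSqrt (m - 1 - i) + invSqrt (m - 1 - i'))) *
        (invSqrt (ndist j j') * (invSqrt (j - m) + invSqrt (j' - m)))) := by
  have hn := invSqrt_nonneg
  wlog hii : i ≤ i' generalizing i i' j j'
  · have := this hi' hi hj' hj (by omega)
    rw [ndist_comm i, ndist_comm j, add_comm (invSqrt (m - 1 - i)), add_comm (invSqrt (j - m))]
    convert this using 3
    exact Set.ext fun ω => and_comm
  rcases le_total j j' with hjj | hjj
  · refine (h.prob_cross_le hC hp hii (by omega) hjj q
      (w := invSqrt (m - 1 - i') * invSqrt (j - m)) ?_).trans ?_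
    · exact mul_le_mul (invSqrt_anti (by omega)) (invSqrt_anti (by omega)) (hn _) (hn _)
    · have e1 : ndist i i' = i' - i := by unfold ndist; omega
      have e2 : ndist j j' = j' - j := by unfold ndist; omega
      rw [e1, e2]
      refine mul_le_mul_of_nonneg_left ?_ (by positivity)
      have := mul_le_mul (le_add_of_nonneg_left (hn (m - 1 - i)) :
        invSqrt (m - 1 - i') ≤ invSqrt (m - 1 - i) + invSqrt (m - 1 - i'))
        (le_add_of_nonneg_right (hn (j' - m)) :
        invSqrt (j - m) ≤ invSqrt (j - m) + invSqrt (j' - m)) (hn _) (add_nonneg (hn _) (hn _))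
      calc _ ≤ (invSqrt (m - 1 - i) + invSqrt (m - 1 - i')) *
            (invSqrt (j - m) + invSqrt (j' - m)) * (invSqrt (i' - i) * invSqrt (j' - j)) :=
            mul_le_mul_of_nonneg_right this (mul_nonneg (hn _) (hn _))
        _ = _ := by ring
  · refine (h.prob_nested_le hC hp hii (by omega) hjj q
      (w := invSqrt (m - 1 - i') * invSqrt (j' - m)) ?_).trans ?_
    · exact mul_le_mul (invSqrt_anti (by omega)) (invSqrt_anti (by omega)) (hn _) (hn _)
    · have e1 : ndist i i' = i' - i := by unfold ndist; omega
      have e2 : ndist j j' = j - j' := by unfold ndist; omega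
      rw [e1, e2]
      refine mul_le_mul_of_nonneg_left ?_ (by positivity)
      have := mul_le_mul (le_add_of_nonneg_left (hn (m - 1 - i)) :
        invSqrt (m - 1 - i') ≤ invSqrt (m - 1 - i) + invSqrt (m - 1 - i'))
        (le_add_of_nonneg_left (hn (j - m)) :
        invSqrt (j' - m) ≤ invSqrt (j - m) + invSqrt (j' - m)) (hn _) (add_nonneg (hn _) (hn _))
      calc _ ≤ (invSqrt (m - 1 - i) + invSqrt (m - 1 - i')) *
            (invSqrt (j - m) + invSqrt (j' - m)) * (invSqrt (i' - i) * invSqrt (j - j')) :=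
            mul_le_mul_of_nonneg_right this (mul_nonneg (hn _) (hn _))
        _ = _ := by ring

end IsCenteredWalk

end

noncomputable section

variable {Ω : Type*} [MeasurableSpace Ω] {P : Measure Ω} [IsProbabilityMeasure P]
  {ζ : ℕ → Ω → ZSq}

/-! ### Counting intersections along a path -/

/-- The indicator of `z j - z i = q`. -/
def hit (z : ℕ → ZSq) (q : ZSq) (i j : ℕ) : ℝ := if z j - z i = q then 1 else 0

/-- The number of pairs `i < j` in `[a, b)` with `z j - z i = q`. -/
def upCount (z : ℕ → ZSq) (q : ZSq) (a b : ℕ) : ℝ :=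
  ∑ j ∈ Finset.Ico a b, ∑ i ∈ Finset.Ico a j, hit z q i j

/-- The number of pairs `(i, j)` in `[a, m) × [m, b)` with `z j - z i = q`. -/
def crossCount (z : ℕ → ZSq) (q : ZSq) (a m b : ℕ) : ℝ :=
  ∑ i ∈ Finset.Ico a m, ∑ j ∈ Finset.Ico m b, hit z q i j

theorem hit_nonneg (z : ℕ → ZSq) (q : ZSq) (i j : ℕ) : 0 ≤ hit z q i j := by
  unfold hit; split_ifs <;> simp

theorem hit_le_one (z : ℕ → ZSq) (q : ZSq) (i j : ℕ) : hit z q i j ≤ 1 := by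
  unfold hit; split_ifs <;> simp

theorem upCount_nonneg (z : ℕ → ZSq) (q : ZSq) (a b : ℕ) : 0 ≤ upCount z q a b :=
  Finset.sum_nonneg fun _ _ => Finset.sum_nonneg fun _ _ => hit_nonneg _ _ _ _

theorem upCount_mono (z : ℕ → ZSq) (q : ZSq) {a b a' b' : ℕ} (ha : a' ≤ a) (hb : b ≤ b') :
    upCount z q a b ≤ upCount z q a' b' := by
  unfold upCount
  calc _ ≤ ∑ j ∈ Finset.Ico a b, ∑ i ∈ Finset.Ico a' j, hit z q i j :=
        Finset.sum_le_sum fun j _ => Finset.sum_le_sum_of_subset_of_nonneg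
          (Finset.Ico_subset_Ico ha le_rfl) fun _ _ _ => hit_nonneg _ _ _ _
    _ ≤ _ := Finset.sum_le_sum_of_subset_of_nonneg
          (Finset.Ico_subset_Ico ha hb) fun _ _ _ => Finset.sum_nonneg fun _ _ =>
            hit_nonneg _ _ _ _

theorem upCount_split (z : ℕ → ZSq) (q : ZSq) {a m b : ℕ} (ham : a ≤ m) (hmb : m ≤ b) :
    upCount z q a b = upCount z q a m + upCount z q m b + crossCount z q a m b := by
  unfold upCount crossCount
  rw [← Finset.sum_Ico_consecutive _ ham hmb, add_assoc, Finset.sum_comm (s := Finset.Ico a m)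
    (t := Finset.Ico m b), ← Finset.sum_add_distrib]
  congr 1
  refine Finset.sum_congr rfl fun j hj => ?_
  rw [add_comm, Finset.sum_Ico_consecutive _ ham (Finset.mem_Ico.1 hj).1]

theorem upCount_self_succ (z : ℕ → ZSq) (q : ZSq) (a : ℕ) : upCount z q a (a + 1) = 0 := by
  simp [upCount]

theorem upCount_self (z : ℕ → ZSq) (q : ZSq) (a : ℕ) : upCount z q a a = 0 := by
  simp [upCount]

theorem hit_walk (q : ZSq) {i j : ℕ} (hij : i ≤ j) (ω : Ω) :
    hit (fun k => randomWalk ζ k ω) q i j =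
      Set.indicator {ω | walkInc ζ i j ω = q} (fun _ => (1 : ℝ)) ω := by
  simp only [hit, randomWalk_sub ζ hij, Set.indicator_apply, Set.mem_ofPred_eq]

/-- Nonnegativity of `Var (X - 5 Y)` bounds twice the covariance by `Var X / 5 + 5 Var Y`. In the
recursion over halves a factor below `2` on `Var X` is essential, since the factor `2` would cost an
extra logarithm. -/
theorem variance_add_le_weighted {X Y : Ω → ℝ} (hX : MemLp X 2 P) (hY : MemLp Y 2 P) :
    Var[X + Y; P] ≤ 6 / 5 * Var[X; P] + 6 * Var[Y; P] := by
  have h1 := variance_add hX hY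
  have h2 := variance_sub hX (hY.const_smul (5 : ℝ))
  rw [covariance_smul_right, variance_smul] at h2
  have h3 := variance_nonneg (X - (5 : ℝ) • Y) P
  linarith

theorem sum_Ico_invSqrt_left_le (a m : ℕ) :
    ∑ x ∈ Finset.Ico a m, invSqrt (m - 1 - x) ≤ 2 * √((m - a : ℕ) : ℝ) := by
  rw [Finset.sum_Ico_eq_sum_range]
  refine le_trans (le_of_eq ?_) (sum_invSqrt_le (m - a))
  rw [← Finset.sum_range_reflect]
  refine Finset.sum_congr rfl fun i hi => ?_
  congr 1
  rw [Finset.mem_range] at hi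
  omega

theorem sum_Ico_invSqrt_right_le (m b : ℕ) :
    ∑ x ∈ Finset.Ico m b, invSqrt (x - m) ≤ 2 * √((b - m : ℕ) : ℝ) := by
  rw [Finset.sum_Ico_eq_sum_range]
  simpa using sum_invSqrt_le (b - m)

/-! ### Mean and variance of the number of self-intersections. -/

namespace IsCenteredWalk

theorem measurableSet_inc (h : IsCenteredWalk P ζ) (q : ZSq) (i j : ℕ) :
    MeasurableSet {ω | walkInc ζ i j ω = q} :=
  h.measurable_inc i j (measurableSet_singleton q)

theorem measurable_hit (h : IsCenteredWalk P ζ) (q : ZSq) (i j : ℕ) :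
    Measurable fun ω => hit (fun k => randomWalk ζ k ω) q i j := by
  have h1 : MeasurableSet {ω | randomWalk ζ j ω - randomWalk ζ i ω = q} :=
    ((Finset.measurable_sum _ fun k _ => h.meas k).sub
      (Finset.measurable_sum _ fun k _ => h.meas k)) (measurableSet_singleton q)
  exact Measurable.ite h1 measurable_const measurable_const

theorem memLp_hit (h : IsCenteredWalk P ζ) (q : ZSq) (i j : ℕ) :
    MemLp (fun ω => hit (fun k => randomWalk ζ k ω) q i j) 2 P := by
  refine MemLp.of_bound (h.measurable_hit q i j).aestronglyMeasurable 1 (ae_of_all _ fun ω => ?_)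
  rw [Real.norm_of_nonneg (hit_nonneg _ _ _ _)]
  exact hit_le_one _ _ _ _

theorem integral_hit (h : IsCenteredWalk P ζ) (q : ZSq) {i j : ℕ} (hij : i ≤ j) :
    ∫ ω, hit (fun k => randomWalk ζ k ω) q i j ∂P = P.real {ω | walkInc ζ i j ω = q} := by
  simp_rw [hit_walk q hij]
  exact integral_indicator_one (h.measurableSet_inc q i j)

theorem integral_hit_mul (h : IsCenteredWalk P ζ) (q : ZSq) {i j i' j' : ℕ} (hij : i ≤ j)
    (hij' : i' ≤ j') :
    ∫ ω, hit (fun k => randomWalk ζ k ω) q i j * hit (fun k => randomWalk ζ k ω) q i' j' ∂P =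
      P.real {ω | walkInc ζ i j ω = q ∧ walkInc ζ i' j' ω = q} := by
  simp_rw [hit_walk q hij, hit_walk q hij']
  refine Eq.trans ?_ (integral_indicator_one
    ((h.measurableSet_inc q i j).inter (h.measurableSet_inc q i' j')))
  congr 1
  ext ω
  by_cases h1 : walkInc ζ i j ω = q <;> by_cases h2 : walkInc ζ i' j' ω = q <;>
    simp [h1, h2]

theorem memLp_upCount (h : IsCenteredWalk P ζ) (q : ZSq) (a b : ℕ) :
    MemLp (fun ω => upCount (fun k => randomWalk ζ k ω) q a b) 2 P :=
  memLp_finsetSum _ fun _ _ => memLp_finsetSum _ fun _ _ => h.memLp_hit _ _ _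

theorem memLp_crossCount (h : IsCenteredWalk P ζ) (q : ZSq) (a m b : ℕ) :
    MemLp (fun ω => crossCount (fun k => randomWalk ζ k ω) q a m b) 2 P :=
  memLp_finsetSum _ fun _ _ => memLp_finsetSum _ fun _ _ => h.memLp_hit _ _ _

/-- The square is a fourfold sum of probabilities of two simultaneous hits; the factorized bound
splits it into two double sums, each linear in the length of its side. -/
theorem integral_crossCount_sq_le (h : IsCenteredWalk P ζ) {C : ℝ} (hC : 0 < C)
    (hp : ∀ (i j : ℕ) (x : ZSq),
      P.real {ω | walkInc ζ i j ω = x} ≤ C * (invSqrt (j - i) * invSqrt (j - i)))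
    (q : ZSq) (a m b : ℕ) :
    ∫ ω, crossCount (fun k => randomWalk ζ k ω) q a m b ^ 2 ∂P ≤
      C ^ 2 * (16 * (m - a : ℕ)) * (16 * (b - m : ℕ)) := by
  have e : ∀ ω, crossCount (fun k => randomWalk ζ k ω) q a m b ^ 2 =
      ∑ i ∈ Finset.Ico a m, ∑ i' ∈ Finset.Ico a m, ∑ j ∈ Finset.Ico m b, ∑ j' ∈ Finset.Ico m b,
        hit (fun k => randomWalk ζ k ω) q i j * hit (fun k => randomWalk ζ k ω) q i' j' := by
    intro ω
    simp_rw [crossCount, sq, Finset.sum_mul_sum]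
  have hint : ∀ i j i' j', Integrable (fun ω => hit (fun k => randomWalk ζ k ω) q i j *
      hit (fun k => randomWalk ζ k ω) q i' j') P := fun i j i' j' =>
    (h.memLp_hit q i j).integrable_mul (h.memLp_hit q i' j')
  simp_rw [e]
  rw [integral_finsetSum _ fun _ _ => integrable_finsetSum _ fun _ _ => integrable_finsetSum _
    fun _ _ => integrable_finsetSum _ fun _ _ => hint _ _ _ _]
  have hA := sum_invSqrt_ndist_mul_le a m (fun x => invSqrt (m - 1 - x))
    (fun x => invSqrt_nonneg _) (sum_Ico_invSqrt_left_le a m)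
  have hB := sum_invSqrt_ndist_mul_le m b (fun x => invSqrt (x - m))
    (fun x => invSqrt_nonneg _) (sum_Ico_invSqrt_right_le m b)
  have hn := invSqrt_nonneg
  have hB0 : 0 ≤ ∑ x ∈ Finset.Ico m b, ∑ y ∈ Finset.Ico m b,
      invSqrt (ndist x y) * (invSqrt (x - m) + invSqrt (y - m)) :=
    Finset.sum_nonneg fun x _ => Finset.sum_nonneg fun y _ =>
      mul_nonneg (hn _) (add_nonneg (hn _) (hn _))
  calc _ ≤ ∑ i ∈ Finset.Ico a m, ∑ i' ∈ Finset.Ico a m, ∑ j ∈ Finset.Ico m b,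
        ∑ j' ∈ Finset.Ico m b,
        C ^ 2 * ((invSqrt (ndist i i') * (invSqrt (m - 1 - i) + invSqrt (m - 1 - i'))) *
        (invSqrt (ndist j j') * (invSqrt (j - m) + invSqrt (j' - m)))) := by
        refine Finset.sum_le_sum fun i hi => ?_
        rw [integral_finsetSum _ fun _ _ => integrable_finsetSum _ fun _ _ =>
          integrable_finsetSum _ fun _ _ => hint _ _ _ _]
        refine Finset.sum_le_sum fun i' hi' => ?_
        rw [integral_finsetSum _ fun _ _ => integrable_finsetSum _ fun _ _ => hint _ _ _ _]
        refine Finset.sum_le_sum fun j hj => ?_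
        rw [integral_finsetSum _ fun _ _ => hint _ _ _ _]
        refine Finset.sum_le_sum fun j' hj' => ?_
        rw [Finset.mem_Ico] at hi hi' hj hj'
        rw [h.integral_hit_mul q (by omega) (by omega)]
        exact h.prob_two_hits_le hC hp hi.2 hi'.2 hj.1 hj'.1 q
    _ = C ^ 2 * (∑ x ∈ Finset.Ico a m, ∑ y ∈ Finset.Ico a m,
          invSqrt (ndist x y) * (invSqrt (m - 1 - x) + invSqrt (m - 1 - y))) *
        (∑ x ∈ Finset.Ico m b, ∑ y ∈ Finset.Ico m b,
          invSqrt (ndist x y) * (invSqrt (x - m) + invSqrt (y - m))) := by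
        simp_rw [← Finset.mul_sum, ← Finset.sum_mul]
        ring
    _ ≤ _ := mul_le_mul (mul_le_mul_of_nonneg_left hA (sq_nonneg C)) hB hB0 (by positivity)

/-- Intersections inside a time interval depend only on increments there, hence on disjoint sets of
steps for consecutive intervals. -/
theorem indep_upCount (h : IsCenteredWalk P ζ) (q : ZSq) (a m b : ℕ) :
    IndepFun (fun ω => upCount (fun k => randomWalk ζ k ω) q a m)
      (fun ω => upCount (fun k => randomWalk ζ k ω) q m b) P := by
  have key : ∀ a b ω, upCount (fun k => randomWalk ζ k ω) q a b =
      ∑ j ∈ Finset.Ico a b, ∑ i ∈ Finset.Ico a j,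
        if ∑ k ∈ Finset.Ico i j,
          extendZero (fun i : Finset.Ico a b => ζ i ω) k = q then (1 : ℝ) else 0 := by
    intro a b ω
    refine Finset.sum_congr rfl fun j hj => Finset.sum_congr rfl fun i hi => ?_
    rw [Finset.mem_Ico] at hi hj
    rw [hit, randomWalk_sub ζ hi.2.le, walkInc_eq_extendZero (S := Finset.Ico a b)
      (Finset.Ico_subset_Ico hi.1 hj.2.le)]
  exact indepFun_of_disjoint h.meas h.indep (Finset.Ico_disjoint_Ico_consecutive a m b)
    (fun z => ∑ j ∈ Finset.Ico a m, ∑ i ∈ Finset.Ico a j,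
        if ∑ k ∈ Finset.Ico i j, extendZero z k = q then (1 : ℝ) else 0)
    (fun z => ∑ j ∈ Finset.Ico m b, ∑ i ∈ Finset.Ico m j,
        if ∑ k ∈ Finset.Ico i j, extendZero z k = q then (1 : ℝ) else 0) (key a m) (key m b)

/-- The variance of the number of self-intersections in a time interval of length `N` is
`O(N²)`. -/
theorem exists_variance_upCount_le (h : IsCenteredWalk P ζ) :
    ∃ K > 0, ∀ (q : ZSq) (N a : ℕ),
      Var[fun ω => upCount (fun k => randomWalk ζ k ω) q a (a + N); P] ≤ K * N ^ 2 := by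
  obtain ⟨C, hC, hp⟩ := h.exists_inc_prob_le
  -- `1536 = 6 · 16²`: the weight of the cross term in `variance_add_le_weighted` times the
  -- constants of `integral_crossCount_sq_le`. The recursion closes because `(6/5)(N₁² + N₂²) + N₁
  -- N₂ ≤ (N₁ + N₂)²` for nearly equal halves.
  refine ⟨1536 * C ^ 2, by positivity, fun q N => ?_⟩
  induction N using Nat.strong_induction_on with
  | _ N ih =>
  intro a
  rcases Nat.lt_or_ge N 2 with hN | hN
  · have h0 : (fun ω => upCount (fun k => randomWalk ζ k ω) q a (a + N)) = fun _ => 0 := by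
      ext ω
      interval_cases N
      · exact upCount_self _ _ _
      · exact upCount_self_succ _ _ _
    rw [h0]
    have h1 : Var[fun _ : Ω => (0 : ℝ); P] = 0 := variance_zero P
    rw [h1]
    positivity
  obtain ⟨N₁, N₂, hN12, h1, h2⟩ : ∃ N₁ N₂, N = N₁ + N₂ ∧ N₁ ≤ N₂ ∧ N₂ ≤ N₁ + 1 :=
    ⟨N / 2, N - N / 2, by omega, by omega, by omega⟩
  have hs : (fun ω => upCount (fun k => randomWalk ζ k ω) q a (a + N)) =
      ((fun ω => upCount (fun k => randomWalk ζ k ω) q a (a + N₁)) +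
        (fun ω => upCount (fun k => randomWalk ζ k ω) q (a + N₁) (a + N₁ + N₂))) +
        (fun ω => crossCount (fun k => randomWalk ζ k ω) q a (a + N₁) (a + N₁ + N₂)) := by
    ext ω
    rw [hN12, ← add_assoc]
    exact upCount_split _ q (Nat.le_add_right _ _) (Nat.le_add_right _ _)
  rw [hs]
  have hv := variance_add_le_weighted
    ((h.memLp_upCount q a (a + N₁)).add (h.memLp_upCount q (a + N₁) (a + N₁ + N₂)))
    (h.memLp_crossCount q a (a + N₁) (a + N₁ + N₂))
  rw [IndepFun.variance_add (h.memLp_upCount q a (a + N₁))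
    (h.memLp_upCount q (a + N₁) (a + N₁ + N₂)) (h.indep_upCount q _ _ _)] at hv
  have hI := (variance_le_expectation_sq
    (h.memLp_crossCount q a (a + N₁) (a + N₁ + N₂)).aestronglyMeasurable).trans
    (h.integral_crossCount_sq_le hC hp q a (a + N₁) (a + N₁ + N₂))
  have hU1 := ih N₁ (by omega) a
  have hU2 := ih N₂ (by omega) (a + N₁)
  simp only [Nat.add_sub_cancel_left] at hI
  have e1 : (N : ℝ) = N₁ + N₂ := by exact_mod_cast hN12
  have e2 : (N₁ : ℝ) ≤ N₂ := by exact_mod_cast h1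
  have e3 : (N₂ : ℝ) ≤ N₁ + 1 := by exact_mod_cast h2
  have e4 : (1 : ℝ) ≤ N₁ := by
    have : 1 ≤ N₁ := by omega
    exact_mod_cast this
  have hC2 : 0 < C ^ 2 := by positivity
  have key : 6 / 5 * (1536 * ((N₁ : ℝ) ^ 2 + (N₂ : ℝ) ^ 2)) + 6 * (256 * (N₁ * N₂)) ≤
      1536 * ((N₁ : ℝ) + N₂) ^ 2 := by nlinarith
  rw [e1]
  nlinarith [mul_le_mul_of_nonneg_left key hC2.le]

/-- By stationarity the mean does not depend on `a` and is a sum of truncated Green functions. The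
term `r = 0` is removed because only pairs with `i < j` are counted. -/
theorem integral_upCount (h : IsCenteredWalk P ζ) (q : ZSq) (a N : ℕ) :
    ∫ ω, upCount (fun k => randomWalk ζ k ω) q a (a + N) ∂P =
      ∑ j ∈ Finset.range N, (∑ r ∈ Finset.range (j + 1), P.real {ω | randomWalk ζ r ω = q} -
        P.real {ω | randomWalk ζ 0 ω = q}) := by
  unfold upCount
  have hint : ∀ i j, Integrable (fun ω => hit (fun k => randomWalk ζ k ω) q i j) P :=
    fun i j => (h.memLp_hit q i j).integrable (by norm_num)
  rw [integral_finsetSum _ fun _ _ => integrable_finsetSum _ fun _ _ => hint _ _,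
    Finset.sum_Ico_eq_sum_range, Nat.add_sub_cancel_left]
  refine Finset.sum_congr rfl fun j _ => ?_
  rw [integral_finsetSum _ fun _ _ => hint _ _, Finset.sum_range_succ', add_sub_cancel_right,
    Finset.sum_Ico_eq_sum_range, Nat.add_sub_cancel_left, ← Finset.sum_range_reflect]
  refine Finset.sum_congr rfl fun i hi => ?_
  rw [Finset.mem_range] at hi
  have e : a + j - (a + (j - 1 - i)) = i + 1 := by omega
  rw [h.integral_hit q (by omega), h.prob_inc, e]

/-- The asymptotics of the mean number of self-intersections. -/
theorem tendsto_integral_upCount (h : IsCenteredWalk P ζ) (q : ZSq) :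
    Tendsto (fun N : ℕ => (∫ ω, upCount (fun k => randomWalk ζ k ω) q 0 N ∂P) /
      (N * Real.log N)) atTop (𝓝 (gaussMass P (ζ 0) / (4 * Real.pi ^ 2))) := by
  obtain ⟨C, hC, hp⟩ := h.exists_walk_prob_le
  set p : ℕ → ℝ := fun r => P.real {ω | randomWalk ζ r ω = q} with hpdef
  set G : ℕ → ℝ := fun n => ∑ r ∈ Finset.range n, p r with hG
  set m : ℕ → ℝ := fun N => ∫ ω, upCount (fun k => randomWalk ζ k ω) q 0 N ∂P with hm
  have hmN : ∀ N, m N = ∑ j ∈ Finset.range N, (G (j + 1) - p 0) := fun N => by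
    have := h.integral_upCount q 0 N
    rwa [zero_add] at this
  -- Summation by parts: `N G(N)` minus the mean is `∑ (k p_k + p_0)`, whose terms are bounded by
  -- the heat kernel estimate. The Green function can thus be evaluated at the endpoint alone.
  have hdiff : ∀ N : ℕ, |m N - N * G N| ≤ (C + 1) * N := by
    intro N
    have h1 : N * G N - m N = ∑ k ∈ Finset.range N, (k * p k + p 0) := by
      induction N with
      | zero => simp [hmN]
      | succ N ih =>
        rw [Finset.sum_range_succ, ← ih, hmN, hmN, Finset.sum_range_succ]
        have : G (N + 1) = G N + p N := Finset.sum_range_succ _ _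
        rw [this]; push_cast; ring
    have h0 : ∀ k, 0 ≤ p k := fun k => measureReal_nonneg
    rw [abs_sub_comm, h1, abs_of_nonneg (Finset.sum_nonneg fun k _ => by
      have := h0 k; have := h0 0; positivity)]
    calc _ ≤ ∑ k ∈ Finset.range N, (C + 1) := Finset.sum_le_sum fun k _ => by
          have h2 : p k ≤ C / (k + 1) := hp k q
          have h3 : p 0 ≤ 1 := measureReal_le_one
          have h4 : (k : ℝ) * p k ≤ C := by
            rw [le_div_iff₀ (by positivity)] at h2
            have := h0 k
            nlinarith
          linarith
      _ = _ := by simp; ring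
  have hlog : Tendsto (fun N : ℕ => (C + 1) / Real.log N) atTop (𝓝 0) :=
    (tendsto_const_nhds).div_atTop (Real.tendsto_log_atTop.comp tendsto_natCast_atTop_atTop)
  have h0 : Tendsto (fun N : ℕ => m N / (N * Real.log N) - G N / Real.log N) atTop (𝓝 0) := by
    refine squeeze_zero_norm' ?_ hlog
    filter_upwards [eventually_ge_atTop 2] with N hN
    have hN1 : (1 : ℝ) < N := by exact_mod_cast hN
    have hl : 0 < Real.log N := Real.log_pos hN1
    have hN0 : (0 : ℝ) < N := by linarith
    have e : m N / (N * Real.log N) - G N / Real.log N = (m N - N * G N) / (N * Real.log N) := by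
      field_simp
    rw [e, Real.norm_eq_abs, abs_div, abs_of_pos (mul_pos hN0 hl), div_le_div_iff₀ (by positivity) hl]
    calc _ ≤ (C + 1) * N * Real.log N := by gcongr; exact hdiff N
      _ = _ := by ring
  have h1 := h0.add (h.tendsto_green q)
  rw [zero_add] at h1
  exact h1.congr fun N => sub_add_cancel _ _

end IsCenteredWalk

end

noncomputable section

variable {Ω : Type*} [MeasurableSpace Ω] {P : Measure Ω} [IsProbabilityMeasure P]
  {ζ : ℕ → Ω → ZSq}

/-! ### A subsequence of subexponential growth -/

/-- `⌈exp (k ^ (3 / 4))⌉`. -/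
def subexp (k : ℕ) : ℕ := ⌈Real.exp ((k : ℝ) ^ (3 / 4 : ℝ))⌉₊

theorem subexp_pos (k : ℕ) : 0 < subexp k := Nat.ceil_pos.2 (Real.exp_pos _)

theorem rpow_le_log_subexp (k : ℕ) : (k : ℝ) ^ (3 / 4 : ℝ) ≤ Real.log (subexp k) := by
  rw [Real.le_log_iff_exp_le (by exact_mod_cast subexp_pos k)]
  exact Nat.le_ceil _

/-- The exponent `3/4` exceeds `1/2`, so the squared logarithms along the subsequence have summable
inverses. -/
theorem inv_log_subexp_sq_le (k : ℕ) :
    (Real.log (subexp k) ^ 2)⁻¹ ≤ ((k : ℝ) ^ (3 / 2 : ℝ))⁻¹ := by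
  rcases Nat.eq_zero_or_pos k with rfl | hk
  · simp [subexp]
  · have h1 := rpow_le_log_subexp k
    have h2 : (0 : ℝ) < (k : ℝ) ^ (3 / 4 : ℝ) := by positivity
    have h3 : (k : ℝ) ^ (3 / 2 : ℝ) = ((k : ℝ) ^ (3 / 4 : ℝ)) ^ 2 := by
      rw [← Real.rpow_natCast, ← Real.rpow_mul (by positivity)]; norm_num
    rw [h3]
    gcongr

theorem tendsto_rpow_three_quarters :
    Tendsto (fun k : ℕ => (k : ℝ) ^ (3 / 4 : ℝ)) atTop atTop :=
  (tendsto_rpow_atTop (by norm_num)).comp tendsto_natCast_atTop_atTop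

theorem tendsto_subexp : Tendsto subexp atTop atTop :=
  tendsto_nat_ceil_atTop.comp (Real.tendsto_exp_atTop.comp tendsto_rpow_three_quarters)

/-- The exponent `3/4` is below one, so the increments of `k ^ (3/4)` tend to zero. -/
theorem tendsto_subexp_ratio :
    Tendsto (fun k => (subexp (k + 1) : ℝ) / subexp k) atTop (𝓝 1) := by
  set g : ℕ → ℝ := fun k => Real.exp ((k : ℝ) ^ (3 / 4 : ℝ)) with hg
  have h1 : Tendsto (fun k => (subexp k : ℝ) / g k) atTop (𝓝 1) :=
    (tendsto_nat_ceil_div_atTop (R := ℝ)).comp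
      (Real.tendsto_exp_atTop.comp tendsto_rpow_three_quarters)
  have h2 : Tendsto (fun k : ℕ => ((k + 1 : ℕ) : ℝ) ^ (3 / 4 : ℝ) - (k : ℝ) ^ (3 / 4 : ℝ)) atTop
      (𝓝 0) := by
    have h3 : Tendsto (fun k : ℕ => 3 / 4 * (k : ℝ) ^ (-(1 / 4) : ℝ)) atTop (𝓝 0) := by
      have := ((tendsto_rpow_neg_atTop (y := 1 / 4) (by norm_num)).comp
        tendsto_natCast_atTop_atTop).const_mul (3 / 4 : ℝ)
      simpa using this
    refine tendsto_of_tendsto_of_tendsto_of_le_of_le' tendsto_const_nhds h3 ?_ ?_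
    · refine Eventually.of_forall fun k => sub_nonneg.2 ?_
      gcongr; simp
    · filter_upwards [eventually_ge_atTop 1] with k hk
      have hk0 : (0 : ℝ) < k := by exact_mod_cast hk
      have e : ((k + 1 : ℕ) : ℝ) = k * (1 + 1 / k) := by push_cast; field_simp
      have h4 := rpow_one_add_le_one_add_mul_self (s := 1 / (k : ℝ)) (p := 3 / 4)
        (by have : 0 ≤ 1 / (k : ℝ) := by positivity
            linarith) (by norm_num) (by norm_num)
      rw [e, Real.mul_rpow hk0.le (by positivity)]
      have h5 : (k : ℝ) ^ (-(1 / 4) : ℝ) = (k : ℝ) ^ (3 / 4 : ℝ) * (1 / k) := by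
        rw [one_div (k : ℝ), ← Real.rpow_neg_one, ← Real.rpow_add hk0]; norm_num
      have h6 := mul_le_mul_of_nonneg_left h4 (Real.rpow_nonneg hk0.le (3 / 4 : ℝ))
      rw [h5]
      linarith
  have h3 : Tendsto (fun k => g (k + 1) / g k) atTop (𝓝 1) := by
    have := (Real.continuous_exp.tendsto 0).comp h2
    rw [Real.exp_zero] at this
    refine this.congr fun k => ?_
    simp only [Function.comp, hg, Real.exp_sub]
  have h4 := ((h1.comp (tendsto_add_atTop_nat 1)).mul h3).div h1 one_ne_zero
  rw [mul_one, div_one] at h4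
  refine h4.congr fun k => ?_
  have hg0 : ∀ k, g k ≠ 0 := fun k => (Real.exp_pos _).ne'
  have := hg0 k
  have := hg0 (k + 1)
  have : (subexp k : ℝ) ≠ 0 := by exact_mod_cast (subexp_pos k).ne'
  simp only [Function.comp, Pi.div_apply]
  field_simp

theorem tendsto_log_div_log {u : ℕ → ℕ} {n : ℕ → ℕ} {r : ℝ} (hr : 0 < r)
    (hn : Tendsto n atTop atTop) (h : Tendsto (fun k => (u k : ℝ) / n k) atTop (𝓝 r)) :
    Tendsto (fun k => Real.log (u k) / Real.log (n k)) atTop (𝓝 1) := by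
  have hlog : Tendsto (fun k => Real.log (n k)) atTop atTop :=
    Real.tendsto_log_atTop.comp (tendsto_natCast_atTop_atTop.comp hn)
  have h1 : Tendsto (fun k => Real.log ((u k : ℝ) / n k) / Real.log (n k)) atTop (𝓝 0) :=
    (h.log hr.ne').div_atTop hlog
  have h2 := h1.const_add 1
  rw [add_zero] at h2
  refine h2.congr' ?_
  filter_upwards [hlog.eventually_gt_atTop 0, h.eventually_const_lt hr] with k hk hu
  have hn0 : (n k : ℝ) ≠ 0 := by rintro h0; simp [h0] at hu
  have hu0 : (u k : ℝ) ≠ 0 := by rintro h0; simp [h0] at hu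
  rw [Real.log_div hu0 hn0]
  field_simp
  ring

/-- Each large `n` lies in some `[N k, N (k + 1))`, found at the first index where `N` exceeds `n`;
monotonicity of `N` is not needed. -/
theorem eventually_of_blocks {N : ℕ → ℕ} (hN : Tendsto N atTop atTop) {Q : ℕ → Prop}
    (h : ∀ᶠ k in atTop, ∀ n, N k ≤ n → n < N (k + 1) → Q n) : ∀ᶠ n in atTop, Q n := by
  obtain ⟨k₀, hk₀⟩ := eventually_atTop.1 h
  filter_upwards [eventually_ge_atTop (N k₀)] with n hn
  have hex : ∃ j, n < N (k₀ + j) := by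
    obtain ⟨k, hk⟩ := eventually_atTop.1 (hN.eventually_gt_atTop n)
    exact ⟨k, hk _ (by omega)⟩
  classical
  obtain ⟨j, hj⟩ : ∃ j, Nat.find hex = j + 1 := by
    refine Nat.exists_eq_succ_of_ne_zero fun h0 => ?_
    have := Nat.find_spec hex
    rw [h0] at this
    simp at this; omega
  have h1 := Nat.find_spec hex
  rw [hj, ← add_assoc] at h1
  have h2 := Nat.find_min hex (m := j) (by omega)
  exact hk₀ (k₀ + j) (by omega) n (by omega) h1

/-- From a subsequence to the full sequence, for monotone functionals of intervals. -/
theorem tendsto_of_subexp {V : ℕ → ℕ → ℝ} (hmono : ∀ {a b a' b'}, a' ≤ a → b ≤ b' →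
      V a b ≤ V a' b') (h0 : ∀ a b, 0 ≤ V a b) {γ : ℝ} (hγ : 0 < γ)
    (hsub : ∀ s t : ℚ, 0 ≤ s → s < t → Tendsto (fun k =>
      V ⌊(subexp k : ℝ) * s⌋₊ ⌊(subexp k : ℝ) * t⌋₊ / (subexp k * Real.log (subexp k))) atTop
        (𝓝 (γ * (t - s)))) {s t : ℝ} (hs : 0 ≤ s) (hst : s ≤ t) :
    Tendsto (fun n : ℕ => V ⌊(n : ℝ) * s⌋₊ ⌊(n : ℝ) * t⌋₊ / (n * Real.log n)) atTop
      (𝓝 (γ * (t - s))) := by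
  have hbig : ∀ᶠ k in atTop, 2 ≤ subexp k := tendsto_subexp.eventually_ge_atTop 2
  have hlogmono : ∀ m n : ℕ, 2 ≤ m → m ≤ n → 0 < (m : ℝ) * Real.log m ∧
      (m : ℝ) * Real.log m ≤ n * Real.log n := by
    intro m n hm hmn
    have h1 : (1 : ℝ) < m := by exact_mod_cast hm
    have h2 : 0 < Real.log m := Real.log_pos h1
    have h3 : (m : ℝ) ≤ n := by exact_mod_cast hmn
    refine ⟨by positivity, ?_⟩
    gcongr
  rw [tendsto_order]
  constructor
  · intro l hl
    rcases hst.eq_or_lt with rfl | hst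
    · refine Eventually.of_forall fun n => ?_
      rw [sub_self, mul_zero] at hl
      exact hl.trans_le (div_nonneg (h0 _ _)
        (mul_nonneg (Nat.cast_nonneg _) (Real.log_natCast_nonneg _)))
    -- For the lower bound the interval is shrunk to rational endpoints, with a loss of at most `2 γ
    -- δ` in the limit; the term `(t - s) / 2` keeps the shrunk interval nonempty.
    set δ := min ((γ * (t - s) - l) / (2 * γ)) ((t - s) / 2) with hδ
    have hδ0 : 0 < δ := lt_min (by apply div_pos <;> linarith) (by linarith)
    have hδ1 : 2 * γ * δ ≤ γ * (t - s) - l := by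
      have := min_le_left ((γ * (t - s) - l) / (2 * γ)) ((t - s) / 2)
      rw [← hδ, le_div_iff₀ (by positivity)] at this
      linarith
    have hδ2 : δ ≤ (t - s) / 2 := min_le_right _ _
    obtain ⟨s', hs'1, hs'2⟩ := exists_rat_btwn (show s < s + δ by linarith)
    obtain ⟨t', ht'1, ht'2⟩ := exists_rat_btwn (show t - δ < t by linarith)
    have hs'0 : (0 : ℚ) ≤ s' := by
      have : (0 : ℝ) ≤ s' := hs.trans hs'1.le
      exact_mod_cast this
    have hst' : s' < t' := by
      have : (s' : ℝ) < t' := by linarith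
      exact_mod_cast this
    have hlim := hsub s' t' hs'0 hst'
    have hrat : Tendsto (fun k => ((subexp k : ℝ) * Real.log (subexp k)) /
        (subexp (k + 1) * Real.log (subexp (k + 1)))) atTop (𝓝 1) := by
      have := ((tendsto_subexp_ratio.mul
        (tendsto_log_div_log one_pos tendsto_subexp tendsto_subexp_ratio))).inv₀ (by norm_num)
      rw [mul_one, inv_one] at this
      refine this.congr fun k => ?_
      rw [div_mul_div_comm, inv_div]
    have hlim2 := hlim.mul hrat
    rw [mul_one] at hlim2
    have hl' : l < γ * (t' - s') := by nlinarith
    refine eventually_of_blocks tendsto_subexp ?_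
    have hs'3 := (tendsto_subexp_ratio.mul_const s)
    rw [one_mul] at hs'3
    filter_upwards [hlim2.eventually_const_lt hl', hbig, hs'3.eventually_lt_const hs'1] with
      k hk hk2 hks n hn1 hn2
    refine hk.trans_le ?_
    have hL1 := hlogmono _ _ hk2 hn1
    have hL2 := hlogmono _ _ (hk2.trans hn1) hn2.le
    have hc : (0 : ℝ) < subexp k := by exact_mod_cast subexp_pos k
    rw [div_mul_div_cancel₀ hL1.1.ne']
    refine div_le_div₀ (h0 _ _) (hmono ?_ ?_) hL2.1 hL2.2
    · refine Nat.floor_le_floor ?_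
      rw [div_mul_eq_mul_div, div_lt_iff₀ hc] at hks
      have : (n : ℝ) ≤ subexp (k + 1) := by exact_mod_cast hn2.le
      nlinarith
    · refine Nat.floor_le_floor ?_
      have h1 : (subexp k : ℝ) ≤ n := by exact_mod_cast hn1
      have h2 : (0 : ℝ) ≤ t' := by linarith
      exact mul_le_mul h1 ht'2.le h2 (by positivity)
  · intro u hu
    -- For the upper bound the interval is enlarged, keeping `s' ≥ 0`. Rational endpoints suffice,
    -- which leaves countably many null sets.
    set δ := (u - γ * (t - s)) / (2 * γ) with hδ
    have hδ0 : 0 < δ := by apply div_pos <;> linarith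
    have hδ1 : 2 * γ * δ = u - γ * (t - s) := by rw [hδ]; field_simp
    obtain ⟨s', hs'0, hs'1, hs'2⟩ : ∃ s' : ℚ, 0 ≤ s' ∧ (s' : ℝ) ≤ s ∧ s - δ < s' := by
      rcases hs.eq_or_lt with rfl | hs
      · exact ⟨0, le_rfl, by simp, by simpa using hδ0⟩
      · obtain ⟨s', h1, h2⟩ := exists_rat_btwn (show max 0 (s - δ) < s by
          apply max_lt <;> linarith)
        refine ⟨s', ?_, h2.le, (le_max_right _ _).trans_lt h1⟩
        have : (0 : ℝ) ≤ s' := (le_max_left _ _).trans h1.le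
        exact_mod_cast this
    obtain ⟨t', ht'1, ht'2⟩ := exists_rat_btwn (show t < t + δ by linarith)
    have hst' : s' < t' := by
      have : (s' : ℝ) < t' := by linarith
      exact_mod_cast this
    have hlim := hsub s' t' hs'0 hst'
    have hu' : γ * (t' - s') < u := by nlinarith
    refine eventually_of_blocks tendsto_subexp ?_
    have ht'3 := (tendsto_subexp_ratio.mul_const t)
    rw [one_mul] at ht'3
    filter_upwards [hlim.eventually_lt_const hu', hbig, ht'3.eventually_lt_const ht'1] with
      k hk hk2 hkt n hn1 hn2
    refine lt_of_le_of_lt ?_ hk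
    have hL1 := hlogmono _ _ hk2 hn1
    have hc : (0 : ℝ) < subexp k := by exact_mod_cast subexp_pos k
    refine div_le_div₀ (h0 _ _) (hmono ?_ ?_) hL1.1 hL1.2
    · refine Nat.floor_le_floor ?_
      have h1 : (subexp k : ℝ) ≤ n := by exact_mod_cast hn1
      have h2 : (0 : ℝ) ≤ s' := by exact_mod_cast hs'0
      exact mul_le_mul h1 hs'1 h2 (by positivity)
    · refine Nat.floor_le_floor ?_
      rw [div_mul_eq_mul_div, div_lt_iff₀ hc] at hkt
      have : (n : ℝ) ≤ subexp (k + 1) := by exact_mod_cast hn2.le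
      have h3 : 0 ≤ t := hs.trans hst
      nlinarith

/-- The expectation of the whole series is finite, so the series converges almost surely and its
terms tend to zero. -/
theorem ae_tendsto_zero_of_summable_integral {X : ℕ → Ω → ℝ} (h0 : ∀ k ω, 0 ≤ X k ω)
    (hint : ∀ k, Integrable (X k) P) (hs : Summable fun k => ∫ ω, X k ω ∂P) :
    ∀ᵐ ω ∂P, Tendsto (fun k => X k ω) atTop (𝓝 0) := by
  have h1 : ∫⁻ ω, ∑' k, ENNReal.ofReal (X k ω) ∂P ≠ ⊤ := by
    rw [lintegral_tsum fun k => (hint k).aemeasurable.ennreal_ofReal]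
    have h2 : ∀ k, ∫⁻ ω, ENNReal.ofReal (X k ω) ∂P = ENNReal.ofReal (∫ ω, X k ω ∂P) := fun k =>
      (ofReal_integral_eq_lintegral_ofReal (hint k) (ae_of_all _ (h0 k))).symm
    simp_rw [h2]
    exact hs.tsum_ofReal_ne_top
  have h2 := ae_lt_top' (AEMeasurable.tsum fun k => (hint k).aemeasurable.ennreal_ofReal) h1
  filter_upwards [h2] with ω hω
  have h3 := ENNReal.tendsto_atTop_zero_of_tsum_ne_top hω.ne
  have h4 := (ENNReal.tendsto_toReal ENNReal.zero_ne_top).comp h3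
  rw [ENNReal.toReal_zero] at h4
  exact h4.congr fun k => ENNReal.toReal_ofReal (h0 k ω)

/-! ### Paths with regular self-intersections -/

/-- The number of pairs `(i, j)` in `[a, b)²` with `z j - z i = q`. -/
def pairCount (z : ℕ → ZSq) (q : ZSq) (a b : ℕ) : ℝ :=
  ∑ i ∈ Finset.Ico a b, ∑ j ∈ Finset.Ico a b, hit z q i j

theorem hit_neg (z : ℕ → ZSq) (q : ZSq) (i j : ℕ) : hit z (-q) i j = hit z q j i := by
  unfold hit
  congr 1
  rw [← neg_sub, neg_inj]

theorem pairCount_eq (z : ℕ → ZSq) (q : ZSq) {a b : ℕ} (hab : a ≤ b) :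
    pairCount z q a b = upCount z q a b + upCount z (-q) a b +
      ((b : ℝ) - a) * if q = 0 then 1 else 0 := by
  induction b, hab using Nat.le_induction with
  | base => simp [pairCount, upCount]
  | succ b hab ih =>
    have e1 : ∀ q, upCount z q a (b + 1) = upCount z q a b + ∑ i ∈ Finset.Ico a b, hit z q i b :=
      fun q => by rw [upCount, Finset.sum_Ico_succ_top hab]; rfl
    have e2 : pairCount z q a (b + 1) = pairCount z q a b + (∑ i ∈ Finset.Ico a b, hit z q i b) +
        (∑ i ∈ Finset.Ico a b, hit z q b i) + hit z q b b := by
      unfold pairCount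
      rw [Finset.sum_Ico_succ_top hab, Finset.sum_Ico_succ_top hab]
      simp_rw [Finset.sum_Ico_succ_top hab]
      rw [Finset.sum_add_distrib]
      ring
    have e3 : hit z q b b = if q = 0 then 1 else 0 := by
      simp [hit, eq_comm]
    rw [e2, ih, e1, e1, e3]
    simp_rw [hit_neg]
    push_cast
    ring

/-- The self-intersections of the path `z` have the asymptotics of those of a planar walk. -/
def IsRegularPath (z : ℕ → ZSq) (c : ℝ) : Prop :=
  ∀ (q : ZSq) (s t : ℝ), 0 ≤ s → s ≤ t →
    Tendsto (fun n : ℕ => pairCount z q ⌊(n : ℝ) * s⌋₊ ⌊(n : ℝ) * t⌋₊ / (n * Real.log n)) atTop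
      (𝓝 (c * (t - s)))

theorem tendsto_floor_mul_div (t : ℝ) (ht : 0 ≤ t) :
    Tendsto (fun n : ℕ => (⌊(n : ℝ) * t⌋₊ : ℝ) / n) atTop (𝓝 t) := by
  have := (tendsto_nat_floor_mul_div_atTop ht).comp (tendsto_natCast_atTop_atTop (R := ℝ))
  refine this.congr fun n => ?_
  simp [mul_comm]

theorem tendsto_floor_sub_div {s t : ℝ} (hs : 0 ≤ s) (hst : s ≤ t) :
    Tendsto (fun n : ℕ => ((⌊(n : ℝ) * t⌋₊ - ⌊(n : ℝ) * s⌋₊ : ℕ) : ℝ) / n) atTop (𝓝 (t - s)) := by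
  refine ((tendsto_floor_mul_div t (hs.trans hst)).sub (tendsto_floor_mul_div s hs)).congr
    fun n => ?_
  rw [Nat.cast_sub (Nat.floor_le_floor (by gcongr)), sub_div]

/-- Ordered pairs come from `q` and from `-q`, which doubles the constant; the diagonal, present for
`q = 0`, is only linear in `n`. -/
theorem isRegularPath_of_upCount {z : ℕ → ZSq} {γ : ℝ}
    (h : ∀ (q : ZSq) (s t : ℝ), 0 ≤ s → s ≤ t →
      Tendsto (fun n : ℕ => upCount z q ⌊(n : ℝ) * s⌋₊ ⌊(n : ℝ) * t⌋₊ / (n * Real.log n)) atTop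
        (𝓝 (γ * (t - s)))) : IsRegularPath z (2 * γ) := by
  intro q s t hs hst
  have hlog : Tendsto (fun n : ℕ => Real.log n) atTop atTop :=
    Real.tendsto_log_atTop.comp tendsto_natCast_atTop_atTop
  have h1 : Tendsto (fun n : ℕ => (((⌊(n : ℝ) * t⌋₊ - ⌊(n : ℝ) * s⌋₊ : ℕ) : ℝ) / n) /
      Real.log n * if q = 0 then 1 else 0) atTop (𝓝 0) := by
    have := ((tendsto_floor_sub_div hs hst).div_atTop hlog).mul_const
      (if q = 0 then (1 : ℝ) else 0)
    rwa [zero_mul] at this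
  have h2 := ((h q s t hs hst).add (h (-q) s t hs hst)).add h1
  have e : γ * (t - s) + γ * (t - s) + 0 = 2 * γ * (t - s) := by ring
  rw [e] at h2
  refine h2.congr fun n => ?_
  have hle : ⌊(n : ℝ) * s⌋₊ ≤ ⌊(n : ℝ) * t⌋₊ := Nat.floor_le_floor (by gcongr)
  rw [pairCount_eq z q hle, Nat.cast_sub hle, div_div]
  ring

namespace IsCenteredWalk

theorem ae_tendsto_upCount_subexp (h : IsCenteredWalk P ζ) (q : ZSq) {s t : ℝ} (hs : 0 ≤ s)
    (hst : s < t) : ∀ᵐ ω ∂P, Tendsto (fun k =>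
      upCount (fun k => randomWalk ζ k ω) q ⌊(subexp k : ℝ) * s⌋₊ ⌊(subexp k : ℝ) * t⌋₊ /
        (subexp k * Real.log (subexp k))) atTop
        (𝓝 (gaussMass P (ζ 0) / (4 * Real.pi ^ 2) * (t - s))) := by
  set γ := gaussMass P (ζ 0) / (4 * Real.pi ^ 2)
  obtain ⟨K, hK, hvar⟩ := h.exists_variance_upCount_le
  set n := subexp with hn
  set a : ℕ → ℕ := fun k => ⌊(n k : ℝ) * s⌋₊ with ha
  set N : ℕ → ℕ := fun k => ⌊(n k : ℝ) * t⌋₊ - ⌊(n k : ℝ) * s⌋₊ with hN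
  have hb : ∀ k, ⌊(n k : ℝ) * t⌋₊ = a k + N k := fun k => by
    have : ⌊(n k : ℝ) * s⌋₊ ≤ ⌊(n k : ℝ) * t⌋₊ := Nat.floor_le_floor (by gcongr)
    simp only [ha, hN]; omega
  set m : ℕ → ℝ := fun N => ∫ ω, upCount (fun k => randomWalk ζ k ω) q 0 N ∂P with hm
  have hmean : ∀ a N, ∫ ω, upCount (fun k => randomWalk ζ k ω) q a (a + N) ∂P = m N := by
    intro a N
    have h1 := h.integral_upCount q 0 N
    rw [zero_add] at h1
    exact (h.integral_upCount q a N).trans h1.symm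
  have hNn : Tendsto (fun k => (N k : ℝ) / n k) atTop (𝓝 (t - s)) :=
    (tendsto_floor_sub_div hs hst.le).comp tendsto_subexp
  have hn0 : ∀ k, (0 : ℝ) < n k := fun k => by exact_mod_cast subexp_pos k
  have hts : 0 < t - s := sub_pos.2 hst
  have hNtop : Tendsto N atTop atTop := by
    have h1 : Tendsto (fun k => (N k : ℝ) / n k * n k) atTop atTop :=
      hNn.pos_mul_atTop hts (tendsto_natCast_atTop_atTop.comp tendsto_subexp)
    refine tendsto_natCast_atTop_iff.1 (h1.congr fun k => ?_)
    exact div_mul_cancel₀ _ (hn0 k).ne'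
  have hmlim : Tendsto (fun k => m (N k) / (n k * Real.log (n k))) atTop (𝓝 (γ * (t - s))) := by
    have h1 := (((h.tendsto_integral_upCount q).comp hNtop).mul hNn).mul
      (tendsto_log_div_log hts tendsto_subexp hNn)
    rw [mul_one] at h1
    refine h1.congr' ?_
    filter_upwards [hNtop.eventually_ge_atTop 2, tendsto_subexp.eventually_ge_atTop 2]
      with k hk hk2
    have h2 : (1 : ℝ) < N k := by exact_mod_cast hk
    have h3 : (1 : ℝ) < n k := by exact_mod_cast hk2
    have := Real.log_pos h2
    have := Real.log_pos h3
    simp only [Function.comp, hm, ← hn]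
    field_simp
  set D : ℕ → Ω → ℝ := fun k ω => (upCount (fun k => randomWalk ζ k ω) q (a k) (a k + N k) -
    m (N k)) / (n k * Real.log (n k)) with hD
  have hD2 : ∀ᵐ ω ∂P, Tendsto (fun k => D k ω ^ 2) atTop (𝓝 0) := by
    have hmem : ∀ k, MemLp (D k) 2 P := fun k => by
      simp only [hD, div_eq_inv_mul]
      exact ((h.memLp_upCount q (a k) (a k + N k)).sub (memLp_const (m (N k)))).const_mul
        (n k * Real.log (n k))⁻¹
    refine ae_tendsto_zero_of_summable_integral (fun k ω => sq_nonneg _)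
      (fun k => (hmem k).integrable_sq) ?_
    -- The variance is `O(n²)` against a squared normalization `n² log² n`, so the second moments of
    -- the errors are summable along `subexp`.
    refine Summable.of_nonneg_of_le (fun k => integral_nonneg fun ω => sq_nonneg _) (fun k => ?_)
      ((Real.summable_nat_rpow_inv.2 (by norm_num : (1 : ℝ) < 3 / 2)).mul_left (K * t ^ 2))
    have h1 : ∫ ω, D k ω ^ 2 ∂P = Var[fun ω => upCount (fun k => randomWalk ζ k ω) q (a k)
        (a k + N k); P] / (n k * Real.log (n k)) ^ 2 := by
      rw [variance_eq_integral (h.memLp_upCount q _ _).aestronglyMeasurable.aemeasurable,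
        hmean, ← integral_div]
      simp_rw [hD, div_pow]
    rw [h1]
    have hNt : (N k : ℝ) ≤ n k * t := by
      have h2 : (⌊(n k : ℝ) * t⌋₊ : ℝ) ≤ n k * t :=
        Nat.floor_le (mul_nonneg (hn0 k).le (hs.trans hst.le))
      refine le_trans ?_ h2
      exact_mod_cast Nat.sub_le _ _
    calc _ ≤ K * (n k * t) ^ 2 / (n k * Real.log (n k)) ^ 2 := by
          gcongr
          exact (hvar q (N k) (a k)).trans (by gcongr)
      _ = K * t ^ 2 * (Real.log (n k) ^ 2)⁻¹ := by
          have := (hn0 k).ne'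
          rw [mul_pow, mul_pow, ← div_eq_mul_inv]
          rcases eq_or_ne (Real.log (n k)) 0 with h0 | h0
          · simp [h0]
          · field_simp
      _ ≤ _ := mul_le_mul_of_nonneg_left (inv_log_subexp_sq_le k) (by positivity)
  filter_upwards [hD2] with ω hω
  have h1 : Tendsto (fun k => D k ω) atTop (𝓝 0) := by
    have := hω.sqrt
    simp_rw [Real.sqrt_sq_eq_abs, Real.sqrt_zero] at this
    exact (tendsto_zero_iff_abs_tendsto_zero _).2 this
  have h2 := h1.add hmlim
  rw [zero_add] at h2
  refine h2.congr fun k => ?_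
  rw [hb k, hD, ← add_div, sub_add_cancel]

/-- Almost every path of the walk is regular. -/
theorem ae_isRegularPath (h : IsCenteredWalk P ζ) :
    ∀ᵐ ω ∂P, IsRegularPath (fun k => randomWalk ζ k ω)
      (Real.pi * √(stepCov P (ζ 0)).det)⁻¹ := by
  have hc : (Real.pi * √(stepCov P (ζ 0)).det)⁻¹ =
      2 * (gaussMass P (ζ 0) / (4 * Real.pi ^ 2)) := by
    rw [gaussMass, mul_inv]
    have := Real.pi_pos
    field_simp
    ring
  rw [hc]
  have h1 : ∀ᵐ ω ∂P, ∀ (q : ZSq) (s t : ℚ), 0 ≤ s → s < t → Tendsto (fun k =>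
      upCount (fun k => randomWalk ζ k ω) q ⌊(subexp k : ℝ) * s⌋₊ ⌊(subexp k : ℝ) * t⌋₊ /
        (subexp k * Real.log (subexp k))) atTop
        (𝓝 (gaussMass P (ζ 0) / (4 * Real.pi ^ 2) * (t - s))) := by
    simp_rw [ae_all_iff]
    intro q s t hs hst
    exact h.ae_tendsto_upCount_subexp q (by exact_mod_cast hs) (by exact_mod_cast hst)
  filter_upwards [h1] with ω hω
  have hγ : 0 < gaussMass P (ζ 0) / (4 * Real.pi ^ 2) :=
    div_pos h.gaussMass_pos (by have := Real.pi_pos; positivity)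
  exact isRegularPath_of_upCount fun q s t hs hst =>
    tendsto_of_subexp (upCount_mono _ q) (upCount_nonneg _ q) hγ (hω q) hs hst

end IsCenteredWalk

end

noncomputable section

/-! ### The topology of the space of càdlàg paths -/

/-- Weak convergence can be tested on bounded uniformly continuous functions. -/
theorem tendsto_probabilityMeasure_of_uniformContinuous {Z : Type*} [UniformSpace Z]
    [(uniformity Z).IsCountablyGenerated] [MeasurableSpace Z] [OpensMeasurableSpace Z]
    {ι : Type*} {l : Filter ι} [l.IsCountablyGenerated]
    {ν : ι → ProbabilityMeasure Z} {ν₀ : ProbabilityMeasure Z}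
    (h : ∀ F : Z → ℝ, UniformContinuous F → (∃ C, ∀ f, |F f| ≤ C) →
      Tendsto (fun i => ∫ f, F f ∂(ν i : Measure Z)) l (𝓝 (∫ f, F f ∂(ν₀ : Measure Z)))) :
    Tendsto ν l (𝓝 ν₀) := by
  let _ : PseudoMetricSpace Z := UniformSpace.pseudoMetricSpace Z
  refine tendsto_iff_forall_lipschitz_integral_tendsto.2 fun F hb hL => h F ?_ ?_
  · obtain ⟨L, hL⟩ := hL
    exact hL.uniformContinuous
  · obtain ⟨C, hC⟩ := hb
    rcases isEmpty_or_nonempty Z with he | ⟨⟨g⟩⟩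
    · exact ⟨0, fun f => (he.false f).elim⟩
    · refine ⟨C + |F g|, fun f => ?_⟩
      have := hC f g
      rw [Real.dist_eq] at this
      have h3 := abs_sub_abs_le_abs_sub (F f) (F g)
      linarith

namespace CadlagPath

/-- The inclusion of `D[0, ∞)` in the space of functions with the uniform structure of uniform
convergence on compact sets. -/
def toUniformOnFun (f : CadlagPath) : UniformOnFun ℝ≥0 ℝ {K : Set ℝ≥0 | IsCompact K} :=
  UniformOnFun.ofFun {K : Set ℝ≥0 | IsCompact K} f.1

theorem isInducing_toUniformOnFun : IsInducing toUniformOnFun := ⟨rfl⟩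

theorem subset_Iic_of_isCompact {K : Set ℝ≥0} (hK : IsCompact K) : ∃ n : ℕ, K ⊆ Set.Iic (n : ℝ≥0) := by
  obtain ⟨T, hT⟩ := hK.bddAbove
  obtain ⟨n, hn⟩ := exists_nat_ge T
  exact ⟨n, fun x hx => (hT hx).trans hn⟩

theorem isCompact_Iic (T : ℝ≥0) : IsCompact (Set.Iic T) := by
  rw [← Set.Icc_bot]; exact isCompact_Icc

theorem tendsto_iff {ι : Type*} {l : Filter ι} {f : ι → CadlagPath} {g : CadlagPath} :
    Tendsto f l (𝓝 g) ↔
      ∀ T : ℕ, ∀ ε > 0, ∀ᶠ i in l, ∀ t : ℝ≥0, t ≤ T → |f i t - g t| < ε := by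
  rw [isInducing_toUniformOnFun.tendsto_nhds_iff,
    UniformOnFun.tendsto_iff_tendstoUniformlyOn]
  constructor
  · intro h T ε hε
    filter_upwards [Metric.tendstoUniformlyOn_iff.1 (h (Set.Iic T) (isCompact_Iic _)) ε hε]
      with i hi t ht
    have := hi t ht
    rw [Real.dist_eq, abs_sub_comm] at this
    exact this
  · intro h K hK
    obtain ⟨n, hn⟩ := subset_Iic_of_isCompact hK
    refine Metric.tendstoUniformlyOn_iff.2 fun ε hε => ?_
    filter_upwards [h n ε hε] with i hi t ht
    rw [Real.dist_eq, abs_sub_comm]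
    exact hi t (hn ht)

theorem isCountablyGenerated_uniformity :
    (@uniformity (UniformOnFun ℝ≥0 ℝ {K : Set ℝ≥0 | IsCompact K}) _).IsCountablyGenerated :=
  UniformOnFun.isCountablyGenerated_uniformity _ (t := fun n : ℕ => Set.Iic (n : ℝ≥0))
    (fun n => isCompact_Iic _) (fun m n h => Set.Iic_subset_Iic.2 (by exact_mod_cast h))
    fun _ hK => subset_Iic_of_isCompact hK

/-- Needed so that almost everywhere limits of measurable random paths are measurable; the space is
not separable. -/
instance : TopologicalSpace.PseudoMetrizableSpace CadlagPath := by
  have := isCountablyGenerated_uniformity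
  have : TopologicalSpace.PseudoMetrizableSpace (UniformOnFun ℝ≥0 ℝ {K : Set ℝ≥0 | IsCompact K}) :=
    UniformSpace.pseudoMetrizableSpace
  exact isInducing_toUniformOnFun.pseudoMetrizableSpace

/-- A function of a path is uniformly continuous for the uniform structure of uniform convergence
on compact sets. -/
def IsUniform (F : CadlagPath → ℝ) : Prop :=
  ∀ ε > 0, ∃ T : ℕ, ∃ δ > 0, ∀ f g : CadlagPath,
    (∀ t : ℝ≥0, t ≤ T → |f t - g t| < δ) → |F f - F g| < ε

theorem IsUniform.continuous {F : CadlagPath → ℝ} (hF : IsUniform F) : Continuous F := by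
  refine continuous_iff_continuousAt.2 fun g => Metric.tendsto_nhds.2 fun ε hε => ?_
  obtain ⟨T, δ, hδ, h⟩ := hF ε hε
  filter_upwards [tendsto_iff.1 (tendsto_id (α := CadlagPath) (x := 𝓝 g)) T δ hδ] with f hf
  exact h f g hf

/-- Weak convergence in `D[0, ∞)` can be tested on bounded uniformly continuous functions. -/
theorem tendsto_probabilityMeasure {ι : Type*} {l : Filter ι} [l.IsCountablyGenerated]
    {ν : ι → ProbabilityMeasure CadlagPath} {ν₀ : ProbabilityMeasure CadlagPath}
    (h : ∀ F : CadlagPath → ℝ, IsUniform F → (∃ C, ∀ f, |F f| ≤ C) →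
      Tendsto (fun i => ∫ f, F f ∂(ν i : Measure CadlagPath)) l
        (𝓝 (∫ f, F f ∂(ν₀ : Measure CadlagPath)))) : Tendsto ν l (𝓝 ν₀) := by
  -- The topology of this pulled back uniformity is by definition the given one, and a compact
  -- exhaustion gives it a countable base.
  let u : UniformSpace CadlagPath := UniformSpace.comap toUniformOnFun inferInstance
  have hu : (@uniformity CadlagPath u).IsCountablyGenerated := by
    have := isCountablyGenerated_uniformity
    exact Filter.comap.isCountablyGenerated _ _
  have ho : @OpensMeasurableSpace CadlagPath u.toTopologicalSpace _ :=
    (inferInstance : OpensMeasurableSpace CadlagPath)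
  refine @tendsto_probabilityMeasure_of_uniformContinuous CadlagPath u hu _ ho ι l _ ν ν₀
    fun F hF hb => h F ?_ hb
  intro ε hε
  have h3 : {p : CadlagPath × CadlagPath | dist (F p.1) (F p.2) < ε} ∈ @uniformity CadlagPath u :=
    hF (Metric.dist_mem_uniformity hε)
  have h4 : @uniformity CadlagPath u = Filter.comap (Prod.map toUniformOnFun toUniformOnFun)
      (uniformity (UniformOnFun ℝ≥0 ℝ {K : Set ℝ≥0 | IsCompact K})) := rfl
  rw [h4] at h3
  obtain ⟨V, hV, hVs⟩ := h3
  obtain ⟨n, hn⟩ := (UniformOnFun.hasAntitoneBasis_uniformity {K : Set ℝ≥0 | IsCompact K}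
    (t := fun n : ℕ => Set.Iic (n : ℝ≥0))
    (fun n => isCompact_Iic _) (fun m n h => Set.Iic_subset_Iic.2 (by exact_mod_cast h))
    (fun _ hK => subset_Iic_of_isCompact hK)
    (V := fun n : ℕ => {p : ℝ × ℝ | dist p.1 p.2 < 1 / ((n : ℝ) + 1)})
    ⟨Metric.uniformity_basis_dist_inv_nat_succ, fun m n hmn p hp => by
      simp only [Set.mem_ofPred_eq] at hp ⊢
      refine hp.trans_le ?_
      gcongr⟩).mem_iff.1 hV
  refine ⟨n, 1 / ((n : ℝ) + 1), by positivity, fun f g hfg => ?_⟩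
  have h5 : (toUniformOnFun f, toUniformOnFun g) ∈ V := hn fun t ht => hfg t ht
  have h6 : (f, g) ∈ Prod.map toUniformOnFun toUniformOnFun ⁻¹' V := h5
  exact hVs h6

/-- A continuous path. -/
def ofContinuous (f : ℝ≥0 → ℝ) (hf : Continuous f) : CadlagPath :=
  ⟨f, fun t => ⟨hf.continuousWithinAt, f t, hf.continuousAt.tendsto.mono_left nhdsWithin_le_nhds⟩⟩

theorem continuous_scale (c : ℝ) : Continuous (scale c) := by
  refine continuous_iff_continuousAt.2 fun g => tendsto_iff.2 fun T ε hε => ?_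
  have h := tendsto_iff.1 (tendsto_id (α := CadlagPath) (x := 𝓝 g)) T (ε / (|c| + 1))
    (by positivity)
  filter_upwards [h] with f hf t ht
  have h1 := hf t ht
  change |c * f t - c * g t| < ε
  rw [lt_div_iff₀ (by positivity)] at h1
  rw [← mul_sub, abs_mul]
  change |f t - g t| * (|c| + 1) < ε at h1
  nlinarith [abs_nonneg (f t - g t)]

/-- On a compact set the step path depends on finitely many values of `s` only. This provides Borel
measurability of the normalized sums in a nonseparable space. -/
theorem continuous_step (n : ℕ) : Continuous fun s : ℕ → ℝ => step s n := by
  refine continuous_iff_continuousAt.2 fun s => tendsto_iff.2 fun T ε hε => ?_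
  have h : ∀ k ∈ Finset.range (n * T + 1), ∀ᶠ s' : ℕ → ℝ in 𝓝 s, |s' k - s k| < ε := by
    intro k _
    have := (continuous_apply k).tendsto s
    exact Metric.tendsto_nhds.1 this ε hε
  filter_upwards [(Finset.eventually_all _).2 h] with s' hs' t ht
  refine hs' ⌊(n : ℝ≥0) * t⌋₊ (Finset.mem_range.2 ?_)
  rw [Nat.lt_add_one_iff]
  refine Nat.floor_le_of_le ?_
  push_cast
  gcongr

end CadlagPath

/-- Comparison of expectations of functions which are close off an event. -/
theorem abs_integral_sub_integral_le {E : Type*} [MeasurableSpace E] {μ : Measure E}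
    [IsProbabilityMeasure μ] {f g : E → ℝ} (hf : AEStronglyMeasurable f μ)
    (hg : AEStronglyMeasurable g μ) {B ε : ℝ} (hfB : ∀ x, |f x| ≤ B) (hgB : ∀ x, |g x| ≤ B)
    (hε : 0 ≤ ε) (S : Set E) (h : ∀ᵐ x ∂μ, x ∉ S → |f x - g x| ≤ ε) :
    |∫ x, f x ∂μ - ∫ x, g x ∂μ| ≤ ε + 2 * B * μ.real S := by
  have hfi : Integrable f μ := Integrable.of_bound hf B (ae_of_all _ hfB)
  have hgi : Integrable g μ := Integrable.of_bound hg B (ae_of_all _ hgB)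
  rw [← integral_sub hfi hgi]
  have hS : MeasurableSet (toMeasurable μ S) := measurableSet_toMeasurable _ _
  have hB : 0 ≤ B := by
    obtain ⟨x⟩ := μ.nonempty_of_neZero
    exact (abs_nonneg _).trans (hfB x)
  have hi : Integrable (fun x => ε + (toMeasurable μ S).indicator (fun _ => 2 * B) x) μ :=
    (integrable_const ε).add ((integrable_const (2 * B)).indicator hS)
  calc |∫ x, (f x - g x) ∂μ| ≤ ∫ x, |f x - g x| ∂μ := abs_integral_le_integral_abs
    _ ≤ ∫ x, (ε + (toMeasurable μ S).indicator (fun _ => 2 * B) x) ∂μ := by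
        refine integral_mono_ae (hfi.sub hgi).abs hi ?_
        filter_upwards [h] with x hx
        by_cases hxS : x ∈ toMeasurable μ S
        · simp only [Set.indicator_of_mem hxS]
          have := abs_sub (f x) (g x)
          have h1 := hfB x
          have h2 := hgB x
          linarith
        · simp only [Set.indicator_of_notMem hxS, add_zero]
          exact hx fun h' => hxS (subset_toMeasurable _ _ h')
    _ = _ := by
        rw [integral_add (integrable_const _) ((integrable_const _).indicator hS),
          integral_indicator hS, integral_const, setIntegral_const]
        simp [measureReal_def, measure_toMeasurable]
        ring

end

noncomputable section

variable {E : Type*} [MeasurableSpace E] {μ : Measure E} [IsProbabilityMeasure μ]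
  {X : ZSq → E → ℝ}

/-! ### Independent fields -/

/-- A field of i.i.d. centered random variables of variance one. -/
structure IsIIDField (μ : Measure E) (X : ZSq → E → ℝ) : Prop where
  meas : ∀ l, Measurable (X l)
  indep : iIndepFun X μ
  ident : ∀ l, IdentDistrib (X l) (X 0) μ μ
  mean : ∫ x, X 0 x ∂μ = 0
  norm : eLpNorm (X 0) 2 μ = 1

namespace IsIIDField

theorem memLp (h : IsIIDField μ X) (l : ZSq) : MemLp (X l) 2 μ :=
  (h.ident l).symm.memLp_snd ⟨(h.meas 0).aestronglyMeasurable, by rw [h.norm]; simp⟩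

theorem integral_eq_zero (h : IsIIDField μ X) (l : ZSq) : ∫ x, X l x ∂μ = 0 :=
  (h.ident l).integral_eq.trans h.mean

theorem integral_sq (h : IsIIDField μ X) (l : ZSq) : ∫ x, X l x ^ 2 ∂μ = 1 := by
  have h1 : ∫ x, X l x ^ 2 ∂μ = ∫ x, X 0 x ^ 2 ∂μ :=
    ((h.ident l).comp (measurable_id.pow_const 2)).integral_eq
  have h2 := h.norm
  rw [(h.memLp 0).eLpNorm_eq_integral_rpow_norm (by norm_num) (by norm_num)] at h2
  rw [h1]
  simp only [ENNReal.toReal_ofNat, Real.rpow_two, Real.norm_eq_abs, sq_abs] at h2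
  rw [ENNReal.ofReal_eq_one] at h2
  have h3 : 0 ≤ ∫ x, X 0 x ^ 2 ∂μ := integral_nonneg fun x => sq_nonneg _
  have h4 := congrArg (fun y : ℝ => y ^ (2 : ℝ)) h2
  simp only [Real.one_rpow] at h4
  rwa [← Real.rpow_mul h3, inv_mul_cancel₀ (by norm_num), Real.rpow_one] at h4

theorem integral_mul (h : IsIIDField μ X) (k l : ZSq) :
    ∫ x, X k x * X l x ∂μ = if k = l then 1 else 0 := by
  split_ifs with hkl
  · subst hkl
    simp_rw [← sq]
    exact h.integral_sq k
  · have := (h.indep.indepFun hkl).integral_fun_mul_eq_mul_integral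
      (h.meas k).aestronglyMeasurable (h.meas l).aestronglyMeasurable
    rw [this, h.integral_eq_zero, zero_mul]

/-- Every estimate for independent fields thereby applies to translates, and through `neg` to the
opposite field. -/
theorem shift (h : IsIIDField μ X) (q : ZSq) : IsIIDField μ fun l => X (l - q) where
  meas _ := h.meas _
  indep := h.indep.precomp (sub_left_injective (b := q))
  ident _ := (h.ident _).trans (h.ident _).symm
  mean := h.integral_eq_zero _
  norm := ((h.ident _).eLpNorm_eq (p := 2)).trans h.norm

theorem neg (h : IsIIDField μ X) : IsIIDField μ fun l x => -X l x where
  meas l := (h.meas l).neg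
  indep := h.indep.comp (fun _ y => -y) fun _ => measurable_neg
  ident l := (h.ident l).comp measurable_neg
  mean := by rw [integral_neg, h.mean, neg_zero]
  norm := (eLpNorm_neg (X 0) 2 μ).trans h.norm

end IsIIDField

/-! ### Sums along segments of paths and local times -/

/-- The sum of the field along the path `z` between the times `a` and `b`. -/
def segSum (X : ZSq → E → ℝ) (z : ℕ → ZSq) (a b : ℕ) (x : E) : ℝ :=
  ∑ k ∈ Finset.Ico a b, X (z k) x

/-- The time spent by the path `z` at `l` between the times `a` and `b`. -/
def locTime (z : ℕ → ZSq) (a b : ℕ) (l : ZSq) : ℝ :=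
  ∑ k ∈ Finset.Ico a b, if z k = l then 1 else 0

/-- The number of intersections of two segments of a path. -/
def segInter (z : ℕ → ZSq) (a b a' b' : ℕ) : ℝ :=
  ∑ k ∈ Finset.Ico a b, ∑ k' ∈ Finset.Ico a' b', hit z 0 k k'

theorem segInter_self (z : ℕ → ZSq) (a b : ℕ) : segInter z a b a b = pairCount z 0 a b := rfl

theorem segInter_nonneg (z : ℕ → ZSq) (a b a' b' : ℕ) : 0 ≤ segInter z a b a' b' :=
  Finset.sum_nonneg fun _ _ => Finset.sum_nonneg fun _ _ => hit_nonneg _ _ _ _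

theorem locTime_nonneg (z : ℕ → ZSq) (a b : ℕ) (l : ZSq) : 0 ≤ locTime z a b l :=
  Finset.sum_nonneg fun _ _ => by split_ifs <;> simp

theorem segSum_eq_sum_locTime (X : ZSq → E → ℝ) {z : ℕ → ZSq} {a b : ℕ} {A : Finset ZSq}
    (hA : ∀ k ∈ Finset.Ico a b, z k ∈ A) (x : E) :
    segSum X z a b x = ∑ l ∈ A, locTime z a b l * X l x := by
  simp_rw [segSum, locTime, Finset.sum_mul]
  rw [Finset.sum_comm]
  refine Finset.sum_congr rfl fun k hk => ?_
  simp only [ite_mul, one_mul, zero_mul]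
  rw [Finset.sum_ite_eq, if_pos (hA k hk)]

theorem sum_locTime_mul {z : ℕ → ZSq} {a b a' b' : ℕ} {A : Finset ZSq}
    (hA : ∀ k ∈ Finset.Ico a b, z k ∈ A) :
    ∑ l ∈ A, locTime z a b l * locTime z a' b' l = segInter z a b a' b' := by
  simp_rw [segInter, locTime, Finset.sum_mul, Finset.mul_sum]
  rw [Finset.sum_comm]
  refine Finset.sum_congr rfl fun k hk => ?_
  rw [Finset.sum_comm]
  refine Finset.sum_congr rfl fun k' _ => ?_
  simp only [ite_mul, one_mul, zero_mul]
  rw [Finset.sum_ite_eq, if_pos (hA k hk), hit]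
  simp only [sub_eq_zero]

theorem locTime_mul_le (z : ℕ → ZSq) (a b a' b' : ℕ) (l : ZSq) :
    locTime z a b l * locTime z a' b' l ≤ segInter z a b a' b' := by
  rw [← sum_locTime_mul (A := insert l ((Finset.Ico a b).image z)) fun k hk =>
    Finset.mem_insert_of_mem (Finset.mem_image_of_mem z hk)]
  exact Finset.single_le_sum (f := fun l => locTime z a b l * locTime z a' b' l)
    (fun l _ => mul_nonneg (locTime_nonneg _ _ _ _) (locTime_nonneg _ _ _ _))
    (Finset.mem_insert_self _ _)

theorem sum_blocks {M : Type*} [AddCommMonoid M] (f : ℕ → M) {τ : ℕ → ℕ} (hτ : Monotone τ)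
    (K : ℕ) : ∑ j ∈ Finset.range K, ∑ k ∈ Finset.Ico (τ j) (τ (j + 1)), f k =
      ∑ k ∈ Finset.Ico (τ 0) (τ K), f k := by
  induction K with
  | zero => simp
  | succ K ih =>
    rw [Finset.sum_range_succ, ih, Finset.sum_Ico_consecutive _ (hτ (Nat.zero_le K))
      (hτ (Nat.le_succ K))]

theorem pairCount_blocks (z : ℕ → ZSq) {τ : ℕ → ℕ} (hτ : Monotone τ) (K : ℕ) :
    pairCount z 0 (τ 0) (τ K) = ∑ i ∈ Finset.range K, ∑ j ∈ Finset.range K,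
      segInter z (τ i) (τ (i + 1)) (τ j) (τ (j + 1)) := by
  unfold pairCount segInter
  rw [← sum_blocks (fun i => ∑ j ∈ Finset.Ico (τ 0) (τ K), hit z 0 i j) hτ K]
  refine Finset.sum_congr rfl fun i _ => ?_
  conv_rhs => rw [Finset.sum_comm]
  refine Finset.sum_congr rfl fun k _ => ?_
  rw [sum_blocks _ hτ K]

/-- The intersections of different blocks. -/
def offDiag (z : ℕ → ZSq) (τ : ℕ → ℕ) (K : ℕ) : ℝ :=
  pairCount z 0 (τ 0) (τ K) - ∑ j ∈ Finset.range K, pairCount z 0 (τ j) (τ (j + 1))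

theorem offDiag_eq (z : ℕ → ZSq) {τ : ℕ → ℕ} (hτ : Monotone τ) (K : ℕ) :
    offDiag z τ K = ∑ i ∈ Finset.range K, ∑ j ∈ (Finset.range K).erase i,
      segInter z (τ i) (τ (i + 1)) (τ j) (τ (j + 1)) := by
  rw [offDiag, pairCount_blocks z hτ, ← Finset.sum_sub_distrib]
  refine Finset.sum_congr rfl fun i hi => ?_
  rw [← Finset.add_sum_erase _ _ hi, segInter_self]
  ring

theorem segInter_le_offDiag (z : ℕ → ZSq) {τ : ℕ → ℕ} (hτ : Monotone τ) {K i j : ℕ}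
    (hi : i < K) (hj : j < K) (hij : j ≠ i) :
    segInter z (τ i) (τ (i + 1)) (τ j) (τ (j + 1)) ≤ offDiag z τ K := by
  rw [offDiag_eq z hτ]
  refine le_trans ?_ (Finset.single_le_sum (f := fun i => ∑ j ∈ (Finset.range K).erase i,
    segInter z (τ i) (τ (i + 1)) (τ j) (τ (j + 1))) (fun i _ => Finset.sum_nonneg fun j _ =>
      segInter_nonneg _ _ _ _ _) (Finset.mem_range.2 hi))
  exact Finset.single_le_sum (f := fun j => segInter z (τ i) (τ (i + 1)) (τ j) (τ (j + 1)))
    (fun j _ => segInter_nonneg _ _ _ _ _) (Finset.mem_erase.2 ⟨hij, Finset.mem_range.2 hj⟩)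

/-- Local times are controlled by the self-intersections of blocks and the intersections of
different blocks. -/
theorem locTime_sq_le (z : ℕ → ZSq) {τ : ℕ → ℕ} (hτ : Monotone τ) (K : ℕ) (l : ZSq) {κ : ℝ}
    (hκ0 : 0 ≤ κ) (hκ : ∀ j < K, pairCount z 0 (τ j) (τ (j + 1)) ≤ κ) :
    locTime z (τ 0) (τ K) l ^ 2 ≤ 2 * offDiag z τ K + κ := by
  set L : ℕ → ℝ := fun j => locTime z (τ j) (τ (j + 1)) l with hL
  have hL0 : ∀ j, 0 ≤ L j := fun j => locTime_nonneg _ _ _ _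
  set T := locTime z (τ 0) (τ K) l
  have hT : T = ∑ j ∈ Finset.range K, L j := (sum_blocks _ hτ K).symm
  have hLκ : ∀ j ∈ Finset.range K, L j ≤ √κ := fun j hj => by
    refine Real.le_sqrt_of_sq_le ?_
    rw [sq]
    exact (locTime_mul_le z _ _ _ _ l).trans (hκ j (Finset.mem_range.1 hj))
  -- Products of different blocks are counted by `offDiag`, and squares of single blocks by `√κ`
  -- times the total. The term `√κ * T` is absorbed below through `2 √κ T ≤ κ + T²`.
  have h1 : T ^ 2 ≤ offDiag z τ K + √κ * T := by
    rw [offDiag_eq z hτ, hT, sq, Finset.sum_mul_sum, Finset.mul_sum, ← Finset.sum_add_distrib]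
    refine Finset.sum_le_sum fun i hi => ?_
    rw [← Finset.add_sum_erase _ _ hi, add_comm]
    refine add_le_add (Finset.sum_le_sum fun j _ => locTime_mul_le z _ _ _ _ l) ?_
    exact mul_le_mul_of_nonneg_right (hLκ i hi) (hL0 i)
  have h2 := Real.mul_self_sqrt hκ0
  nlinarith [sq_nonneg (√κ - T)]

/-! ### Asymptotics along a regular path -/

/-- The grid of mesh `1 / m` at scale `n`. -/
def grid (m n j : ℕ) : ℕ := ⌊(n : ℝ) * ((j : ℝ) / m)⌋₊

theorem grid_mono (m n : ℕ) : Monotone (grid m n) := fun i j hij =>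
  Nat.floor_le_floor (by gcongr)

theorem grid_zero (m n : ℕ) : grid m n 0 = 0 := by simp [grid]

theorem grid_mul {m : ℕ} (hm : 0 < m) (n T : ℕ) : grid m n (m * T) = n * T := by
  have : (m : ℝ) ≠ 0 := by exact_mod_cast hm.ne'
  rw [grid]
  have e : (n : ℝ) * (((m * T : ℕ) : ℝ) / m) = ((n * T : ℕ) : ℝ) := by
    push_cast; field_simp
  rw [e, Nat.floor_natCast]

namespace IsRegularPath

variable {z : ℕ → ZSq} {c : ℝ}

theorem tendsto_block (h : IsRegularPath z c) (m j : ℕ) (hm : 0 < m) :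
    Tendsto (fun n => pairCount z 0 (grid m n j) (grid m n (j + 1)) / (n * Real.log n)) atTop
      (𝓝 (c / m)) := by
  have := h 0 ((j : ℝ) / m) (((j + 1 : ℕ) : ℝ) / m) (by positivity) (by gcongr; simp)
  have e : c * ((((j + 1 : ℕ) : ℝ) / m) - (j : ℝ) / m) = c / m := by
    push_cast; ring
  rwa [e] at this

/-- The limit for the whole interval equals the sum of the limits for the blocks, so nothing of
order `n log n` is left for intersections of different blocks. -/
theorem tendsto_offDiag (h : IsRegularPath z c) (m K : ℕ) (hm : 0 < m) :
    Tendsto (fun n => offDiag z (grid m n) K / (n * Real.log n)) atTop (𝓝 0) := by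
  have h1 := h 0 0 ((K : ℝ) / m) le_rfl (by positivity)
  have h2 := tendsto_finsetSum (Finset.range K) fun j _ => h.tendsto_block m j hm
  have h3 := h1.sub h2
  have e : c * ((K : ℝ) / m - 0) - ∑ _j ∈ Finset.range K, c / m = 0 := by
    simp; ring
  rw [e] at h3
  refine h3.congr fun n => ?_
  rw [offDiag, sub_div, Finset.sum_div, grid_zero]
  simp [grid]

/-- Different blocks are asymptotically orthogonal; this is the source of the independent increments
of the limit. -/
theorem tendsto_segInter (h : IsRegularPath z c) {m K i j : ℕ} (hm : 0 < m) (hi : i < K)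
    (hj : j < K) :
    Tendsto (fun n => segInter z (grid m n i) (grid m n (i + 1)) (grid m n j) (grid m n (j + 1)) /
      (n * Real.log n)) atTop (𝓝 (if i = j then c / m else 0)) := by
  split_ifs with hij
  · subst hij
    exact h.tendsto_block m i hm
  · refine squeeze_zero (fun n => div_nonneg (segInter_nonneg _ _ _ _ _)
      (mul_nonneg (Nat.cast_nonneg _) (Real.log_natCast_nonneg _))) (fun n => ?_)
      (h.tendsto_offDiag m K hm)
    exact div_le_div_of_nonneg_right (segInter_le_offDiag z (grid_mono m n) hi hj (Ne.symm hij))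
      (mul_nonneg (Nat.cast_nonneg _) (Real.log_natCast_nonneg _))

/-- Local times are negligible with respect to the normalization. -/
theorem eventually_locTime_sq_le (h : IsRegularPath z c) (T : ℕ) {ε : ℝ} (hε : 0 < ε) :
    ∀ᶠ n : ℕ in atTop, ∀ l, locTime z 0 (n * T) l ^ 2 ≤ ε * (n * Real.log n) := by
  -- The mesh is such that each block has self-intersections below `ε / 2` in the limit; with `ε /
  -- 4` for the intersections of different blocks, `locTime_sq_le` gives `ε`.
  obtain ⟨m, hm⟩ := exists_nat_gt (2 * c / ε + 1)
  have hc0 : 0 ≤ c := by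
    have h1 := h 0 0 1 le_rfl zero_le_one
    rw [sub_zero, mul_one] at h1
    refine ge_of_tendsto' h1 fun n => div_nonneg (Finset.sum_nonneg fun _ _ =>
      Finset.sum_nonneg fun _ _ => hit_nonneg _ _ _ _)
      (mul_nonneg (Nat.cast_nonneg _) (Real.log_natCast_nonneg _))
  have hm0 : (0 : ℝ) < m := by
    have : 0 ≤ 2 * c / ε := by positivity
    linarith
  have hm' : 0 < m := by exact_mod_cast hm0
  have h1 : c / m < ε / 2 := by
    rw [div_lt_div_iff₀ hm0 (by norm_num)]
    have h2 : 2 * c / ε < m := by linarith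
    rw [div_lt_iff₀ hε] at h2
    linarith
  have h2 := (Finset.eventually_all (Finset.range (m * T))).2 fun j _ =>
    (h.tendsto_block m j hm').eventually_lt_const h1
  have h3 := (h.tendsto_offDiag m (m * T) hm').eventually_lt_const (show (0 : ℝ) < ε / 4 by
    positivity)
  filter_upwards [h2, h3, eventually_ge_atTop 2] with n hn2 hn3 hn l
  have hr : 0 < (n : ℝ) * Real.log n := by
    have : (1 : ℝ) < n := by exact_mod_cast hn
    have := Real.log_pos this
    positivity
  rw [div_lt_iff₀ hr] at hn3
  have h4 := locTime_sq_le z (grid_mono m n) (m * T) l (κ := ε / 2 * (n * Real.log n))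
    (by positivity) fun j hj => by
      have := hn2 j (Finset.mem_range.2 hj)
      rw [div_lt_iff₀ hr] at this
      exact this.le
  rw [grid_zero, grid_mul hm'] at h4
  linarith

end IsRegularPath

end

noncomputable section

variable {E : Type*} [MeasurableSpace E] {μ : Measure E} [IsProbabilityMeasure μ]
  {X : ZSq → E → ℝ}

/-! ### The central limit theorem for weighted sums -/

theorem norm_prod_sub_prod_le {ι : Type*} (A : Finset ι) (f g : ι → ℂ) (hf : ∀ i, ‖f i‖ ≤ 1)
    (hg : ∀ i, ‖g i‖ ≤ 1) : ‖∏ i ∈ A, f i - ∏ i ∈ A, g i‖ ≤ ∑ i ∈ A, ‖f i - g i‖ := by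
  classical
  induction A using Finset.induction_on with
  | empty => simp
  | insert a A ha ih =>
    rw [Finset.prod_insert ha, Finset.prod_insert ha, Finset.sum_insert ha]
    have h1 : ‖∏ i ∈ A, g i‖ ≤ 1 := by
      rw [norm_prod]
      exact Finset.prod_le_one (fun _ _ => norm_nonneg _) fun i _ => hg i
    calc ‖f a * ∏ i ∈ A, f i - g a * ∏ i ∈ A, g i‖
        = ‖f a * (∏ i ∈ A, f i - ∏ i ∈ A, g i) + (f a - g a) * ∏ i ∈ A, g i‖ := by
          congr 1; ring
      _ ≤ ‖f a‖ * ‖∏ i ∈ A, f i - ∏ i ∈ A, g i‖ + ‖f a - g a‖ * ‖∏ i ∈ A, g i‖ := by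
          refine (norm_add_le _ _).trans ?_
          rw [norm_mul, norm_mul]
      _ ≤ 1 * ‖∏ i ∈ A, f i - ∏ i ∈ A, g i‖ + ‖f a - g a‖ * 1 := by
          gcongr
          exact hf a
      _ ≤ _ := by linarith

namespace IsIIDField

theorem exists_charFun_sub_exp_le (h : IsIIDField μ X) {ε : ℝ} (hε : 0 < ε) :
    ∃ δ > 0, ∀ x : ℝ, |x| ≤ δ →
      ‖charFun (μ.map (X 0)) x - Complex.exp (-(x ^ 2 / 2 : ℝ))‖ ≤ ε * x ^ 2 := by
  have h1 := taylor_charFun_two (h.meas 0).aemeasurable h.mean (by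
    simpa using h.integral_sq 0)
  have h2 := h1.def (half_pos hε)
  obtain ⟨δ, hδ, h3⟩ := Metric.eventually_nhds_iff.1 h2
  refine ⟨min (δ / 2) (min 1 (√ε)), by positivity, fun x hx => ?_⟩
  have hx1 : |x| ≤ δ / 2 := hx.trans (min_le_left _ _)
  have hx2 : |x| ≤ 1 := hx.trans ((min_le_right _ _).trans (min_le_left _ _))
  have hx3 : |x| ≤ √ε := hx.trans ((min_le_right _ _).trans (min_le_right _ _))
  have h4 := h3 (y := x) (by rw [Real.dist_eq, sub_zero]; linarith)
  have hxe : x ^ 2 ≤ ε := by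
    rw [← sq_abs]
    calc |x| ^ 2 ≤ √ε ^ 2 := by gcongr
      _ = ε := Real.sq_sqrt hε.le
  have hxo : x ^ 2 ≤ 1 := by rw [← sq_abs]; exact pow_le_one₀ (abs_nonneg _) hx2
  have h5 : |Real.exp (-(x ^ 2 / 2)) - 1 - -(x ^ 2 / 2)| ≤ (-(x ^ 2 / 2)) ^ 2 :=
    Real.abs_exp_sub_one_sub_id_le (by
      rw [abs_neg, abs_of_nonneg (by positivity)]; linarith)
  have h6 : ‖(1 - (x : ℂ) ^ 2 / 2) - Complex.exp (-(x ^ 2 / 2 : ℝ))‖ ≤ ε / 2 * x ^ 2 := by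
    have e : (1 - (x : ℂ) ^ 2 / 2) - Complex.exp (-(x ^ 2 / 2 : ℝ)) =
        ((-(Real.exp (-(x ^ 2 / 2)) - 1 - -(x ^ 2 / 2)) : ℝ) : ℂ) := by
      push_cast; ring
    rw [e, Complex.norm_real, Real.norm_eq_abs, abs_neg]
    refine h5.trans ?_
    nlinarith [sq_nonneg x]
  have h7 : ‖charFun (μ.map (X 0)) x - (1 - (x : ℂ) ^ 2 / 2)‖ ≤ ε / 2 * x ^ 2 := by
    rw [Real.norm_of_nonneg (sq_nonneg x)] at h4
    exact h4
  calc _ = ‖(charFun (μ.map (X 0)) x - (1 - (x : ℂ) ^ 2 / 2)) +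
        ((1 - (x : ℂ) ^ 2 / 2) - Complex.exp (-(x ^ 2 / 2 : ℝ)))‖ := by congr 1; ring
    _ ≤ ε / 2 * x ^ 2 + ε / 2 * x ^ 2 := (norm_add_le _ _).trans (add_le_add h7 h6)
    _ = ε * x ^ 2 := by ring

theorem charFun_weighted (h : IsIIDField μ X) (A : Finset ZSq) (W : ZSq → ℝ) (s : ℝ) :
    charFun (μ.map fun x => ∑ l ∈ A, W l * X l x) s =
      ∏ l ∈ A, charFun (μ.map (X 0)) (W l * s) := by
  have h1 : iIndepFun (fun l x => W l * X l x) μ :=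
    h.indep.comp (fun l y => W l * y) fun l => measurable_const_mul _
  rw [(h1.restrict A).charFun_map_fun_finsetSum_eq_prod
    fun l _ => ((h.meas l).const_mul _).aemeasurable, Finset.prod_apply]
  refine Finset.prod_congr rfl fun l _ => ?_
  rw [charFun_map_mul_comp (h.meas l).aemeasurable, (h.ident l).map_eq]

/-- The variables being identically distributed, uniform smallness of the weights replaces the
Lindeberg condition. Each factor differs from its Gaussian counterpart by a small multiple of `(W n
l * s)²`, and these sum to a small multiple of the variance. -/
theorem tendsto_charFun_weighted (h : IsIIDField μ X) {A : ℕ → Finset ZSq} {W : ℕ → ZSq → ℝ}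
    {v : ℝ} (hV : Tendsto (fun n => ∑ l ∈ A n, W n l ^ 2) atTop (𝓝 v))
    (hmax : ∀ ε > 0, ∀ᶠ n in atTop, ∀ l ∈ A n, |W n l| ≤ ε) (s : ℝ) :
    Tendsto (fun n => charFun (μ.map fun x => ∑ l ∈ A n, W n l * X l x) s) atTop
      (𝓝 (Complex.exp (-(v * s ^ 2 / 2 : ℝ)))) := by
  have := Measure.isProbabilityMeasure_map (μ := μ) (h.meas 0).aemeasurable
  have h1 : Tendsto (fun n => Complex.exp (-((∑ l ∈ A n, W n l ^ 2) * s ^ 2 / 2 : ℝ))) atTop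
      (𝓝 (Complex.exp (-(v * s ^ 2 / 2 : ℝ)))) := by
    have h2 : Continuous fun y : ℝ => Complex.exp (-(y * s ^ 2 / 2 : ℝ)) := by fun_prop
    exact (h2.tendsto v).comp hV
  have h2 : Tendsto (fun n => charFun (μ.map fun x => ∑ l ∈ A n, W n l * X l x) s -
      Complex.exp (-((∑ l ∈ A n, W n l ^ 2) * s ^ 2 / 2 : ℝ))) atTop (𝓝 0) := by
    rw [Metric.tendsto_nhds]
    intro η hη
    have hv1 : 0 < |v| + 1 := by positivity
    obtain ⟨δ, hδ, hφ⟩ := h.exists_charFun_sub_exp_le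
      (ε := η / (2 * ((|v| + 1) * (s ^ 2 + 1)))) (by positivity)
    have hm := hmax (δ / (|s| + 1)) (by positivity)
    have hv := hV.eventually_lt_const (show v < |v| + 1 by linarith [le_abs_self v])
    filter_upwards [hm, hv] with n hn hvn
    rw [dist_zero_right, h.charFun_weighted]
    have e : Complex.exp (-((∑ l ∈ A n, W n l ^ 2) * s ^ 2 / 2 : ℝ)) =
        ∏ l ∈ A n, Complex.exp (-((W n l * s) ^ 2 / 2 : ℝ)) := by
      rw [← Complex.exp_sum]
      congr 1
      rw [Finset.sum_mul, Finset.sum_div]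
      push_cast
      rw [← Finset.sum_neg_distrib]
      refine Finset.sum_congr rfl fun l _ => ?_
      ring
    rw [e]
    calc _ ≤ ∑ l ∈ A n, ‖charFun (μ.map (X 0)) (W n l * s) -
          Complex.exp (-((W n l * s) ^ 2 / 2 : ℝ))‖ := by
          refine norm_prod_sub_prod_le _ _ _ (fun l => norm_charFun_le_one _) fun l => ?_
          rw [← Complex.ofReal_neg, Complex.norm_exp_ofReal]
          exact Real.exp_le_one_iff.2 (neg_nonpos.2 (by positivity))
      _ ≤ ∑ l ∈ A n, η / (2 * ((|v| + 1) * (s ^ 2 + 1))) * (W n l * s) ^ 2 := by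
          refine Finset.sum_le_sum fun l hl => hφ _ ?_
          rw [abs_mul]
          have h3 := hn l hl
          rw [le_div_iff₀ (by positivity)] at h3
          nlinarith [abs_nonneg (W n l)]
      _ = η / (2 * ((|v| + 1) * (s ^ 2 + 1))) * ((∑ l ∈ A n, W n l ^ 2) * s ^ 2) := by
          rw [← Finset.mul_sum, Finset.sum_mul]
          simp_rw [mul_pow]
      _ ≤ η / (2 * ((|v| + 1) * (s ^ 2 + 1))) * ((|v| + 1) * (s ^ 2 + 1)) := by
          have h5 : 0 ≤ s ^ 2 := sq_nonneg s
          refine mul_le_mul_of_nonneg_left ?_ (by positivity)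
          exact mul_le_mul hvn.le (by linarith) h5 hv1.le
      _ = η / 2 := by field_simp
      _ < η := half_lt_self hη
  have h3 := h2.add h1
  rw [zero_add] at h3
  exact h3.congr fun n => sub_add_cancel _ _

theorem memLp_segSum (h : IsIIDField μ X) (z : ℕ → ZSq) (a b : ℕ) :
    MemLp (segSum X z a b) 2 μ := memLp_finsetSum _ fun _ _ => h.memLp _

theorem measurable_segSum (h : IsIIDField μ X) (z : ℕ → ZSq) (a b : ℕ) :
    Measurable (segSum X z a b) := Finset.measurable_sum _ fun _ _ => h.meas _

theorem integral_segSum_sq (h : IsIIDField μ X) (z : ℕ → ZSq) (a b : ℕ) :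
    ∫ x, segSum X z a b x ^ 2 ∂μ = pairCount z 0 a b := by
  have hi : ∀ k l, Integrable (fun x => X k x * X l x) μ := fun k l =>
    (h.memLp k).integrable_mul (h.memLp l)
  simp_rw [segSum, sq, Finset.sum_mul_sum]
  rw [integral_finsetSum _ fun _ _ => integrable_finsetSum _ fun _ _ => hi _ _]
  refine Finset.sum_congr rfl fun i _ => ?_
  rw [integral_finsetSum _ fun _ _ => hi _ _]
  refine Finset.sum_congr rfl fun j _ => ?_
  rw [h.integral_mul, hit]
  simp only [sub_eq_zero, eq_comm]

/-- A linear combination of block sums is a weighted sum over sites, with weights built from block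
local times. Its variance is a quadratic form in `segInter`, asymptotically diagonal, and the
weights are small by the bound on local times. -/
theorem tendsto_charFun_blocks (h : IsIIDField μ X) {z : ℕ → ZSq} {c : ℝ}
    (hz : IsRegularPath z c) {m : ℕ} (hm : 0 < m) (K : ℕ) (d : ℕ → ℝ) (s : ℝ) :
    Tendsto (fun n : ℕ => charFun (μ.map fun x => ∑ j ∈ Finset.range K,
      d j * (segSum X z (grid m n j) (grid m n (j + 1)) x / √(n * Real.log n))) s) atTop
      (𝓝 (Complex.exp (-((∑ j ∈ Finset.range K, d j ^ 2) * (c / m) * s ^ 2 / 2 : ℝ)))) := by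
  set r : ℕ → ℝ := fun n => √(n * Real.log n) with hr
  have hr2 : ∀ n, r n * r n = n * Real.log n := fun n =>
    Real.mul_self_sqrt (mul_nonneg (Nat.cast_nonneg _) (Real.log_natCast_nonneg _))
  -- A generous horizon: since `m ≥ 1`, the first `K` cells end before time `n * K`, which is of the
  -- form treated by `eventually_locTime_sq_le`.
  set A : ℕ → Finset ZSq := fun n => (Finset.Ico 0 (n * K)).image z with hA
  set L : ℕ → ℕ → ZSq → ℝ := fun n j l => locTime z (grid m n j) (grid m n (j + 1)) l with hL
  set W : ℕ → ZSq → ℝ := fun n l => ∑ j ∈ Finset.range K, d j * (L n j l / r n) with hW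
  have hgrid : ∀ n j, j < K → grid m n (j + 1) ≤ n * K := fun n j hj => by
    rw [← grid_mul hm]
    exact grid_mono m n (by nlinarith)
  have hmem : ∀ n, ∀ j < K, ∀ k ∈ Finset.Ico (grid m n j) (grid m n (j + 1)), z k ∈ A n := by
    intro n j hj k hk
    refine Finset.mem_image_of_mem z (Finset.mem_Ico.2 ⟨Nat.zero_le _, ?_⟩)
    exact (Finset.mem_Ico.1 hk).2.trans_le (hgrid n j hj)
  have hsum : ∀ n x, ∑ j ∈ Finset.range K, d j *
      (segSum X z (grid m n j) (grid m n (j + 1)) x / r n) = ∑ l ∈ A n, W n l * X l x := by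
    intro n x
    simp only [hW, Finset.sum_mul]
    rw [Finset.sum_comm]
    refine Finset.sum_congr rfl fun j hj => ?_
    rw [segSum_eq_sum_locTime X (hmem n j (Finset.mem_range.1 hj)), Finset.sum_div,
      Finset.mul_sum]
    refine Finset.sum_congr rfl fun l _ => ?_
    ring
  have hgoal : ∀ n : ℕ, (fun x => ∑ j ∈ Finset.range K, d j *
      (segSum X z (grid m n j) (grid m n (j + 1)) x / √(n * Real.log n))) =
      fun x => ∑ l ∈ A n, W n l * X l x := fun n => funext (hsum n)
  simp_rw [hgoal]
  refine h.tendsto_charFun_weighted ?_ ?_ s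
  · have h1 : ∀ n, ∑ l ∈ A n, W n l ^ 2 = ∑ i ∈ Finset.range K, ∑ j ∈ Finset.range K,
        d i * d j * (segInter z (grid m n i) (grid m n (i + 1)) (grid m n j) (grid m n (j + 1)) /
          (n * Real.log n)) := by
      intro n
      simp only [hW, sq, Finset.sum_mul_sum]
      rw [Finset.sum_comm]
      refine Finset.sum_congr rfl fun i hi => ?_
      rw [Finset.sum_comm]
      refine Finset.sum_congr rfl fun j _ => ?_
      rw [← sum_locTime_mul (hmem n i (Finset.mem_range.1 hi)), Finset.sum_div, Finset.mul_sum]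
      refine Finset.sum_congr rfl fun l _ => ?_
      rw [← hr2 n, mul_mul_mul_comm, div_mul_div_comm]
    simp_rw [h1]
    have h2 := tendsto_finsetSum (Finset.range K) fun i hi =>
      tendsto_finsetSum (Finset.range K) fun j hj =>
        (hz.tendsto_segInter hm (Finset.mem_range.1 hi) (Finset.mem_range.1 hj)).const_mul
          (d i * d j)
    convert h2 using 2
    rw [Finset.sum_mul]
    refine Finset.sum_congr rfl fun i hi => ?_
    simp only [mul_ite, mul_zero]
    rw [Finset.sum_ite_eq, if_pos hi, sq]
  · intro ε hε
    set D := ∑ j ∈ Finset.range K, |d j| with hD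
    have hD0 : 0 ≤ D := Finset.sum_nonneg fun _ _ => abs_nonneg _
    have hev := hz.eventually_locTime_sq_le K (ε := (ε / (D + 1)) ^ 2) (by positivity)
    filter_upwards [hev, eventually_ge_atTop 2] with n hn hn2 l _
    have hrn : 0 < r n := by
      have h1 : (1 : ℝ) < n := by exact_mod_cast hn2
      have := Real.log_pos h1
      exact Real.sqrt_pos.2 (by positivity)
    have h1 : locTime z 0 (n * K) l ≤ ε / (D + 1) * r n := by
      refine (abs_le_of_sq_le_sq' ?_ (by positivity)).2
      rw [mul_pow, sq (r n), hr2]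
      exact hn l
    have h2 : ∀ j ∈ Finset.range K, L n j l ≤ ε / (D + 1) * r n := fun j hj => by
      refine le_trans ?_ h1
      refine Finset.sum_le_sum_of_subset_of_nonneg (Finset.Ico_subset_Ico (Nat.zero_le _)
        (hgrid n j (Finset.mem_range.1 hj))) fun _ _ _ => ?_
      split_ifs <;> simp
    calc |W n l| ≤ ∑ j ∈ Finset.range K, |d j * (L n j l / r n)| :=
          Finset.abs_sum_le_sum_abs _ _
      _ ≤ ∑ j ∈ Finset.range K, |d j| * (ε / (D + 1)) := by
          refine Finset.sum_le_sum fun j hj => ?_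
          rw [abs_mul]
          refine mul_le_mul_of_nonneg_left ?_ (abs_nonneg _)
          rw [abs_of_nonneg (div_nonneg (locTime_nonneg _ _ _ _) hrn.le), div_le_iff₀ hrn]
          exact h2 j hj
      _ = D * (ε / (D + 1)) := by rw [← Finset.sum_mul]
      _ ≤ ε := by
          rw [mul_div_assoc', div_le_iff₀ (by positivity)]
          nlinarith

end IsIIDField

end

noncomputable section

variable {E : Type*} [MeasurableSpace E] {μ : Measure E} [IsProbabilityMeasure μ]
  {X : ZSq → E → ℝ}

/-! ### Maximal inequalities -/

/-- The event that the sums along the path started at time `a` reach the level `r` before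
time `b`. -/
def upEvent (X : ZSq → E → ℝ) (z : ℕ → ZSq) (a b : ℕ) (r : ℝ) : Set E :=
  {x | ∃ k ∈ Finset.Icc a b, r ≤ segSum X z a k x}

/-- The event that the absolute values of the sums along the path started at time `a` reach the
level `r` before time `b`. -/
def maxEvent (X : ZSq → E → ℝ) (z : ℕ → ZSq) (a b : ℕ) (r : ℝ) : Set E :=
  {x | ∃ k ∈ Finset.Icc a b, r ≤ |segSum X z a k x|}

/-- The sum along the path with the site `l` removed. -/
def segSumOff (z : ℕ → ZSq) (l : ZSq) (a b : ℕ) (y : ZSq → ℝ) : ℝ :=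
  ∑ k ∈ Finset.Ico a b, if z k = l then 0 else y (z k)

theorem segSum_eq_off (X : ZSq → E → ℝ) (z : ℕ → ZSq) (l : ZSq) (a b : ℕ) (x : E) :
    segSum X z a b x = segSumOff z l a b (fun k => X k x) + locTime z a b l * X l x := by
  rw [segSum, segSumOff, locTime, Finset.sum_mul, ← Finset.sum_add_distrib]
  refine Finset.sum_congr rfl fun k _ => ?_
  split_ifs with h <;> simp [h]

theorem measurableSet_exists_mem {β : Type*} [MeasurableSpace β] (s : Finset ℕ)
    {f : ℕ → β → ℝ} (hf : ∀ k, Measurable (f k)) (r : ℝ) :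
    MeasurableSet {x | ∃ k ∈ s, r ≤ f k x} := by
  have : {x | ∃ k ∈ s, r ≤ f k x} = ⋃ k ∈ s, {x | r ≤ f k x} := by ext x; simp
  rw [this]
  exact Finset.measurableSet_biUnion s fun k _ => measurableSet_le measurable_const (hf k)

/-- A tuple of field values, extended by zero. -/
def extendField {S : Finset ZSq} (y : S → ℝ) (k : ZSq) : ℝ := if h : k ∈ S then y ⟨k, h⟩ else 0

theorem measurable_extendField {S : Finset ZSq} (k : ZSq) :
    Measurable fun y : S → ℝ => extendField y k := by
  unfold extendField
  split_ifs with h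
  · exact measurable_pi_apply _
  · exact measurable_const

namespace IsIIDField

theorem measurableSet_upEvent (h : IsIIDField μ X) (z : ℕ → ZSq) (a b : ℕ) (r : ℝ) :
    MeasurableSet (upEvent X z a b r) :=
  measurableSet_exists_mem _ (fun k => h.measurable_segSum z a k) r

/-- Increasing events are positively correlated with each site of the field. -/
theorem setIntegral_upEvent_nonneg (h : IsIIDField μ X) (z : ℕ → ZSq) (a b : ℕ) (r : ℝ)
    (l : ZSq) : 0 ≤ ∫ x in upEvent X z a b r, X l x ∂μ := by
  set S : Finset ZSq := ((Finset.Ico a b).image z).erase l with hS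
  -- The same event with `X l` replaced by zero, hence independent of `X l`. Raising `X l` from zero
  -- can only produce the event and lowering it can only destroy it, so `X l` times the indicator of
  -- `upEvent` dominates `X l` times that of `D`, whose mean is zero.
  set D : Set (S → ℝ) :=
    {y | ∃ k ∈ Finset.Icc a b, r ≤ segSumOff z l a k (extendField y)} with hD
  have hDm : MeasurableSet D := by
    refine measurableSet_exists_mem _ (fun k => ?_) r
    refine Finset.measurable_sum _ fun i _ => ?_
    split_ifs
    · exact measurable_const
    · exact measurable_extendField _
  set Y : E → S → ℝ := fun x k => X k x with hY
  have hYm : Measurable Y := measurable_pi_lambda _ fun k => h.meas _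
  have hoff : ∀ x, ∀ k ∈ Finset.Icc a b,
      segSumOff z l a k (extendField (Y x)) = segSumOff z l a k fun k => X k x := by
    intro x k hk
    refine Finset.sum_congr rfl fun i hi => ?_
    split_ifs with hil
    · rfl
    · have : z i ∈ S := Finset.mem_erase.2 ⟨hil, Finset.mem_image_of_mem z (Finset.mem_Ico.2
        ⟨(Finset.mem_Ico.1 hi).1, (Finset.mem_Ico.1 hi).2.trans_le (Finset.mem_Icc.1 hk).2⟩)⟩
      rw [extendField, dif_pos this]
  have hind : IndepFun (X l) (fun x => D.indicator (fun _ => (1 : ℝ)) (Y x)) μ := by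
    have h1 := h.indep.indepFun_finset {l} S (by
      rw [Finset.disjoint_singleton_left]; exact Finset.notMem_erase _ _) h.meas
    have h2 : Measurable fun y : ({l} : Finset ZSq) → ℝ => y ⟨l, Finset.mem_singleton_self l⟩ :=
      measurable_pi_apply _
    exact h1.comp h2 (measurable_const.indicator hDm : Measurable (D.indicator fun _ => (1 : ℝ)))
  have hXi : Integrable (X l) μ := (h.memLp l).integrable (by norm_num)
  have hzero : ∫ x, X l x * D.indicator (fun _ => (1 : ℝ)) (Y x) ∂μ = 0 := by
    rw [hind.integral_fun_mul_eq_mul_integral (h.meas l).aestronglyMeasurable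
      ((measurable_const.indicator hDm).comp hYm).aestronglyMeasurable, h.integral_eq_zero,
      zero_mul]
  rw [← integral_indicator (h.measurableSet_upEvent z a b r), ← hzero]
  have hi2 : Integrable (fun x => X l x * D.indicator (fun _ => (1 : ℝ)) (Y x)) μ := by
    refine (hXi.indicator (hYm hDm)).congr (ae_of_all _ fun x => ?_)
    by_cases hx : Y x ∈ D
    · simp [hx]
    · simp [hx]
  refine integral_mono hi2 (hXi.indicator (h.measurableSet_upEvent z a b r)) fun x => ?_
  have hup : x ∈ upEvent X z a b r ↔ ∃ k ∈ Finset.Icc a b,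
      r ≤ segSumOff z l a k (fun k => X k x) + locTime z a k l * X l x := by
    simp only [upEvent, Set.mem_ofPred_eq, ← segSum_eq_off]
  have hYD : Y x ∈ D ↔ ∃ k ∈ Finset.Icc a b, r ≤ segSumOff z l a k (fun k => X k x) := by
    simp only [hD, Set.mem_ofPred_eq]
    exact exists_congr fun k => and_congr_right fun hk => by rw [hoff x k hk]
  rcases le_total 0 (X l x) with hx | hx
  · by_cases hxD : Y x ∈ D
    · have : x ∈ upEvent X z a b r := by
        obtain ⟨k, hk, hr⟩ := hYD.1 hxD
        exact hup.2 ⟨k, hk, hr.trans (le_add_of_nonneg_right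
          (mul_nonneg (locTime_nonneg _ _ _ _) hx))⟩
      simp [this, hxD]
    · simp only [Set.indicator_of_notMem hxD, mul_zero]
      by_cases hu : x ∈ upEvent X z a b r <;> simp [hu, hx]
  · by_cases hu : x ∈ upEvent X z a b r
    · have : Y x ∈ D := by
        obtain ⟨k, hk, hr⟩ := hup.1 hu
        exact hYD.2 ⟨k, hk, hr.trans (add_le_of_nonpos_right
          (mul_nonpos_of_nonneg_of_nonpos (locTime_nonneg _ _ _ _) hx))⟩
      simp [this, hu]
    · simp only [Set.indicator_of_notMem hu]
      by_cases hxD : Y x ∈ D <;> simp [hxD, hx]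

/-- A Doob inequality for the sums along a path. -/
theorem mul_upEvent_le (h : IsIIDField μ X) (z : ℕ → ZSq) {a b : ℕ} (hab : a ≤ b) (r : ℝ) :
    r * μ.real (upEvent X z a b r) ≤ ∫ x in upEvent X z a b r, segSum X z a b x ∂μ := by
  have hSi : ∀ b, Integrable (segSum X z a b) μ := fun b =>
    (h.memLp_segSum z a b).integrable (by norm_num)
  induction b, hab using Nat.le_induction with
  | base =>
    have h0 : ∀ x, segSum X z a a x = 0 := fun x => by simp [segSum]
    simp_rw [h0]
    rcases le_or_gt r 0 with hr | hr
    · rw [integral_zero]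
      exact mul_nonpos_of_nonpos_of_nonneg hr measureReal_nonneg
    · have : upEvent X z a a r = ∅ := by
        ext x
        simp [upEvent, h0, hr]
      simp [this]
  | succ b hab ih =>
    set D := upEvent X z a b r with hD
    -- The paths that reach the level for the first time at `b + 1`. On `N` the sum is at least `r`;
    -- on `D` the new term has nonnegative integral by positive correlation, which replaces the
    -- martingale property.
    set N : Set E := {x | r ≤ segSum X z a (b + 1) x} \ D with hN
    have hDm : MeasurableSet D := h.measurableSet_upEvent z a b r
    have hNm : MeasurableSet N :=
      (measurableSet_le measurable_const (h.measurable_segSum z a (b + 1))).diff hDm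
    have hun : upEvent X z a (b + 1) r = D ∪ N := by
      ext x
      simp only [hN, Set.union_sdiff_self, Set.mem_union]
      constructor
      · rintro ⟨k, hk, hr⟩
        rw [Finset.mem_Icc] at hk
        rcases Nat.lt_or_ge b k with hbk | hbk
        · right
          have : k = b + 1 := by omega
          rwa [this] at hr
        · exact Or.inl ⟨k, Finset.mem_Icc.2 ⟨hk.1, hbk⟩, hr⟩
      · rintro (⟨k, hk, hr⟩ | hr)
        · rw [Finset.mem_Icc] at hk
          exact ⟨k, Finset.mem_Icc.2 ⟨hk.1, by omega⟩, hr⟩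
        · exact ⟨b + 1, Finset.mem_Icc.2 ⟨by omega, le_rfl⟩, hr⟩
    have hdisj : Disjoint D N := Set.disjoint_sdiff_right
    rw [hun, setIntegral_union hdisj hNm (hSi _).integrableOn (hSi _).integrableOn,
      measureReal_union hdisj hNm, mul_add]
    refine add_le_add ?_ ?_
    · have e : ∀ x, segSum X z a (b + 1) x = segSum X z a b x + X (z b) x := fun x =>
        Finset.sum_Ico_succ_top hab _
      simp_rw [e]
      rw [integral_add (hSi b).integrableOn
        ((h.memLp (z b)).integrable (by norm_num)).integrableOn]
      exact ih.trans (le_add_of_nonneg_right (h.setIntegral_upEvent_nonneg z a b r (z b)))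
    · have h1 : ∫ _x in N, r ∂μ ≤ ∫ x in N, segSum X z a (b + 1) x ∂μ :=
        setIntegral_mono_on (integrable_const r).integrableOn (hSi _).integrableOn hNm
          fun x hx => hx.1
      rwa [setIntegral_const, smul_eq_mul, mul_comm] at h1

/-- In the Doob inequality the sum is at most `r / 2` plus `2 / r` times its square on `{r / 2 <
S}`; the first part is absorbed in the left side. The restriction to large values is what makes the
bound summable over many small blocks. -/
theorem upEvent_le (h : IsIIDField μ X) (z : ℕ → ZSq) {a b : ℕ} (hab : a ≤ b) {r : ℝ}
    (hr : 0 < r) : μ.real (upEvent X z a b r) ≤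
      4 / r ^ 2 * ∫ x in {x | r / 2 < segSum X z a b x}, segSum X z a b x ^ 2 ∂μ := by
  set D := upEvent X z a b r with hD
  set G : Set E := {x | r / 2 < segSum X z a b x} with hG
  have hDm : MeasurableSet D := h.measurableSet_upEvent z a b r
  have hGm : MeasurableSet G := measurableSet_lt measurable_const (h.measurable_segSum z a b)
  have hSi : Integrable (segSum X z a b) μ := (h.memLp_segSum z a b).integrable (by norm_num)
  have hS2 : Integrable (fun x => segSum X z a b x ^ 2) μ := (h.memLp_segSum z a b).integrable_sq
  have h1 := h.mul_upEvent_le z hab r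
  rw [← hD] at h1
  have h2 : ∫ x in D, segSum X z a b x ∂μ ≤
      r / 2 * μ.real D + 2 / r * ∫ x in G, segSum X z a b x ^ 2 ∂μ := by
    rw [← integral_indicator hDm, ← integral_indicator hGm]
    have h3 : ∫ x, D.indicator (fun _ => r / 2) x ∂μ = r / 2 * μ.real D := by
      rw [integral_indicator hDm, setIntegral_const, smul_eq_mul, mul_comm]
    rw [← h3, ← integral_const_mul, ← integral_add ((integrable_const _).indicator hDm)
      ((hS2.indicator hGm).const_mul _)]
    refine integral_mono (hSi.indicator hDm) (((integrable_const _).indicator hDm).add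
      ((hS2.indicator hGm).const_mul _)) fun x => ?_
    have h4 : 0 ≤ 2 / r * G.indicator (fun x => segSum X z a b x ^ 2) x :=
      mul_nonneg (by positivity) (Set.indicator_nonneg (fun _ _ => sq_nonneg _) _)
    by_cases hx : x ∈ D
    · simp only [Set.indicator_of_mem hx]
      by_cases hxG : x ∈ G
      · have h5 : r / 2 < segSum X z a b x := hxG
        simp only [Set.indicator_of_mem hxG]
        have h6 : segSum X z a b x ≤ 2 / r * segSum X z a b x ^ 2 := by
          rw [div_mul_eq_mul_div, le_div_iff₀ hr]
          nlinarith
        linarith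
      · have h5 : segSum X z a b x ≤ r / 2 := not_lt.1 hxG
        linarith
    · simp only [Set.indicator_of_notMem hx, zero_add]
      exact h4
  have h3 : r / 2 * μ.real D ≤ 2 / r * ∫ x in G, segSum X z a b x ^ 2 ∂μ := by linarith
  calc μ.real D = 2 / r * (r / 2 * μ.real D) := by field_simp
    _ ≤ 2 / r * (2 / r * ∫ x in G, segSum X z a b x ^ 2 ∂μ) :=
        mul_le_mul_of_nonneg_left h3 (by positivity)
    _ = _ := by ring

theorem segSum_neg (X : ZSq → E → ℝ) (z : ℕ → ZSq) (a b : ℕ) (x : E) :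
    segSum (fun l x => -X l x) z a b x = -segSum X z a b x := by
  simp [segSum]

theorem maxEvent_le (h : IsIIDField μ X) (z : ℕ → ZSq) {a b : ℕ} (hab : a ≤ b) {r : ℝ}
    (hr : 0 < r) : μ.real (maxEvent X z a b r) ≤
      4 / r ^ 2 * ∫ x in {x | r / 2 < |segSum X z a b x|}, segSum X z a b x ^ 2 ∂μ := by
  have hS2 : Integrable (fun x => segSum X z a b x ^ 2) μ := (h.memLp_segSum z a b).integrable_sq
  have h1 := h.upEvent_le z hab hr
  have h2 := h.neg.upEvent_le z hab hr
  simp_rw [segSum_neg, neg_sq] at h2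
  have hsub : maxEvent X z a b r ⊆
      upEvent X z a b r ∪ upEvent (fun l x => -X l x) z a b r := by
    rintro x ⟨k, hk, hkr⟩
    rcases le_abs.1 hkr with h3 | h3
    · exact Or.inl ⟨k, hk, h3⟩
    · refine Or.inr ⟨k, hk, ?_⟩
      rwa [segSum_neg]
  have hu : {x | r / 2 < |segSum X z a b x|} =
      {x | r / 2 < segSum X z a b x} ∪ {x | r / 2 < -segSum X z a b x} := by
    ext x
    simp [lt_abs]
  rw [hu, setIntegral_union ?_ ?_ hS2.integrableOn hS2.integrableOn, mul_add]
  · exact (measureReal_mono hsub (measure_ne_top _ _)).trans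
      ((measureReal_union_le _ _).trans (add_le_add h1 h2))
  · refine Set.disjoint_left.2 fun x hx1 hx2 => ?_
    simp only [Set.mem_ofPred_eq] at hx1 hx2
    linarith
  · exact measurableSet_lt measurable_const (h.measurable_segSum z a b).neg

/-- The truncation is dropped. This cruder bound serves to dominate tails at all levels, not to
prove tightness. -/
theorem maxEvent_le_variance (h : IsIIDField μ X) (z : ℕ → ZSq) {a b : ℕ} (hab : a ≤ b) {r : ℝ}
    (hr : 0 < r) : μ.real (maxEvent X z a b r) ≤ 4 * pairCount z 0 a b / r ^ 2 := by
  refine (h.maxEvent_le z hab hr).trans ?_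
  rw [mul_div_right_comm]
  refine mul_le_mul_of_nonneg_left ?_ (by positivity)
  rw [← h.integral_segSum_sq]
  exact setIntegral_le_integral (h.memLp_segSum z a b).integrable_sq
    (ae_of_all _ fun x => sq_nonneg _)

end IsIIDField

/-- The part of the second moment carried by large values is controlled by the second moment and
the characteristic function. -/
theorem setIntegral_sq_le_charFun {f : E → ℝ} (hf : MemLp f 2 μ) {a : ℝ} (ha : 0 < a)
    (hm : Measurable f) :
    ∫ x in {x | a < |f x|}, f x ^ 2 ∂μ ≤
      2 * (∫ x, f x ^ 2 ∂μ - a ^ 2 / 4 * (1 - (charFun (μ.map f) (√8 / a)).re)) := by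
  set b := √8 / a with hb
  -- With this frequency `(a² / 4)(1 - cos (b f))` is at most `f²` everywhere, and at most `a² / 2 ≤
  -- f² / 2` where `|f| > a`. Twice its defect from `f²` therefore dominates `f²` on large values
  -- and is nonnegative elsewhere.
  have hb2 : a ^ 2 / 4 * (b ^ 2 / 2) = 1 := by
    rw [hb, div_pow, Real.sq_sqrt (by norm_num)]; field_simp; norm_num
  have hf2 : Integrable (fun x => f x ^ 2) μ := hf.integrable_sq
  have hcos : Integrable (fun x => Real.cos (b * f x)) μ :=
    Integrable.of_bound (Real.measurable_cos.comp (hm.const_mul b)).aestronglyMeasurable 1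
      (ae_of_all _ fun x => by rw [Real.norm_eq_abs]; exact Real.abs_cos_le_one _)
  have hre : (charFun (μ.map f) b).re = ∫ x, Real.cos (b * f x) ∂μ := by
    rw [charFun_apply_real, integral_map hm.aemeasurable (by fun_prop)]
    have hi : Integrable (fun x => Complex.exp (b * f x * Complex.I)) μ := by
      refine Integrable.of_bound (Measurable.aestronglyMeasurable (by fun_prop)) 1
        (ae_of_all _ fun x => ?_)
      rw [← Complex.ofReal_mul, Complex.norm_exp_ofReal_mul_I]
    rw [← RCLike.re_eq_complex_re, ← integral_re hi]
    congr 1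
    ext x
    rw [RCLike.re_eq_complex_re, ← Complex.ofReal_mul, Complex.exp_ofReal_mul_I_re]
  have hc1 : Integrable (fun x => a ^ 2 / 4 * (1 - Real.cos (b * f x))) μ :=
    ((integrable_const _).sub hcos).const_mul _
  have e : 2 * (∫ x, f x ^ 2 ∂μ - a ^ 2 / 4 * (1 - (charFun (μ.map f) b).re)) =
      ∫ x, 2 * (f x ^ 2 - a ^ 2 / 4 * (1 - Real.cos (b * f x))) ∂μ := by
    rw [integral_const_mul, integral_sub hf2 hc1,
      integral_const_mul, integral_sub (integrable_const _) hcos, hre]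
    simp
  rw [e, ← integral_indicator (measurableSet_lt measurable_const hm.abs)]
  refine integral_mono (hf2.indicator (measurableSet_lt measurable_const hm.abs))
    ((hf2.sub hc1).const_mul _) fun x => ?_
  have h1 : 1 - (b * f x) ^ 2 / 2 ≤ Real.cos (b * f x) := Real.one_sub_sq_div_two_le_cos
  have h2 := Real.neg_one_le_cos (b * f x)
  have h0 : a ^ 2 / 4 * (1 - Real.cos (b * f x)) ≤ f x ^ 2 := by
    calc _ ≤ a ^ 2 / 4 * ((b * f x) ^ 2 / 2) := by gcongr; linarith
      _ = (a ^ 2 / 4 * (b ^ 2 / 2)) * f x ^ 2 := by ring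
      _ = f x ^ 2 := by rw [hb2, one_mul]
  by_cases hx : x ∈ {x | a < |f x|}
  · simp only [Set.indicator_of_mem hx]
    have h3 : a ^ 2 ≤ f x ^ 2 := by
      rw [← sq_abs (f x)]
      have h4 : a < |f x| := hx
      gcongr
    have h5 : a ^ 2 / 4 * (1 - Real.cos (b * f x)) ≤ a ^ 2 / 4 * 2 := by
      gcongr; linarith
    linarith
  · simp only [Set.indicator_of_notMem hx]
    linarith

end

noncomputable section

variable {E : Type*} [MeasurableSpace E] {μ : Measure E} [IsProbabilityMeasure μ]
  {X : ZSq → E → ℝ} {z : ℕ → ZSq} {c : ℝ}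

/-! ### Oscillations of the sums along a regular path -/

/-- The normalization `√(n log n)`. -/
def scl (n : ℕ) : ℝ := √(n * Real.log n)

theorem scl_nonneg (n : ℕ) : 0 ≤ scl n := Real.sqrt_nonneg _

theorem scl_sq (n : ℕ) : scl n ^ 2 = n * Real.log n :=
  Real.sq_sqrt (mul_nonneg (Nat.cast_nonneg _) (Real.log_natCast_nonneg _))

theorem scl_pos {n : ℕ} (hn : 2 ≤ n) : 0 < scl n := by
  have h1 : (1 : ℝ) < n := by exact_mod_cast hn
  have := Real.log_pos h1
  exact Real.sqrt_pos.2 (by positivity)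

theorem exp_neg_sub_le {y : ℝ} (hy : 0 ≤ y) : y - 1 + Real.exp (-y) ≤ y ^ 2 / 2 := by
  have h := Real.quadratic_le_exp_of_nonneg hy
  have h1 : Real.exp (-y) * Real.exp y = 1 := by rw [← Real.exp_add]; simp
  have h2 := Real.exp_pos (-y)
  have h3 : (1 - y + y ^ 2 / 2) * (1 + y + y ^ 2 / 2) ≥ 1 := by nlinarith [sq_nonneg (y ^ 2)]
  have h4 : Real.exp (-y) * (1 + y + y ^ 2 / 2) ≤ 1 := by
    calc _ ≤ Real.exp (-y) * Real.exp y := by gcongr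
      _ = 1 := h1
  nlinarith [sq_nonneg y]

theorem exists_block {τ : ℕ → ℕ} {K k : ℕ} (h0 : τ 0 ≤ k) (hK : k ≤ τ K) (hK0 : 0 < K) :
    ∃ j < K, τ j ≤ k ∧ k ≤ τ (j + 1) := by
  induction K with
  | zero => omega
  | succ K ih =>
    rcases le_or_gt (τ K) k with h | h
    · exact ⟨K, by omega, h, hK⟩
    · rcases Nat.eq_zero_or_pos K with rfl | hKp
      · omega
      · obtain ⟨j, hj, h1⟩ := ih h.le hKp
        exact ⟨j, by omega, h1⟩

/-- The event that the sums oscillate by `r` in one of the first `K` cells of a grid. -/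
def oscEvent (X : ZSq → E → ℝ) (z : ℕ → ZSq) (m n K : ℕ) (r : ℝ) : Set E :=
  ⋃ j ∈ Finset.range K, maxEvent X z (grid m n j) (grid m n (j + 1)) r

namespace IsIIDField

/-- The maximal inequality and `setIntegral_sq_le_charFun` bound the probability by a quantity that
converges to `(y - 1 + exp(-y)) / 2` with `y = 16 v / ε²`, hence to at most `64 v² / ε⁴`. Being
quadratic in `v = c / m`, it stays small when summed over `O(m)` blocks, while a variance bound
linear in `v` would not. -/
theorem eventually_maxEvent_block_le (h : IsIIDField μ X) (hz : IsRegularPath z c) {m : ℕ}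
    (hm : 0 < m) (j : ℕ) {ε : ℝ} (hε : 0 < ε) {η : ℝ} (hη : 64 * (c / m) ^ 2 / ε ^ 4 < η) :
    ∀ᶠ n in atTop, μ.real (maxEvent X z (grid m n j) (grid m n (j + 1)) (ε * scl n)) ≤ η := by
  set v := c / m with hv
  set s := √8 / (ε / 2) with hs
  have hs2 : s ^ 2 = 32 / ε ^ 2 := by
    rw [hs, div_pow, div_pow, Real.sq_sqrt (by norm_num)]; field_simp; norm_num
  set S : ℕ → E → ℝ := fun n => segSum X z (grid m n j) (grid m n (j + 1)) with hS
  have hcf : Tendsto (fun n => charFun (μ.map fun x => S n x / scl n) s) atTop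
      (𝓝 (Complex.exp (-(v * s ^ 2 / 2 : ℝ)))) := by
    have h1 := h.tendsto_charFun_blocks hz hm (j + 1) (fun i => if i = j then 1 else 0) s
    have e1 : ∑ i ∈ Finset.range (j + 1), (if i = j then (1 : ℝ) else 0) ^ 2 = 1 := by
      simp
    rw [e1, one_mul] at h1
    refine h1.congr fun n => ?_
    congr 2
    ext x
    simp [hS, scl]
  have hV := hz.tendsto_block m j hm
  have hlim : Tendsto (fun n => 8 / ε ^ 2 * (pairCount z 0 (grid m n j) (grid m n (j + 1)) /
      (n * Real.log n) - ε ^ 2 / 16 * (1 - (charFun (μ.map fun x => S n x / scl n) s).re)))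
      atTop (𝓝 (8 / ε ^ 2 * (v - ε ^ 2 / 16 *
        (1 - (Complex.exp (-(v * s ^ 2 / 2 : ℝ))).re)))) :=
    (hV.sub ((((Complex.continuous_re.tendsto _).comp hcf).const_sub 1).const_mul _)).const_mul _
  have hv0 : 0 ≤ v := ge_of_tendsto' hV fun n => div_nonneg (segInter_nonneg z _ _ _ _)
    (mul_nonneg (Nat.cast_nonneg _) (Real.log_natCast_nonneg _))
  have hbound : 8 / ε ^ 2 * (v - ε ^ 2 / 16 *
        (1 - (Complex.exp (-(v * s ^ 2 / 2 : ℝ))).re)) < η := by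
    refine lt_of_le_of_lt ?_ hη
    rw [← Complex.ofReal_neg, Complex.exp_ofReal_re, hs2]
    have h1 := exp_neg_sub_le (y := 16 * v / ε ^ 2) (by positivity)
    have e1 : v * (32 / ε ^ 2) / 2 = 16 * v / ε ^ 2 := by ring
    rw [e1]
    calc 8 / ε ^ 2 * (v - ε ^ 2 / 16 * (1 - Real.exp (-(16 * v / ε ^ 2)))) =
          1 / 2 * (16 * v / ε ^ 2 - 1 + Real.exp (-(16 * v / ε ^ 2))) := by field_simp; ring
      _ ≤ 1 / 2 * ((16 * v / ε ^ 2) ^ 2 / 2) := by gcongr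
      _ = _ := by field_simp; ring
  filter_upwards [hlim.eventually_lt_const hbound, eventually_ge_atTop 2] with n hn hn2
  refine le_trans ?_ hn.le
  have hr := scl_pos hn2
  have h1 := h.maxEvent_le z (grid_mono m n (Nat.le_succ j)) (r := ε * scl n) (by positivity)
  have h2 := setIntegral_sq_le_charFun (h.memLp_segSum z (grid m n j) (grid m n (j + 1)))
    (a := ε * scl n / 2) (by positivity) (h.measurable_segSum z _ _)
  rw [h.integral_segSum_sq] at h2
  have e2 : charFun (μ.map (segSum X z (grid m n j) (grid m n (j + 1)))) (√8 / (ε * scl n / 2)) =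
      charFun (μ.map fun x => S n x / scl n) s := by
    simp_rw [div_eq_inv_mul (_ : ℝ) (scl n)]
    rw [charFun_map_mul_comp (h.measurable_segSum z _ _).aemeasurable]
    congr 1
    rw [hs]; field_simp
  rw [e2] at h2
  refine h1.trans ((mul_le_mul_of_nonneg_left h2 (by positivity)).trans (le_of_eq ?_))
  rw [← scl_sq]
  field_simp
  ring

/-- Tightness: on a fine grid, oscillations are unlikely. -/
theorem exists_oscEvent_le (h : IsIIDField μ X) (hz : IsRegularPath z c) (T : ℕ) {ε η : ℝ}
    (hε : 0 < ε) (hη : 0 < η) : ∃ M : ℕ, ∀ m ≥ M, 0 < m ∧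
      ∀ᶠ n in atTop, μ.real (oscEvent X z m n (m * T) (ε * scl n)) ≤ η := by
  -- Chosen so that each of the `m * T` blocks has probability at most `η / (m * (T + 1))`; `T + 1`
  -- avoids division by zero.
  obtain ⟨M, hM⟩ := exists_nat_gt (64 * c ^ 2 * (T + 1) / (ε ^ 4 * η))
  have hM0 : (0 : ℝ) < M := lt_of_le_of_lt (by positivity) hM
  refine ⟨M, fun m hm => ?_⟩
  have hmM : (M : ℝ) ≤ m := by exact_mod_cast hm
  have hm0 : (0 : ℝ) < m := hM0.trans_le hmM
  have hm' : 0 < m := by exact_mod_cast hm0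
  refine ⟨hm', ?_⟩
  have h1 : 64 * (c / m) ^ 2 / ε ^ 4 < η / (m * (T + 1)) := by
    have h2 := hM.trans_le hmM
    rw [div_lt_iff₀ (by positivity)] at h2
    have e : 64 * (c / m) ^ 2 / ε ^ 4 = 64 * c ^ 2 / (m ^ 2 * ε ^ 4) := by field_simp
    rw [e, div_lt_div_iff₀ (by positivity) (by positivity)]
    have h3 := mul_lt_mul_of_pos_left h2 hm0
    nlinarith
  have h2 := (Finset.eventually_all (Finset.range (m * T))).2 fun j _ =>
    h.eventually_maxEvent_block_le hz hm' j hε h1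
  filter_upwards [h2] with n hn
  calc μ.real (oscEvent X z m n (m * T) (ε * scl n)) ≤ ∑ j ∈ Finset.range (m * T),
        μ.real (maxEvent X z (grid m n j) (grid m n (j + 1)) (ε * scl n)) :=
        measureReal_biUnion_finset_le _ _
    _ ≤ ∑ _j ∈ Finset.range (m * T), η / (m * (T + 1)) := Finset.sum_le_sum hn
    _ = m * T * (η / (m * (T + 1))) := by simp
    _ ≤ η := by
        rw [mul_div_assoc', div_le_iff₀ (by positivity)]
        nlinarith [mul_pos hm0 hη]

/-! ### Shifts of the field -/

/-- In the cross term `X (z i - q)` and `X (z j)` correlate exactly when `z i - z j = q`. Along a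
regular path the two counts have the same asymptotics, so translating the field costs `o(n log n)`
in variance. -/
theorem integral_segSum_shift_sub_sq (h : IsIIDField μ X) (z : ℕ → ZSq) (q : ZSq) (a b : ℕ) :
    ∫ x, (segSum (fun l => X (l - q)) z a b x - segSum X z a b x) ^ 2 ∂μ =
      2 * pairCount z 0 a b - 2 * pairCount z q a b := by
  have h1 := (h.shift q).memLp_segSum z a b
  have h2 := h.memLp_segSum z a b
  have e : ∀ x, (segSum (fun l => X (l - q)) z a b x - segSum X z a b x) ^ 2 =
      segSum (fun l => X (l - q)) z a b x ^ 2 + segSum X z a b x ^ 2 -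
        2 * (segSum (fun l => X (l - q)) z a b x * segSum X z a b x) := fun x => by ring
  have hc : ∫ x, segSum (fun l => X (l - q)) z a b x * segSum X z a b x ∂μ =
      pairCount z q a b := by
    have hi : ∀ k l, Integrable (fun x => X k x * X l x) μ := fun k l =>
      (h.memLp k).integrable_mul (h.memLp l)
    simp_rw [segSum, Finset.sum_mul_sum]
    rw [integral_finsetSum _ fun _ _ => integrable_finsetSum _ fun _ _ => hi _ _, pairCount]
    conv_rhs => rw [Finset.sum_comm]
    refine Finset.sum_congr rfl fun i _ => ?_
    rw [integral_finsetSum _ fun _ _ => hi _ _]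
    refine Finset.sum_congr rfl fun j _ => ?_
    rw [h.integral_mul, hit]
    congr 1
    rw [sub_eq_iff_eq_add, sub_eq_iff_eq_add, add_comm]
  simp_rw [e]
  have hi1 : Integrable (fun x => segSum (fun l => X (l - q)) z a b x ^ 2 +
      segSum X z a b x ^ 2) μ := h1.integrable_sq.add h2.integrable_sq
  have hi2 : Integrable (fun x => 2 * (segSum (fun l => X (l - q)) z a b x *
      segSum X z a b x)) μ := (h1.integrable_mul h2).const_mul 2
  rw [integral_sub hi1 hi2,
    integral_add h1.integrable_sq h2.integrable_sq, integral_const_mul, hc,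
    (h.shift q).integral_segSum_sq, h.integral_segSum_sq]
  ring

end IsIIDField

/-- The maximal distance of the sums of the shifted and of the original field. -/
def shiftDist (X : ZSq → E → ℝ) (z : ℕ → ZSq) (q : ZSq) (N : ℕ) (x : E) : ℝ :=
  (Finset.range (N + 1)).sup' Finset.nonempty_range_add_one
    fun k => |segSum (fun l => X (l - q)) z 0 k x - segSum X z 0 k x|

theorem le_shiftDist_iff {q : ZSq} {N : ℕ} {x : E} {r : ℝ} : r ≤ shiftDist X z q N x ↔
    ∃ k ≤ N, r ≤ |segSum (fun l => X (l - q)) z 0 k x - segSum X z 0 k x| := by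
  simp [shiftDist, Finset.le_sup'_iff]

theorem le_shiftDist {q : ZSq} {N k : ℕ} (hk : k ≤ N) (x : E) :
    |segSum (fun l => X (l - q)) z 0 k x - segSum X z 0 k x| ≤ shiftDist X z q N x :=
  le_shiftDist_iff.2 ⟨k, hk, le_rfl⟩

theorem shiftDist_nonneg (q : ZSq) (N : ℕ) (x : E) : 0 ≤ shiftDist X z q N x :=
  (abs_nonneg _).trans (le_shiftDist (Nat.zero_le N) x)

theorem segSum_add (X : ZSq → E → ℝ) (z : ℕ → ZSq) {a b d : ℕ} (hab : a ≤ b) (hbd : b ≤ d)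
    (x : E) : segSum X z a b x + segSum X z b d x = segSum X z a d x :=
  Finset.sum_Ico_consecutive _ hab hbd

namespace IsIIDField

theorem measurable_shiftDist (h : IsIIDField μ X) (z : ℕ → ZSq) (q : ZSq) (N : ℕ) :
    Measurable (shiftDist X z q N) := by
  have : shiftDist X z q N = (Finset.range (N + 1)).sup' Finset.nonempty_range_add_one
      fun k x => |segSum (fun l => X (l - q)) z 0 k x - segSum X z 0 k x| := by
    ext x
    rw [Finset.sup'_apply]
    rfl
  rw [this]
  exact Finset.measurable_sup' _ fun k _ =>
    (((h.shift q).measurable_segSum z 0 k).sub (h.measurable_segSum z 0 k)).abs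

/-- A crude bound through the maxima of the two fields separately. Its merit is to be uniform in
`q`. -/
theorem measure_shiftDist_le (h : IsIIDField μ X) (z : ℕ → ZSq) (q : ZSq) (N : ℕ) {r : ℝ}
    (hr : 0 < r) :
    μ.real {x | r ≤ shiftDist X z q N x} ≤ 32 * pairCount z 0 0 N / r ^ 2 := by
  have hsub : {x | r ≤ shiftDist X z q N x} ⊆
      maxEvent (fun l => X (l - q)) z 0 N (r / 2) ∪ maxEvent X z 0 N (r / 2) := by
    intro x hx
    obtain ⟨k, hk, hkr⟩ := le_shiftDist_iff.1 hx
    by_contra hcon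
    simp only [maxEvent, Set.mem_union, Set.mem_ofPred_eq, not_or, not_exists, not_and,
      not_le] at hcon
    have h1 := hcon.1 k (Finset.mem_Icc.2 ⟨Nat.zero_le _, hk⟩)
    have h2 := hcon.2 k (Finset.mem_Icc.2 ⟨Nat.zero_le _, hk⟩)
    have h3 := abs_sub (segSum (fun l => X (l - q)) z 0 k x) (segSum X z 0 k x)
    linarith
  have h1 := (h.shift q).maxEvent_le_variance z (Nat.zero_le N) (half_pos hr)
  have h2 := h.maxEvent_le_variance z (Nat.zero_le N) (half_pos hr)
  refine (measureReal_mono hsub (measure_ne_top _ _)).trans ((measureReal_union_le _ _).trans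
    ((add_le_add h1 h2).trans (le_of_eq ?_)))
  field_simp
  ring

/-- At the points of a fixed grid the difference is small by its `L²` norm. Between grid points both
fields oscillate little by tightness. The level `t` is shared equally among the three errors. -/
theorem tendsto_measure_shiftDist (h : IsIIDField μ X) (hz : IsRegularPath z c) (q : ZSq) {T : ℕ}
    (hT : 0 < T) {t : ℝ} (ht : 0 < t) :
    Tendsto (fun n => μ.real {x | t * scl n ≤ shiftDist X z q (n * T) x}) atTop (𝓝 0) := by
  rw [Metric.tendsto_nhds]
  intro η hη
  set ε := t / 3 with hε'
  have hε : 0 < ε := by positivity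
  obtain ⟨M₁, hM₁⟩ := (h.shift q).exists_oscEvent_le hz T hε (show 0 < η / 4 by positivity)
  obtain ⟨M₂, hM₂⟩ := h.exists_oscEvent_le hz T hε (show 0 < η / 4 by positivity)
  set m := max M₁ M₂
  obtain ⟨hm, ho1⟩ := hM₁ m (le_max_left _ _)
  obtain ⟨-, ho2⟩ := hM₂ m (le_max_right _ _)
  have hV : ∀ j, Tendsto (fun n => (2 * pairCount z 0 0 (grid m n j) -
      2 * pairCount z q 0 (grid m n j)) / (n * Real.log n) / ε ^ 2) atTop (𝓝 0) := by
    intro j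
    have h1 := hz 0 0 ((j : ℝ) / m) le_rfl (by positivity)
    have h2 := hz q 0 ((j : ℝ) / m) le_rfl (by positivity)
    have h3 := ((h1.const_mul 2).sub (h2.const_mul 2)).div_const (ε ^ 2)
    rw [sub_self, zero_div] at h3
    refine h3.congr fun n => ?_
    simp only [mul_zero, Nat.floor_zero]
    rw [sub_div (2 * pairCount z 0 0 (grid m n j)), mul_div_assoc, mul_div_assoc]
    rfl
  have hVs := (tendsto_finsetSum (Finset.range (m * T)) fun j _ => hV j)
  rw [Finset.sum_const_zero] at hVs
  filter_upwards [ho1, ho2, hVs.eventually_lt_const (show 0 < η / 4 by positivity),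
    eventually_ge_atTop 2] with n h1 h2 h3 hn
  have hr := scl_pos hn
  rw [Real.dist_eq, sub_zero, abs_of_nonneg measureReal_nonneg]
  set G : Set E := ⋃ j ∈ Finset.range (m * T), {x | ε * scl n ≤
    |segSum (fun l => X (l - q)) z 0 (grid m n j) x - segSum X z 0 (grid m n j) x|} with hG
  have hGle : μ.real G ≤ ∑ j ∈ Finset.range (m * T), (2 * pairCount z 0 0 (grid m n j) -
      2 * pairCount z q 0 (grid m n j)) / (n * Real.log n) / ε ^ 2 := by
    refine (measureReal_biUnion_finset_le _ _).trans (Finset.sum_le_sum fun j _ => ?_)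
    have hmem := ((h.shift q).memLp_segSum z 0 (grid m n j)).sub (h.memLp_segSum z 0 (grid m n j))
    have h4 := mul_meas_ge_le_integral_of_nonneg (μ := μ) (ae_of_all _ fun x => sq_nonneg _)
      hmem.integrable_sq ((ε * scl n) ^ 2)
    simp only [Pi.sub_apply] at h4
    rw [h.integral_segSum_shift_sub_sq] at h4
    rw [div_div, ← scl_sq, le_div_iff₀ (by positivity), mul_comm]
    refine le_trans (le_of_eq ?_) h4
    rw [mul_pow, mul_comm (ε ^ 2)]
    congr 2
    ext x
    simp only [Set.mem_ofPred_eq]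
    rw [← mul_pow, mul_comm (scl n), ← sq_abs (_ - _), pow_le_pow_iff_left₀ (by positivity)
      (abs_nonneg _) two_ne_zero]
  have hsub : {x | t * scl n ≤ shiftDist X z q (n * T) x} ⊆
      G ∪ (oscEvent (fun l => X (l - q)) z m n (m * T) (ε * scl n) ∪
        oscEvent X z m n (m * T) (ε * scl n)) := by
    intro x hx
    obtain ⟨k, hk, hkr⟩ := le_shiftDist_iff.1 hx
    obtain ⟨j, hj, hj1, hj2⟩ := exists_block (τ := grid m n) (K := m * T) (k := k)
      (by rw [grid_zero]; exact Nat.zero_le _) (by rwa [grid_mul hm]) (by positivity)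
    by_contra hcon
    simp only [hG, oscEvent, maxEvent, Set.mem_union, Set.mem_iUnion, Set.mem_ofPred_eq, not_or,
      not_exists, not_and, not_le, Finset.mem_range, Finset.mem_Icc, exists_prop] at hcon
    have e1 := hcon.1 j hj
    have e2 := hcon.2.1 j hj k ⟨hj1, hj2⟩
    have e3 := hcon.2.2 j hj k ⟨hj1, hj2⟩
    have e4 := segSum_add (fun l => X (l - q)) z (Nat.zero_le _) hj1 x
    have e5 := segSum_add X z (Nat.zero_le _) hj1 x
    rw [← e4, ← e5, add_sub_add_comm] at hkr
    have e6 := abs_add_le (segSum (fun l => X (l - q)) z 0 (grid m n j) x -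
      segSum X z 0 (grid m n j) x) (segSum (fun l => X (l - q)) z (grid m n j) k x -
      segSum X z (grid m n j) k x)
    have e7 := abs_sub (segSum (fun l => X (l - q)) z (grid m n j) k x)
      (segSum X z (grid m n j) k x)
    have e8 : t * scl n = 3 * (ε * scl n) := by rw [hε']; ring
    linarith
  calc _ ≤ μ.real G + (μ.real (oscEvent (fun l => X (l - q)) z m n (m * T) (ε * scl n)) +
        μ.real (oscEvent X z m n (m * T) (ε * scl n))) :=
        (measureReal_mono hsub (measure_ne_top _ _)).trans ((measureReal_union_le _ _).trans
          (add_le_add le_rfl (measureReal_union_le _ _)))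
    _ < η := by linarith

end IsIIDField

end

noncomputable section

variable {E : Type*} [MeasurableSpace E] {μ : Measure E} [IsProbabilityMeasure μ]
  {X : ZSq → E → ℝ} {z : ℕ → ZSq} {c : ℝ}

/-! ### Moving averages -/

theorem min_one_div_sq_le {C t : ℝ} (ht : 0 < t) {p : ℝ} (h1 : p ≤ 1)
    (h2 : p ≤ C / t ^ 2) : p ≤ (C + 1) * (1 + t ^ 2)⁻¹ := by
  rw [← div_eq_mul_inv, le_div_iff₀ (by positivity)]
  rw [le_div_iff₀ (by positivity)] at h2
  nlinarith

namespace IsIIDField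

/-- The mean of the normalized maximal distance of the sums of the field and of a shift tends to
zero, with a bound which does not depend on the shift. -/
theorem tendsto_lintegral_shiftDist (h : IsIIDField μ X) (hz : IsRegularPath z c) {T : ℕ}
    (hT : 0 < T) : ∃ B : ENNReal, B ≠ ⊤ ∧
      (∀ᶠ n in atTop, ∀ q, ∫⁻ x, ENNReal.ofReal (shiftDist X z q (n * T) x / scl n) ∂μ ≤ B) ∧
      ∀ q, Tendsto (fun n => ∫⁻ x, ENNReal.ofReal (shiftDist X z q (n * T) x / scl n) ∂μ) atTop
        (𝓝 0) := by
  have hlim := hz 0 0 T le_rfl (Nat.cast_nonneg _)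
  have hfl : ∀ n : ℕ, ⌊(n : ℝ) * (T : ℝ)⌋₊ = n * T := fun n => by
    rw [← Nat.cast_mul, Nat.floor_natCast]
  simp only [mul_zero, Nat.floor_zero, hfl, sub_zero] at hlim
  have hcT : 0 ≤ c * T := ge_of_tendsto' hlim fun n => div_nonneg (segInter_nonneg z _ _ _ _)
    (mul_nonneg (Nat.cast_nonneg _) (Real.log_natCast_nonneg _))
  have hev := hlim.eventually_lt_const (show c * T < c * T + 1 by linarith)
  set C := 32 * (c * T + 1) with hC
  have hC0 : 0 ≤ C := by positivity
  set bound : ℝ → ENNReal := fun t => ENNReal.ofReal ((C + 1) * (1 + t ^ 2)⁻¹) with hbound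
  have hlayer : ∀ n, 2 ≤ n → ∀ q,
      ∫⁻ x, ENNReal.ofReal (shiftDist X z q (n * T) x / scl n) ∂μ =
        ∫⁻ t in Set.Ioi 0, μ {x | t * scl n ≤ shiftDist X z q (n * T) x} := by
    intro n hn q
    rw [lintegral_eq_lintegral_meas_le μ
      (ae_of_all _ fun x => div_nonneg (shiftDist_nonneg q _ x) (scl_nonneg n))
      ((h.measurable_shiftDist z q (n * T)).div_const _).aemeasurable]
    simp_rw [le_div_iff₀ (scl_pos hn)]
  have hdom : ∀ n, 2 ≤ n → pairCount z 0 0 (n * T) / (n * Real.log n) < c * T + 1 → ∀ q,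
      ∀ t ∈ Set.Ioi (0 : ℝ), μ {x | t * scl n ≤ shiftDist X z q (n * T) x} ≤ bound t := by
    intro n hn hp q t ht
    have ht0 : 0 < t := ht
    have hr := scl_pos hn
    have h1 := h.measure_shiftDist_le z q (n * T) (r := t * scl n) (by positivity)
    rw [ENNReal.le_ofReal_iff_toReal_le (measure_ne_top _ _) (by positivity)]
    refine min_one_div_sq_le ht0 measureReal_le_one (h1.trans ?_)
    rw [← scl_sq, div_lt_iff₀ (by positivity)] at hp
    rw [div_le_div_iff₀ (by positivity) (by positivity), hC]
    have : 0 < t ^ 2 := by positivity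
    nlinarith
  have hfin : ∫⁻ t in Set.Ioi (0 : ℝ), bound t ≠ ⊤ := by
    have h1 : Integrable (fun t : ℝ => (C + 1) * (1 + t ^ 2)⁻¹) :=
      integrable_inv_one_add_sq.const_mul _
    exact (h1.integrableOn.lintegral_lt_top).ne
  refine ⟨∫⁻ t in Set.Ioi (0 : ℝ), bound t, hfin, ?_, fun q => ?_⟩
  · filter_upwards [hev, eventually_ge_atTop 2] with n hn hn2 q
    rw [hlayer n hn2]
    exact setLIntegral_mono' measurableSet_Ioi (hdom n hn2 hn q)
  · have h1 : Tendsto (fun n => ∫⁻ t in Set.Ioi (0 : ℝ),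
        μ {x | t * scl n ≤ shiftDist X z q (n * T) x}) atTop
        (𝓝 (∫⁻ _t in Set.Ioi (0 : ℝ), 0)) := by
      refine tendsto_lintegral_filter_of_dominated_convergence bound ?_ ?_ hfin ?_
      -- Measurability in the level `t` comes from monotonicity.
      · filter_upwards [] with n
        refine Antitone.measurable fun s t hst => measure_mono fun x hx => ?_
        have h2 : t * scl n ≤ shiftDist X z q (n * T) x := hx
        exact (mul_le_mul_of_nonneg_right hst (scl_nonneg n)).trans h2
      · filter_upwards [hev, eventually_ge_atTop 2] with n hn hn2
        exact (ae_restrict_iff' measurableSet_Ioi).2 (ae_of_all _ (hdom n hn2 hn q))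
      · refine (ae_restrict_iff' measurableSet_Ioi).2 (ae_of_all _ fun t ht => ?_)
        have h2 := h.tendsto_measure_shiftDist hz q hT (t := t) ht
        have h3 := (ENNReal.tendsto_ofReal h2)
        rw [ENNReal.ofReal_zero] at h3
        refine h3.congr fun n => ?_
        rw [measureReal_def, ENNReal.ofReal_toReal (measure_ne_top _ _)]
    rw [lintegral_zero] at h1
    refine h1.congr' ?_
    filter_upwards [eventually_ge_atTop 2] with n hn
    rw [hlayer n hn q]

variable {a : ZSq → ℝ}

theorem lintegral_enorm_le (h : IsIIDField μ X) (l : ZSq) : ∫⁻ x, ‖X l x‖ₑ ∂μ ≤ 1 := by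
  have h1 : eLpNorm (X l) 1 μ ≤ eLpNorm (X l) 2 μ :=
    eLpNorm_le_eLpNorm_of_exponent_le (by norm_num) (h.meas l).aestronglyMeasurable
  rw [(h.ident l).eLpNorm_eq, (h.ident l).eLpNorm_eq, h.norm] at h1
  rw [← (h.ident l).eLpNorm_eq, eLpNorm_one_eq_lintegral_enorm] at h1
  exact h1

theorem tsum_enorm_ne_top (ha : Summable fun q => |a q|) : ∑' q, ‖a q‖ₑ ≠ ⊤ := by
  have h1 := ha.tsum_ofReal_ne_top
  refine (tsum_congr fun q => ?_).trans_ne h1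
  rw [← Real.enorm_abs, Real.enorm_eq_ofReal (abs_nonneg _)]

/-- The series defining a moving average converges almost surely. -/
theorem ae_summable (h : IsIIDField μ X) (ha : Summable fun q => |a q|) :
    ∀ᵐ x ∂μ, ∀ l, Summable fun q => a q * X (l - q) x := by
  rw [ae_all_iff]
  intro l
  have h1 : ∫⁻ x, ∑' q, ‖a q * X (l - q) x‖ₑ ∂μ ≠ ⊤ := by
    rw [lintegral_tsum fun q => ((h.meas (l - q)).const_mul (a q)).enorm.aemeasurable]
    refine ne_top_of_le_ne_top (tsum_enorm_ne_top ha) (ENNReal.tsum_le_tsum fun q => ?_)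
    simp_rw [enorm_mul]
    rw [lintegral_const_mul _ (h.meas _).enorm]
    exact mul_le_of_le_one_right' (h.lintegral_enorm_le _)
  have h2 := ae_lt_top' (AEMeasurable.tsum fun q =>
    ((h.meas (l - q)).const_mul (a q)).enorm.aemeasurable) h1
  filter_upwards [h2] with x hx
  exact Summable.of_nnnorm (ENNReal.tsum_coe_ne_top_iff_summable.1 hx.ne)

theorem aemeasurable_sumAlong (h : IsIIDField μ X) (z : ℕ → ZSq) (k : ℕ) :
    AEMeasurable (sumAlong (movingAverage a X) z k) μ :=
  (Finset.measurable_sum _ fun i _ => Measurable.tsum fun q =>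
    (h.meas (z i - q)).const_mul (a q)).aemeasurable

/-- Where all the series converge, the sum of the moving average is the `a`-weighted sum of the sums
of translates, and each is compared with the sum of the original field. -/
theorem ae_enorm_sumAlong_sub_le (h : IsIIDField μ X) (ha : Summable fun q => |a q|)
    (z : ℕ → ZSq) : ∀ᵐ x ∂μ, ∀ N, ∀ k ≤ N,
      ‖sumAlong (movingAverage a X) z k x - (∑' q, a q) * sumAlong X z k x‖ₑ ≤
        ∑' q, ‖a q‖ₑ * ENNReal.ofReal (shiftDist X z q N x) := by
  filter_upwards [h.ae_summable ha] with x hx N k hk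
  have hsa : Summable a := ha.of_abs
  have e : sumAlong (movingAverage a X) z k x - (∑' q, a q) * sumAlong X z k x =
      ∑' q, a q * (segSum (fun l => X (l - q)) z 0 k x - segSum X z 0 k x) := by
    have h1 : sumAlong (movingAverage a X) z k x =
        ∑' q, a q * segSum (fun l => X (l - q)) z 0 k x := by
      simp only [sumAlong, movingAverage, segSum, Finset.mul_sum, ← Finset.range_eq_Ico]
      rw [Summable.tsum_finsetSum fun i _ => hx (z i)]
    have h2 : Summable fun q => a q * segSum (fun l => X (l - q)) z 0 k x := by
      simp only [segSum, Finset.mul_sum]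
      exact summable_sum fun i _ => hx (z i)
    have h3 : (∑' q, a q) * sumAlong X z k x = ∑' q, a q * segSum X z 0 k x := by
      rw [tsum_mul_right, sumAlong, segSum, Finset.range_eq_Ico]
    rw [h1, h3, ← Summable.tsum_sub h2 (hsa.mul_right _)]
    simp_rw [mul_sub]
  rw [e]
  refine enorm_tsum_le_tsum_enorm.trans (ENNReal.tsum_le_tsum fun q => ?_)
  rw [enorm_mul]
  gcongr
  rw [← Real.enorm_abs, Real.enorm_eq_ofReal (abs_nonneg _)]
  exact ENNReal.ofReal_le_ofReal (le_shiftDist hk x)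

/-- The sums of a moving average along a regular path are close to those of a multiple of the
original field. -/
theorem tendsto_movingAverage_sub (h : IsIIDField μ X) (hz : IsRegularPath z c)
    (ha : Summable fun q => |a q|) {T : ℕ} (hT : 0 < T) {ε : ℝ} (hε : 0 < ε) :
    Tendsto (fun n => μ.real {x | ∃ k ≤ n * T, ε * scl n ≤
      |sumAlong (movingAverage a X) z k x - (∑' q, a q) * sumAlong X z k x|}) atTop (𝓝 0) := by
  obtain ⟨B, hB, hbd, hlim⟩ := h.tendsto_lintegral_shiftDist hz hT
  set I : ℕ → ZSq → ENNReal := fun n q =>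
    ∫⁻ x, ENNReal.ofReal (shiftDist X z q (n * T) x / scl n) ∂μ with hI
  have hsum : Tendsto (fun n => ∑' q, ‖a q‖ₑ * I n q) atTop (𝓝 0) := by
    -- Dominated convergence in `q` for counting measure: each translate contributes a vanishing
    -- amount, dominated by the summable `‖a q‖ₑ * B`.
    have h1 : Tendsto (fun n => ∫⁻ q, ‖a q‖ₑ * I n q ∂(Measure.count : Measure ZSq)) atTop
        (𝓝 (∫⁻ _q, 0 ∂(Measure.count : Measure ZSq))) := by
      refine tendsto_lintegral_filter_of_dominated_convergence (fun q => ‖a q‖ₑ * B) ?_ ?_ ?_ ?_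
      · exact Eventually.of_forall fun n => measurable_of_countable _
      · filter_upwards [hbd] with n hn
        exact ae_of_all _ fun q => mul_le_mul_right (hn q) _
      · rw [lintegral_count, ENNReal.tsum_mul_right]
        exact ENNReal.mul_ne_top (tsum_enorm_ne_top ha) hB
      · refine ae_of_all _ fun q => ?_
        have := ENNReal.Tendsto.const_mul (a := ‖a q‖ₑ) (hlim q) (Or.inr enorm_ne_top)
        rwa [mul_zero] at this
    simp_rw [lintegral_count] at h1
    simpa using h1
  have hε' : ENNReal.ofReal ε ≠ 0 := by simpa using hε
  have h2 := ENNReal.Tendsto.div_const hsum (Or.inr hε')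
  rw [ENNReal.zero_div] at h2
  have h3 := (ENNReal.tendsto_toReal ENNReal.zero_ne_top).comp h2
  rw [ENNReal.toReal_zero] at h3
  refine squeeze_zero' (Eventually.of_forall fun n => measureReal_nonneg) ?_ h3
  have hfin : ∀ᶠ n in atTop, (∑' q, ‖a q‖ₑ * I n q) / ENNReal.ofReal ε < ⊤ :=
    h2.eventually_lt_const ENNReal.zero_lt_top
  filter_upwards [eventually_ge_atTop 2, hfin] with n hn hf
  have hr := scl_pos hn
  refine ENNReal.toReal_mono hf.ne ?_
  have hmeas : Measurable fun x => ∑' q, ‖a q‖ₑ *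
      ENNReal.ofReal (shiftDist X z q (n * T) x / scl n) :=
    Measurable.tsum fun q => Measurable.const_mul
      ((h.measurable_shiftDist z q (n * T)).div_const _).ennreal_ofReal _
  calc _ ≤ μ {x | ENNReal.ofReal ε ≤ ∑' q, ‖a q‖ₑ *
        ENNReal.ofReal (shiftDist X z q (n * T) x / scl n)} := by
        refine measure_mono_ae ?_
        filter_upwards [h.ae_enorm_sumAlong_sub_le ha z] with x hx
        rintro ⟨k, hk, hkε⟩
        have h4 := hx (n * T) k hk
        change ENNReal.ofReal ε ≤ _
        have h5 : ENNReal.ofReal (ε * scl n) ≤ ∑' q, ‖a q‖ₑ *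
            ENNReal.ofReal (shiftDist X z q (n * T) x) := by
          refine le_trans ?_ h4
          rw [← Real.enorm_abs, Real.enorm_eq_ofReal (abs_nonneg _)]
          exact ENNReal.ofReal_le_ofReal hkε
        simp_rw [ENNReal.ofReal_div_of_pos hr, div_eq_mul_inv, ← mul_assoc]
        rw [ENNReal.tsum_mul_right, ← div_eq_mul_inv, ENNReal.le_div_iff_mul_le
          (Or.inl (by simpa using hr)) (Or.inl ENNReal.ofReal_ne_top),
          ← ENNReal.ofReal_mul hε.le]
        exact h5
    _ ≤ (∫⁻ x, ∑' q, ‖a q‖ₑ * ENNReal.ofReal (shiftDist X z q (n * T) x / scl n) ∂μ) /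
        ENNReal.ofReal ε := meas_ge_le_lintegral_div hmeas.aemeasurable hε' ENNReal.ofReal_ne_top
    _ = _ := by
        congr 1
        rw [lintegral_tsum fun q => (Measurable.const_mul
          ((h.measurable_shiftDist z q (n * T)).div_const _).ennreal_ofReal _).aemeasurable]
        refine tsum_congr fun q => ?_
        rw [lintegral_const_mul _
          ((h.measurable_shiftDist z q (n * T)).div_const _).ennreal_ofReal]

end IsIIDField

end

noncomputable section

/-! ### Gaussian Hilbert spaces and pre-Brownian motion -/

section Isonormal

variable {Ω : Type*} [MeasurableSpace Ω] {P : Measure Ω} [IsProbabilityMeasure P]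

/-- From `|exp(isx) - exp(isy)| ≤ |s| |x - y|` and `L¹ ≤ L²`. It lets Gaussian laws pass to `L²`
limits. -/
theorem norm_charFun_sub_le (f g : Lp ℝ 2 P) (s : ℝ) :
    ‖charFun (P.map f) s - charFun (P.map g) s‖ ≤ |s| * ‖f - g‖ := by
  have hf : AEMeasurable f P := (Lp.aestronglyMeasurable f).aemeasurable
  have hg : AEMeasurable g P := (Lp.aestronglyMeasurable g).aemeasurable
  have hi : ∀ u : Lp ℝ 2 P, Integrable (fun x => Complex.exp (s * u x * Complex.I)) P := by
    intro u
    have hu : AEMeasurable u P := (Lp.aestronglyMeasurable u).aemeasurable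
    refine Integrable.of_bound (C := 1) (AEMeasurable.aestronglyMeasurable (by fun_prop))
      (ae_of_all _ fun x => ?_)
    rw [← Complex.ofReal_mul, Complex.norm_exp_ofReal_mul_I]
  have hd : MemLp (f - g : Lp ℝ 2 P) 2 P := Lp.memLp _
  rw [charFun_apply_real, charFun_apply_real, integral_map hf (by fun_prop),
    integral_map hg (by fun_prop), ← integral_sub (hi f) (hi g)]
  have h1 : ∀ᵐ x ∂P, ‖Complex.exp (s * f x * Complex.I) - Complex.exp (s * g x * Complex.I)‖ ≤
      |s| * |(f - g : Lp ℝ 2 P) x| := by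
    filter_upwards [Lp.coeFn_sub f g] with x hx
    rw [hx, Pi.sub_apply, ← abs_mul, mul_sub]
    have e : Complex.exp (s * f x * Complex.I) - Complex.exp (s * g x * Complex.I) =
        Complex.exp (((s * g x : ℝ) : ℂ) * Complex.I) *
          (Complex.exp (Complex.I * ((s * f x - s * g x : ℝ) : ℂ)) - 1) := by
      rw [mul_sub, ← Complex.exp_add, mul_one]
      push_cast
      congr 2
      ring
    rw [e, norm_mul, Complex.norm_exp_ofReal_mul_I, one_mul]
    exact Real.norm_exp_I_mul_ofReal_sub_one_le.trans_eq (Real.norm_eq_abs _)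
  have h2 : eLpNorm (f - g : Lp ℝ 2 P) 1 P ≤ eLpNorm (f - g : Lp ℝ 2 P) 2 P :=
    eLpNorm_le_eLpNorm_of_exponent_le (by norm_num) hd.1
  have h3 : ∫ x, |(f - g : Lp ℝ 2 P) x| ∂P ≤ ‖f - g‖ := by
    rw [Lp.norm_def]
    have h4 := ENNReal.toReal_mono hd.2.ne h2
    refine le_trans (le_of_eq ?_) h4
    rw [eLpNorm_one_eq_lintegral_enorm, ← integral_norm_eq_lintegral_enorm hd.1]
    rfl
  calc _ ≤ ∫ x, |s| * |(f - g : Lp ℝ 2 P) x| ∂P :=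
        norm_integral_le_of_norm_le (((hd.integrable (by norm_num)).abs).const_mul _) h1
    _ = |s| * ∫ x, |(f - g : Lp ℝ 2 P) x| ∂P := integral_const_mul _ _
    _ ≤ _ := by gcongr

theorem tendsto_charFun_of_tendsto_Lp {ι : Type*} {l : Filter ι} {f : ι → Lp ℝ 2 P}
    {g : Lp ℝ 2 P} (h : Tendsto f l (𝓝 g)) (s : ℝ) :
    Tendsto (fun i => charFun (P.map (f i)) s) l (𝓝 (charFun (P.map g) s)) := by
  rw [tendsto_iff_norm_sub_tendsto_zero] at h ⊢
  refine squeeze_zero (fun _ => norm_nonneg _) (fun i => norm_charFun_sub_le _ _ s) ?_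
  simpa using h.const_mul |s|

end Isonormal

/-- Every real Hilbert space embeds isometrically in a space of centered Gaussian variables. -/
theorem exists_isonormal (H : Type) [NormedAddCommGroup H] [InnerProductSpace ℝ H]
    [CompleteSpace H] : ∃ (Ω : Type) (_ : MeasurableSpace Ω) (P : Measure Ω)
      (_ : IsProbabilityMeasure P) (J : H →ₗᵢ[ℝ] Lp ℝ 2 P),
      ∀ f, P.map (J f) = gaussianReal 0 (‖f‖₊ ^ 2) := by
  classical
  -- A Hilbert basis is sent to independent standard Gaussian coordinates, which are orthonormal in
  -- `L²`. The law of `J f` is identified by characteristic functions of finite partial sums.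
  obtain ⟨w, b, -⟩ := exists_hilbertBasis ℝ H
  let P : Measure (w → ℝ) := Measure.infinitePi fun _ => gaussianReal 0 1
  have hme : ∀ i, Measurable fun ω : w → ℝ => ω i := fun i => measurable_pi_apply i
  have hlaw : ∀ i, P.map (fun ω => ω i) = gaussianReal 0 1 := fun i =>
    Measure.infinitePi_map_eval (fun _ : w => gaussianReal 0 1) i
  have hind : iIndepFun (fun (i : w) (ω : w → ℝ) => ω i) P :=
    iIndepFun_infinitePi (X := fun _ ω => ω) (by fun_prop)
  have hL : ∀ i, MemLp (fun ω : w → ℝ => ω i) 2 P := by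
    intro i
    have h1 : MemLp id 2 (P.map fun ω : w → ℝ => ω i) := by
      rw [hlaw i]; exact memLp_id_gaussianReal 2
    exact h1.comp_of_map (hme i).aemeasurable
  have hmean : ∀ i, ∫ ω, ω i ∂P = 0 := by
    intro i
    have h1 := integral_map (μ := P) (φ := fun ω : w → ℝ => ω i) (f := fun x : ℝ => x)
      (hme i).aemeasurable (by fun_prop)
    rw [← h1, hlaw i, integral_id_gaussianReal]
  have hsq : ∀ i, ∫ ω, ω i ^ 2 ∂P = 1 := by
    intro i
    have h1 := integral_map (μ := P) (φ := fun ω : w → ℝ => ω i) (f := fun x : ℝ => x ^ 2)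
      (hme i).aemeasurable (by fun_prop)
    have h2 := variance_id_gaussianReal (μ := 0) (v := 1)
    rw [variance_eq_integral (by fun_prop)] at h2
    simp only [id_eq, integral_id_gaussianReal, sub_zero] at h2
    rw [← h1, hlaw i, h2]
    norm_num
  let e : w → Lp ℝ 2 P := fun i => (hL i).toLp _
  have he : Orthonormal ℝ e := by
    rw [orthonormal_iff_ite]
    intro i j
    have h1 : inner ℝ (e i) (e j) = ∫ ω, ω i * ω j ∂P := by
      rw [L2.inner_def]
      refine integral_congr_ae ?_
      filter_upwards [(hL i).coeFn_toLp, (hL j).coeFn_toLp] with ω h1 h2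
      simp only [e]
      rw [h1, h2]
      simp [mul_comm]
    rw [h1]
    split_ifs with hij
    · subst hij
      simpa [sq] using hsq i
    · rw [(hind.indepFun hij).integral_fun_mul_eq_mul_integral
        (hme i).aestronglyMeasurable (hme j).aestronglyMeasurable, hmean, zero_mul]
  refine ⟨w → ℝ, inferInstance, P, inferInstance,
    he.orthogonalFamily.linearIsometry.comp b.repr.toLinearIsometry, fun f => ?_⟩
  set J := he.orthogonalFamily.linearIsometry.comp b.repr.toLinearIsometry with hJ
  have hs : HasSum (fun i => b.repr f i • e i) (J f) :=
    he.orthogonalFamily.hasSum_linearIsometry (b.repr f)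
  have hn : HasSum (fun i => b.repr f i ^ 2) (‖f‖ ^ 2) := by
    have h1 := b.hasSum_inner_mul_inner f f
    rw [real_inner_self_eq_norm_sq] at h1
    refine h1.congr_fun ?_
    intro i
    rw [b.repr_apply_apply, sq, real_inner_comm]
  have : IsProbabilityMeasure (P.map (J f)) :=
    Measure.isProbabilityMeasure_map (Lp.aestronglyMeasurable _).aemeasurable
  refine Measure.ext_of_charFun (funext fun s => ?_)
  have h1 := tendsto_charFun_of_tendsto_Lp hs s
  have h2 : ∀ S : Finset w, charFun (P.map (∑ i ∈ S, b.repr f i • e i : Lp ℝ 2 P)) s =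
      Complex.exp (-((∑ i ∈ S, b.repr f i ^ 2 : ℝ) * s ^ 2 / 2)) := by
    intro S
    have h3 : (∑ i ∈ S, b.repr f i • e i : Lp ℝ 2 P) =ᵐ[P] fun ω => ∑ i ∈ S, b.repr f i * ω i := by
      have h4 : ∀ᵐ ω ∂P, ∀ i ∈ S, (b.repr f i • e i : Lp ℝ 2 P) ω = b.repr f i * ω i := by
        refine (ae_ball_iff S.countable_toSet).2 fun i _ => ?_
        filter_upwards [Lp.coeFn_smul (b.repr f i) (e i), (hL i).coeFn_toLp] with ω h5 h6
        rw [h5, Pi.smul_apply, smul_eq_mul]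
        congr 1
      filter_upwards [h4, Lp.coeFn_finsetSum S fun i => b.repr f i • e i] with ω h5 h6
      rw [h6, Finset.sum_apply]
      exact Finset.sum_congr rfl h5
    rw [Measure.map_congr h3]
    have h7 : iIndepFun (fun (i : w) (ω : w → ℝ) => b.repr f i * ω i) P :=
      hind.comp (fun i x => b.repr f i * x) (by fun_prop)
    rw [(h7.restrict S).charFun_map_fun_finsetSum_eq_prod 
        (fun i _ => ((hme i).const_mul _).aemeasurable), Finset.prod_apply]
    rw [Complex.ofReal_sum, Finset.sum_mul, Finset.sum_div, ← Finset.sum_neg_distrib,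
      Complex.exp_sum]
    refine Finset.prod_congr rfl fun i _ => ?_
    rw [charFun_map_mul_comp (hme i).aemeasurable, hlaw i, charFun_gaussianReal]
    congr 1
    push_cast
    ring
  have h3 : Tendsto (fun S : Finset w => charFun (P.map (∑ i ∈ S, b.repr f i • e i : Lp ℝ 2 P)) s)
      atTop (𝓝 (Complex.exp (-((‖f‖ ^ 2 : ℝ) * s ^ 2 / 2)))) := by
    simp_rw [h2]
    have h4 : Continuous fun y : ℝ => Complex.exp (-((y : ℂ) * s ^ 2 / 2)) := by fun_prop
    exact (h4.tendsto _).comp hn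
  rw [tendsto_nhds_unique h1 h3, charFun_gaussianReal]
  congr 1
  push_cast
  simp

/-- Existence of a pre-Brownian motion. -/
theorem exists_isPreBrownianReal : ∃ (Ω : Type) (_ : MeasurableSpace Ω) (P : Measure Ω)
    (_ : IsProbabilityMeasure P) (B : ℝ≥0 → Ω → ℝ), IsPreBrownianReal B P := by
  obtain ⟨Ω, _, P, _, J, hJ⟩ := exists_isonormal (Lp ℝ 2 (volume : Measure ℝ))
  -- The indicator of `(0, t]`: inner products of these are `min s t`, the Brownian covariance.
  let I : ℝ≥0 → Lp ℝ 2 (volume : Measure ℝ) := fun t =>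
    indicatorConstLp 2 (measurableSet_Ioc (a := (0 : ℝ)) (b := t)) (by simp) 1
  have hm : ∀ f, AEMeasurable (J f) P := fun f => (Lp.aestronglyMeasurable _).aemeasurable
  have hJi : ∀ f, ∫ ω, J f ω ∂P = 0 := by
    intro f
    have h1 := integral_map (μ := P) (φ := J f) (f := fun x : ℝ => x) (hm f) (by fun_prop)
    rw [← h1, hJ, integral_id_gaussianReal]
  refine ⟨Ω, _, P, inferInstance, fun t => J (I t), ?_⟩
  refine IsGaussianProcess.isPreBrownianReal_of_covariance ?_ (fun t => hJi _) fun s t hst => ?_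
  · refine ⟨fun S => ⟨isGaussian_of_map_eq_gaussianReal fun L => ?_⟩⟩
    have hM : AEMeasurable (fun ω => S.restrict fun t => J (I t) ω) P :=
      aemeasurable_pi_lambda _ fun _ => hm _
    let f := ∑ i : S, L (Pi.single i 1) • I i
    refine ⟨0, ‖f‖₊ ^ 2, ?_⟩
    rw [AEMeasurable.map_map_of_aemeasurable (by fun_prop) hM, ← hJ f]
    refine Measure.map_congr ?_
    have h0 : J f = ∑ i : S, L (Pi.single i 1) • J (I i) := by
      simp [f, map_sum]
    have h4 : ∀ᵐ ω ∂P, ∀ i : S, (L (Pi.single i 1) • J (I i) : Lp ℝ 2 P) ω =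
        L (Pi.single i 1) * J (I i) ω := by
      refine ae_all_iff.2 fun i => ?_
      filter_upwards [Lp.coeFn_smul (L (Pi.single i 1)) (J (I i))] with ω h5
      rw [h5, Pi.smul_apply, smul_eq_mul]
    rw [h0]
    filter_upwards [h4, Lp.coeFn_finsetSum Finset.univ fun i : S => L (Pi.single i 1) • J (I i)]
      with ω h5 h6
    rw [h6, Finset.sum_apply]
    simp_rw [h5]
    rw [Function.comp_apply]
    conv_lhs => rw [pi_eq_sum_univ (S.restrict fun t => J (I t) ω)]
    rw [map_sum]
    refine Finset.sum_congr rfl fun i _ => ?_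
    rw [map_smul, smul_eq_mul, mul_comm]
    congr 2
    ext j
    simp [Pi.single_apply, eq_comm]
  · have hL : ∀ f, MemLp (J f) 2 P := fun f => Lp.memLp _
    rw [covariance_eq_sub (hL _) (hL _), hJi, hJi, mul_zero, sub_zero]
    have h1 : ∫ ω, J (I s) ω * J (I t) ω ∂P = inner ℝ (J (I s)) (J (I t)) := by
      rw [L2.inner_def]
      exact integral_congr_ae (ae_of_all _ fun ω => mul_comm _ _)
    have hst' : (s : ℝ) ≤ t := hst
    change ∫ ω, J (I s) ω * J (I t) ω ∂P = s
    rw [h1, J.inner_map_map]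
    simp only [I]
    rw [L2.inner_indicatorConstLp_indicatorConstLp (hμs := by simp) (hμt := by simp)]
    rw [Set.Ioc_inter_Ioc]
    simp [hst']

end

noncomputable section

/-! ### Polygonal paths -/

/-- The projection of the line on `[0, 1]`. -/
def clamp (x : ℝ) : ℝ := max 0 (min 1 x)

theorem continuous_clamp : Continuous clamp := by unfold clamp; fun_prop

theorem clamp_nonneg (x : ℝ) : 0 ≤ clamp x := le_max_left _ _

theorem clamp_le_one (x : ℝ) : clamp x ≤ 1 := max_le zero_le_one (min_le_left _ _)

theorem clamp_of_nonpos {x : ℝ} (hx : x ≤ 0) : clamp x = 0 :=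
  max_eq_left ((min_le_right _ _).trans hx)

theorem clamp_of_one_le {x : ℝ} (hx : 1 ≤ x) : clamp x = 1 := by
  rw [clamp, min_eq_left hx, max_eq_right zero_le_one]

theorem clamp_of_mem {x : ℝ} (h0 : 0 ≤ x) (h1 : x ≤ 1) : clamp x = x := by
  rw [clamp, min_eq_right h1, max_eq_right h0]

theorem clamp_mono : Monotone clamp := fun x y h => by unfold clamp; gcongr

theorem clamp_two_mul (u : ℝ) : clamp (2 * u) + clamp (2 * u - 1) = 2 * clamp u := by
  rcases le_total u 0 with h | h
  · rw [clamp_of_nonpos h, clamp_of_nonpos (by linarith), clamp_of_nonpos (by linarith)]; ring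
  rcases le_total 1 u with h1 | h1
  · rw [clamp_of_one_le h1, clamp_of_one_le (by linarith), clamp_of_one_le (by linarith)]; ring
  rw [clamp_of_mem h h1]
  rcases le_total (2 * u) 1 with h2 | h2
  · rw [clamp_of_mem (by linarith) h2, clamp_of_nonpos (by linarith)]; ring
  · rw [clamp_of_one_le h2, clamp_of_mem (by linarith) (by linarith)]; ring

namespace CadlagPath

/-- The polygonal path started at `0` with increments `d j` on the cells `[j/m, (j+1)/m]`, `j < K`,
and constant after `K/m`. -/
def polygon (m K : ℕ) (d : ℕ → ℝ) : CadlagPath :=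
  ofContinuous (fun t => ∑ j ∈ Finset.range K, d j * clamp (m * t - j))
    (continuous_finsetSum _ fun _ _ => continuous_const.mul (continuous_clamp.comp (by fun_prop)))

theorem polygon_apply (m K : ℕ) (d : ℕ → ℝ) (t : ℝ≥0) :
    polygon m K d t = ∑ j ∈ Finset.range K, d j * clamp (m * t - j) := rfl

theorem continuous_polygon (m K : ℕ) : Continuous (polygon m K) := by
  refine continuous_iff_continuousAt.2 fun d => tendsto_iff.2 fun T ε hε => ?_
  have hc : Continuous fun d' : ℕ → ℝ => ∑ j ∈ Finset.range K, |d' j - d j| := by fun_prop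
  have h0 := hc.tendsto d
  simp only [sub_self, abs_zero, Finset.sum_const_zero] at h0
  filter_upwards [h0.eventually_lt_const hε] with d' hd' t _
  refine lt_of_le_of_lt ?_ hd'
  rw [polygon_apply, polygon_apply, ← Finset.sum_sub_distrib]
  refine (Finset.abs_sum_le_sum_abs _ _).trans (Finset.sum_le_sum fun j _ => ?_)
  rw [← sub_mul, abs_mul, abs_of_nonneg (clamp_nonneg _)]
  exact mul_le_of_le_one_right (abs_nonneg _) (clamp_le_one _)

theorem polygon_congr {m K : ℕ} {d d' : ℕ → ℝ} (h : ∀ j < K, d j = d' j) :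
    polygon m K d = polygon m K d' := by
  have : ∀ t, polygon m K d t = polygon m K d' t := fun t => by
    rw [polygon_apply, polygon_apply]
    exact Finset.sum_congr rfl fun j hj => by rw [h j (Finset.mem_range.1 hj)]
  exact Subtype.ext (funext this)

theorem polygon_apply_of_le {m K L : ℕ} (d : ℕ → ℝ) {t : ℝ≥0} (hKL : K ≤ L)
    (h : (m : ℝ) * t ≤ K) : polygon m L d t = polygon m K d t := by
  rw [polygon_apply, polygon_apply]
  refine (Finset.sum_subset (Finset.range_mono hKL) fun j _ hj => ?_).symm
  have : (K : ℝ) ≤ j := by exact_mod_cast not_lt.1 (Finset.mem_range.not.1 hj)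
  rw [clamp_of_nonpos (by linarith), mul_zero]

theorem polygon_apply_eq {m K : ℕ} (d : ℕ → ℝ) {t : ℝ≥0} {i : ℕ} (hi : i < K)
    (h0 : (i : ℝ) ≤ m * t) (h1 : (m : ℝ) * t ≤ i + 1) :
    polygon m K d t = ∑ j ∈ Finset.range i, d j + (m * t - i) * d i := by
  rw [polygon_apply_of_le (K := i + 1) d hi (by exact_mod_cast h1), polygon_apply,
    Finset.sum_range_succ, clamp_of_mem (by linarith) (by linarith), mul_comm (d i)]
  congr 1
  refine Finset.sum_congr rfl fun j hj => ?_
  have : (j : ℝ) + 1 ≤ i := by exact_mod_cast Finset.mem_range.1 hj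
  rw [clamp_of_one_le (by linarith), mul_one]

/-- On each coarse cell the two polygons differ by half the difference of the two fine increments
times a tent function. The tents live on different cells, and bounding them by differences of
`clamp` makes the sum telescope to at most one. -/
theorem abs_polygon_refine_le {m K : ℕ} {d : ℕ → ℝ} {r : ℝ} (hr : ∀ j < 2 * K, |d j| ≤ r)
    (hr0 : 0 ≤ r) (t : ℝ≥0) :
    |polygon (2 * m) (2 * K) d t - polygon m K (fun j => d (2 * j) + d (2 * j + 1)) t| ≤ r := by
  have hs : ∀ f : ℕ → ℝ, ∑ j ∈ Finset.range (2 * K), f j =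
      ∑ j ∈ Finset.range K, (f (2 * j) + f (2 * j + 1)) := by
    intro f
    induction K with
    | zero => simp
    | succ K ih =>
      rw [show 2 * (K + 1) = 2 * K + 1 + 1 by ring, Finset.sum_range_succ, Finset.sum_range_succ,
        Finset.sum_range_succ, ih fun j hj => hr j (by omega)]
      ring
  rw [polygon_apply, polygon_apply, hs, ← Finset.sum_sub_distrib]
  set x : ℝ := m * t with hx
  have hterm : ∀ j ∈ Finset.range K, |d (2 * j) * clamp (((2 * m : ℕ) : ℝ) * t - ((2 * j : ℕ) : ℝ)) +
      d (2 * j + 1) * clamp (((2 * m : ℕ) : ℝ) * t - ((2 * j + 1 : ℕ) : ℝ)) -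
      (d (2 * j) + d (2 * j + 1)) * clamp (m * t - j)| ≤
      r * (clamp (2 * x - 2 * (j : ℕ)) - clamp (2 * x - 2 * ((j + 1 : ℕ) : ℝ))) := by
    intro j hj
    have hj' := Finset.mem_range.1 hj
    have h1 := hr (2 * j) (by omega)
    have h2 := hr (2 * j + 1) (by omega)
    have h3 := clamp_two_mul (x - j)
    have h4 : clamp (2 * (x - j) - 1) ≤ clamp (2 * (x - j)) := clamp_mono (by linarith)
    have h5 : clamp (2 * (x - j) - 2) ≤ clamp (2 * (x - j) - 1) := clamp_mono (by linarith)
    have e1 : ((2 * m : ℕ) : ℝ) * t - ((2 * j : ℕ) : ℝ) = 2 * (x - j) := by push_cast; ring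
    have e2 : ((2 * m : ℕ) : ℝ) * t - ((2 * j + 1 : ℕ) : ℝ) = 2 * (x - j) - 1 := by push_cast; ring
    have e3 : 2 * x - 2 * (j : ℝ) = 2 * (x - j) := by ring
    have e4 : 2 * x - 2 * ((j + 1 : ℕ) : ℝ) = 2 * (x - j) - 2 := by push_cast; ring
    rw [e1, e2, e3, e4]
    set p := clamp (2 * (x - j))
    set q := clamp (2 * (x - j) - 1)
    have e5 : clamp (x - j) = (p + q) / 2 := by linarith
    rw [e5]
    have e6 : d (2 * j) * p + d (2 * j + 1) * q - (d (2 * j) + d (2 * j + 1)) * ((p + q) / 2) =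
        (d (2 * j) - d (2 * j + 1)) / 2 * (p - q) := by ring
    have h6 : |(d (2 * j) - d (2 * j + 1)) / 2| ≤ r := by
      rw [abs_le] at h1 h2 ⊢
      constructor <;> linarith
    rw [e6, abs_mul, abs_of_nonneg (sub_nonneg.2 h4)]
    calc _ ≤ r * (p - q) := by gcongr
      _ ≤ _ := by gcongr
  refine (Finset.abs_sum_le_sum_abs _ _).trans ((Finset.sum_le_sum hterm).trans ?_)
  rw [← Finset.mul_sum, Finset.sum_range_sub' fun j : ℕ => clamp (2 * x - 2 * (j : ℝ))]
  have h1 := clamp_le_one (2 * x - 2 * ((0 : ℕ) : ℝ))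
  have h2 := clamp_nonneg (2 * x - 2 * (K : ℝ))
  nlinarith

end CadlagPath

/-! ### Brownian motion -/

/-- Chernoff bound followed by `exp x ≥ x² / 2`; only the order `v² / r⁴` of a fourth-moment
inequality is needed. -/
theorem gaussianReal_abs_ge_le (v : ℝ≥0) {r : ℝ} (hr : 0 < r) :
    (gaussianReal 0 v).real {x | r ≤ |x|} ≤ 16 * (v : ℝ) ^ 2 / r ^ 4 := by
  rcases eq_or_ne v 0 with rfl | hv
  · rw [gaussianReal_zero_var, measureReal_def, Measure.dirac_apply]
    simp [hr]
  have hv0 : (0 : ℝ) < v := by exact_mod_cast pos_iff_ne_zero.2 hv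
  have hexp : Real.exp (-(r ^ 2 / (2 * v))) ≤ 8 * (v : ℝ) ^ 2 / r ^ 4 := by
    have h1 := Real.quadratic_le_exp_of_nonneg (x := r ^ 2 / (2 * v)) (by positivity)
    rw [Real.exp_neg]
    have h2 : r ^ 4 / (8 * (v : ℝ) ^ 2) ≤ Real.exp (r ^ 2 / (2 * v)) := by
      refine le_trans ?_ h1
      have : (r ^ 2 / (2 * v)) ^ 2 / 2 = r ^ 4 / (8 * (v : ℝ) ^ 2) := by field_simp; ring
      rw [← this]
      have : 0 ≤ r ^ 2 / (2 * (v : ℝ)) := by positivity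
      linarith
    calc _ ≤ (r ^ 4 / (8 * (v : ℝ) ^ 2))⁻¹ := by gcongr
      _ = _ := by rw [inv_div]
  have hmgf : ∀ t : ℝ, mgf id (gaussianReal 0 v) t = Real.exp (v * t ^ 2 / 2) := by
    intro t
    rw [mgf_id_gaussianReal]
    simp
  have h1 : (gaussianReal 0 v).real {x | r ≤ x} ≤ 8 * (v : ℝ) ^ 2 / r ^ 4 := by
    refine le_trans ?_ hexp
    have := measure_ge_le_exp_mul_mgf (X := id) (μ := gaussianReal 0 v) r (t := r / v)
      (by positivity) (integrable_exp_mul_gaussianReal _)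
    refine this.trans_eq ?_
    rw [hmgf, ← Real.exp_add]
    congr 1
    field_simp
    ring
  have h2 : (gaussianReal 0 v).real {x | x ≤ -r} ≤ 8 * (v : ℝ) ^ 2 / r ^ 4 := by
    refine le_trans ?_ hexp
    have := measure_le_le_exp_mul_mgf (X := id) (μ := gaussianReal 0 v) (-r) (t := -(r / v))
      (by have : 0 < r / v := by positivity
          linarith) (integrable_exp_mul_gaussianReal _)
    refine this.trans_eq ?_
    rw [hmgf, ← Real.exp_add]
    congr 1
    field_simp
    ring
  have h3 : {x : ℝ | r ≤ |x|} ⊆ {x | r ≤ x} ∪ {x | x ≤ -r} := by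
    intro x hx
    rcases le_abs'.1 (show r ≤ |x| from hx) with h | h
    · exact Or.inr h
    · exact Or.inl h
  calc _ ≤ _ := measureReal_mono h3
    _ ≤ _ := measureReal_union_le _ _
    _ ≤ 8 * (v : ℝ) ^ 2 / r ^ 4 + 8 * (v : ℝ) ^ 2 / r ^ 4 := add_le_add h1 h2
    _ = _ := by ring

end

noncomputable section

theorem CadlagPath.continuous_polygon_apply (m K : ℕ) (d : ℕ → ℝ) :
    Continuous (polygon m K d : ℝ≥0 → ℝ) := by
  change Continuous fun t : ℝ≥0 => ∑ j ∈ Finset.range K, d j * clamp (m * t - j)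
  exact continuous_finsetSum _ fun _ _ => continuous_const.mul (continuous_clamp.comp (by fun_prop))

/-- A sequence of continuous paths with geometrically small differences converges. -/
theorem CadlagPath.exists_tendsto_ofContinuous {u : ℕ → CadlagPath}
    (hu : ∀ k, Continuous (u k : ℝ≥0 → ℝ)) {r : ℝ} (hr0 : 0 < r) (hr : r < 1)
    (h : ∀ T : ℕ, ∀ᶠ k in atTop, ∀ t : ℝ≥0, t ≤ T → |u (k + 1) t - u k t| ≤ r ^ k) :
    ∃ (g : ℝ≥0 → ℝ) (hg : Continuous g), Tendsto u atTop (𝓝 (ofContinuous g hg)) := by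
  have hk : ∀ T : ℕ, ∃ k₀, ∀ n, ∀ t : ℝ≥0, t ≤ T →
      dist (u (k₀ + n) t) (u (k₀ + (n + 1)) t) ≤ 1 * r ^ n := by
    intro T
    obtain ⟨k₀, hk₀⟩ := eventually_atTop.1 (h T)
    refine ⟨k₀, fun n t ht => ?_⟩
    rw [dist_comm, Real.dist_eq, one_mul]
    exact (hk₀ (k₀ + n) (by omega) t ht).trans
      (pow_le_pow_of_le_one hr0.le hr.le (by omega))
  choose k₀ hk₀ using hk
  have hlim : ∀ t : ℝ≥0, ∃ y, Tendsto (fun k => u k t) atTop (𝓝 y) := by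
    intro t
    obtain ⟨T, hT⟩ := exists_nat_ge t
    have hc := cauchySeq_of_le_geometric r 1 hr fun n => hk₀ T n t hT
    obtain ⟨y, hy⟩ := cauchySeq_tendsto_of_complete hc
    refine ⟨y, (tendsto_add_atTop_iff_nat (k₀ T)).1 ?_⟩
    simpa only [add_comm] using hy
  choose g hg using hlim
  have hunif : ∀ T : ℕ, ∀ ε > 0, ∀ᶠ k in atTop, ∀ t : ℝ≥0, t ≤ T → |u k t - g t| < ε := by
    intro T ε hε
    have h1 : Tendsto (fun n : ℕ => 1 * r ^ n / (1 - r)) atTop (𝓝 0) := by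
      simpa using ((tendsto_pow_atTop_nhds_zero_of_lt_one hr0.le hr).const_mul 1).div_const (1 - r)
    obtain ⟨N, hN⟩ := eventually_atTop.1 (h1.eventually_lt_const hε)
    refine eventually_atTop.2 ⟨k₀ T + N, fun k hk t ht => ?_⟩
    obtain ⟨n, rfl⟩ := Nat.exists_eq_add_of_le (show k₀ T ≤ k by omega)
    refine lt_of_le_of_lt ?_ (hN n (by omega))
    have hy : Tendsto (fun n => u (k₀ T + n) t) atTop (𝓝 (g t)) := by
      simpa only [add_comm] using (tendsto_add_atTop_iff_nat (k₀ T)).2 (hg t)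
    rw [← Real.dist_eq]
    exact dist_le_of_le_geometric_of_tendsto r 1 hr (fun n => hk₀ T n t ht) hy n
  have hcont : Continuous g := by
    refine continuous_iff_continuousAt.2 fun t => ?_
    obtain ⟨T, hT⟩ := exists_nat_gt t
    have hU : TendstoUniformlyOn (fun k t => u k t) g atTop (Set.Iic (T : ℝ≥0)) := by
      refine Metric.tendstoUniformlyOn_iff.2 fun ε hε => ?_
      filter_upwards [hunif T ε hε] with k hk t ht
      rw [dist_comm, Real.dist_eq]
      exact hk t ht
    exact (hU.continuousOn (Frequently.of_forall fun k => (hu k).continuousOn)).continuousAt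
      (Iic_mem_nhds hT)
  exact ⟨g, hcont, tendsto_iff.2 hunif⟩

section Brownian

variable {Ω : Type*} [MeasurableSpace Ω] {P : Measure Ω} [IsProbabilityMeasure P]
  {B : ℝ≥0 → Ω → ℝ}

/-- The increments of a process on the dyadic grid of mesh `2⁻ᵏ`. -/
def dyadicIncr (B : ℝ≥0 → Ω → ℝ) (k j : ℕ) (ω : Ω) : ℝ :=
  B (((j + 1 : ℕ) : ℝ≥0) / 2 ^ k) ω - B ((j : ℝ≥0) / 2 ^ k) ω

theorem dyadicIncr_refine (B : ℝ≥0 → Ω → ℝ) (k j : ℕ) (ω : Ω) :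
    dyadicIncr B k j ω = dyadicIncr B (k + 1) (2 * j) ω + dyadicIncr B (k + 1) (2 * j + 1) ω := by
  have h : ∀ i : ℕ, ((2 * i : ℕ) : ℝ≥0) / 2 ^ (k + 1) = (i : ℝ≥0) / 2 ^ k := by
    intro i
    rw [pow_succ, Nat.cast_mul, mul_comm, Nat.cast_ofNat, mul_div_mul_right _ _ (by norm_num)]
  unfold dyadicIncr
  rw [show 2 * j + 1 + 1 = 2 * (j + 1) by ring, h, h]
  ring

/-- The polygonal approximations of a process at the dyadic times. -/
def dyadicPolygon (B : ℝ≥0 → Ω → ℝ) (k : ℕ) (ω : Ω) : CadlagPath :=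
  CadlagPath.polygon (2 ^ k) (2 ^ k * k) fun j => dyadicIncr B k j ω

theorem aemeasurable_dyadicIncr (hB : IsPreBrownianReal B P) (k j : ℕ) :
    AEMeasurable (dyadicIncr B k j) P := (hB.aemeasurable _).sub (hB.aemeasurable _)

theorem aemeasurable_dyadicPolygon (hB : IsPreBrownianReal B P) (k : ℕ) :
    AEMeasurable (dyadicPolygon B k) P :=
  (CadlagPath.continuous_polygon _ _).measurable.comp_aemeasurable
    (aemeasurable_pi_lambda _ fun j => aemeasurable_dyadicIncr hB k j)

theorem map_dyadicIncr (hB : IsPreBrownianReal B P) (k j : ℕ) :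
    P.map (dyadicIncr B k j) = gaussianReal 0 (1 / 2 ^ k) := by
  have h := (hB.hasLaw_sub (((j + 1 : ℕ) : ℝ≥0) / 2 ^ k) ((j : ℝ≥0) / 2 ^ k)).map_eq
  have e : nndist (((j + 1 : ℕ) : ℝ≥0) / 2 ^ k).1 ((j : ℝ≥0) / 2 ^ k).1 = 1 / 2 ^ k := by
    ext
    rw [coe_nndist, Real.dist_eq]
    simp only [NNReal.val_eq_coe]
    push_cast
    rw [← sub_div, add_sub_cancel_left, abs_of_nonneg (by positivity)]
  rw [e] at h
  exact h

theorem iIndepFun_dyadicIncr (hB : IsPreBrownianReal B P) (k : ℕ) :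
    iIndepFun (dyadicIncr B k) P :=
  hB.hasIndepIncrements.nat (t := fun j : ℕ => (j : ℝ≥0) / 2 ^ k) fun i j hij => by
    dsimp only; gcongr

theorem measureReal_abs_sub_ge_le (hB : IsPreBrownianReal B P) (s t : ℝ≥0) {r : ℝ} (hr : 0 < r) :
    P.real {ω | r ≤ |B s ω - B t ω|} ≤ 16 * |(s : ℝ) - t| ^ 2 / r ^ 4 := by
  have h := (hB.hasLaw_sub s t).measureReal_eq (p := fun x => r ≤ |x|)
    (measurableSet_le measurable_const measurable_id.abs)
  have h2 := gaussianReal_abs_ge_le (nndist s.1 t.1) hr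
  rw [coe_nndist, Real.dist_eq] at h2
  exact (le_of_eq h).trans h2

/-- The base `9/10` is below one but has fourth power above `1/2`, so the union bound over `2 ^ k *
k` increments is still summable in `k`. -/
theorem measureReal_dyadicIncr_le (hB : IsPreBrownianReal B P) (k : ℕ) :
    P.real (⋃ j ∈ Finset.range (2 ^ k * k), {ω | (9 / 10 : ℝ) ^ k ≤ |dyadicIncr B k j ω|}) ≤
      16 * ((k : ℝ) ^ 1 * (5000 / 6561 : ℝ) ^ k) := by
  have h2 : ∀ j, P.real {ω | (9 / 10 : ℝ) ^ k ≤ |dyadicIncr B k j ω|} ≤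
      16 * (1 / 2 ^ k : ℝ) ^ 2 / ((9 / 10 : ℝ) ^ k) ^ 4 := by
    intro j
    have h1 := measureReal_abs_sub_ge_le hB (((j + 1 : ℕ) : ℝ≥0) / 2 ^ k)
      ((j : ℝ≥0) / 2 ^ k) (r := (9 / 10 : ℝ) ^ k) (by positivity)
    have e : |((((j + 1 : ℕ) : ℝ≥0) / 2 ^ k : ℝ≥0) : ℝ) - (((j : ℝ≥0) / 2 ^ k : ℝ≥0) : ℝ)| =
        1 / 2 ^ k := by
      push_cast
      rw [← sub_div, add_sub_cancel_left, abs_of_nonneg (by positivity)]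
    rw [e] at h1
    exact h1
  refine (measureReal_biUnion_finset_le _ _).trans ((Finset.sum_le_sum fun j _ => h2 j).trans ?_)
  have e : (5000 / 6561 : ℝ) ^ k = (2 ^ k)⁻¹ / ((9 / 10) ^ 4) ^ k := by
    rw [← inv_pow, ← div_pow]; norm_num
  rw [Finset.sum_const, Finset.card_range, nsmul_eq_mul, ← pow_mul, mul_comm k 4, pow_mul, e]
  generalize ((9 / 10 : ℝ) ^ 4) ^ k = y
  push_cast
  refine le_of_eq ?_
  have h3 : (2 : ℝ) ^ k ≠ 0 := by positivity
  rw [one_div, pow_one]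
  calc _ = (2 ^ k * (2 ^ k : ℝ)⁻¹) * (16 * (k * ((2 ^ k)⁻¹ / y))) := by ring
    _ = _ := by rw [mul_inv_cancel₀ h3, one_mul]

theorem ae_eventually_dyadicIncr_lt (hB : IsPreBrownianReal B P) :
    ∀ᵐ ω ∂P, ∀ᶠ k in atTop, ∀ j < 2 ^ k * k, |dyadicIncr B k j ω| < (9 / 10) ^ k := by
  have hsum : Summable fun k : ℕ => 16 * ((k : ℝ) ^ 1 * (5000 / 6561 : ℝ) ^ k) :=
    (summable_pow_mul_geometric_of_norm_lt_one (R := ℝ) 1 (r := 5000 / 6561) (by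
      rw [Real.norm_eq_abs, abs_of_nonneg] <;> norm_num)).mul_left 16
  have hfin : ∑' k : ℕ, P (⋃ j ∈ Finset.range (2 ^ k * k),
      {ω | (9 / 10 : ℝ) ^ k ≤ |dyadicIncr B k j ω|}) ≠ ⊤ := by
    refine ne_top_of_le_ne_top hsum.tsum_ofReal_ne_top (ENNReal.tsum_le_tsum fun k => ?_)
    rw [← ofReal_measureReal (measure_ne_top _ _)]
    exact ENNReal.ofReal_le_ofReal (measureReal_dyadicIncr_le hB k)
  filter_upwards [ae_eventually_notMem hfin] with ω hω
  filter_upwards [hω] with k hk j hj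
  by_contra hc
  refine hk (Set.mem_iUnion₂.2 ⟨j, Finset.mem_range.2 hj, ?_⟩)
  exact not_lt.1 hc

/-- Since the horizon of the `k`-th polygon is `k`, every `[0, T]` is eventually covered. There
consecutive polygons differ by at most the largest increment of the finer one, which is
geometrically small. -/
theorem ae_exists_tendsto_dyadicPolygon (hB : IsPreBrownianReal B P) :
    ∀ᵐ ω ∂P, ∃ (g : ℝ≥0 → ℝ) (hg : Continuous g),
      Tendsto (fun k => dyadicPolygon B k ω) atTop (𝓝 (CadlagPath.ofContinuous g hg)) := by
  filter_upwards [ae_eventually_dyadicIncr_lt hB] with ω hω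
  refine CadlagPath.exists_tendsto_ofContinuous
    (fun k => CadlagPath.continuous_polygon_apply _ _ _) (r := 9 / 10) (by norm_num) (by norm_num)
    fun T => ?_
  filter_upwards [(tendsto_add_atTop_nat 1).eventually hω, eventually_ge_atTop T] with k hk hT t ht
  have ht' : (t : ℝ) ≤ T := by exact_mod_cast ht
  have h1 : dyadicPolygon B (k + 1) ω t = CadlagPath.polygon (2 * 2 ^ k) (2 * (2 ^ k * T))
      (fun j => dyadicIncr B (k + 1) j ω) t := by
    unfold dyadicPolygon
    rw [CadlagPath.polygon_apply_of_le (K := 2 ^ (k + 1) * T) _ (by gcongr; omega) (by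
      push_cast; gcongr), pow_succ]
    ring_nf
  have h2 : dyadicPolygon B k ω t = CadlagPath.polygon (2 ^ k) (2 ^ k * T)
      (fun j => dyadicIncr B (k + 1) (2 * j) ω + dyadicIncr B (k + 1) (2 * j + 1) ω) t := by
    unfold dyadicPolygon
    rw [CadlagPath.polygon_apply_of_le (K := 2 ^ k * T) _ (by gcongr) (by push_cast; gcongr)]
    simp_rw [← dyadicIncr_refine]
  rw [h1, h2]
  refine (CadlagPath.abs_polygon_refine_le (r := (9 / 10) ^ (k + 1)) (fun j hj => (hk j ?_).le)
    (by positivity) t).trans (pow_le_pow_of_le_one (by norm_num) (by norm_num) (by omega))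
  refine hj.trans_le ?_
  calc 2 * (2 ^ k * T) = 2 ^ (k + 1) * T := by ring
    _ ≤ 2 ^ (k + 1) * (k + 1) := by gcongr; omega

open Classical in
/-- The limit of the dyadic polygonal approximations of a process. -/
def dyadicLimit (B : ℝ≥0 → Ω → ℝ) (ω : Ω) : CadlagPath :=
  if h : ∃ (g : ℝ≥0 → ℝ) (hg : Continuous g),
      Tendsto (fun k => dyadicPolygon B k ω) atTop (𝓝 (CadlagPath.ofContinuous g hg))
  then CadlagPath.ofContinuous h.choose h.choose_spec.choose
  else CadlagPath.ofContinuous 0 continuous_const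

theorem continuous_dyadicLimit (B : ℝ≥0 → Ω → ℝ) (ω : Ω) :
    Continuous (dyadicLimit B ω : ℝ≥0 → ℝ) := by
  unfold dyadicLimit
  split_ifs with h
  · exact h.choose_spec.choose
  · exact continuous_const

theorem ae_tendsto_dyadicPolygon (hB : IsPreBrownianReal B P) :
    ∀ᵐ ω ∂P, Tendsto (fun k => dyadicPolygon B k ω) atTop (𝓝 (dyadicLimit B ω)) := by
  filter_upwards [ae_exists_tendsto_dyadicPolygon hB] with ω h
  rw [dyadicLimit, dif_pos h]
  exact h.choose_spec.choose_spec

theorem aemeasurable_dyadicLimit (hB : IsPreBrownianReal B P) :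
    AEMeasurable (dyadicLimit B) P :=
  aemeasurable_of_tendsto_metrizable_ae atTop (aemeasurable_dyadicPolygon hB)
    (ae_tendsto_dyadicPolygon hB)

/-- At the dyadic point `τ k` below `t` the polygon equals `B (τ k)`, because `B 0 = 0` almost
surely. As `τ k → t`, `B (τ k)` tends to `B t` in measure, and to the continuous limit path at `t`
almost surely. -/
theorem ae_eq_dyadicLimit (hB : IsPreBrownianReal B P) (t : ℝ≥0) :
    B t =ᵐ[P] fun ω => dyadicLimit B ω t := by
  let i : ℕ → ℕ := fun k => ⌊(2 : ℝ≥0) ^ k * t⌋₊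
  let τ : ℕ → ℝ≥0 := fun k => (i k : ℝ≥0) / 2 ^ k
  have hτ : ∀ k, τ k ≤ t := fun k =>
    (div_le_iff₀' (by positivity)).2 (Nat.floor_le zero_le)
  have hτ' : ∀ k, |(τ k : ℝ) - t| ≤ (1 / 2) ^ k := by
    intro k
    have h1 : (τ k : ℝ) ≤ t := hτ k
    have h2 : (2 : ℝ) ^ k * t < i k + 1 := by
      have := Nat.lt_floor_add_one ((2 : ℝ≥0) ^ k * t)
      have h' : ((2 ^ k * t : ℝ≥0) : ℝ) < ((i k + 1 : ℝ≥0) : ℝ) := NNReal.coe_lt_coe.2 this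
      push_cast at h'
      exact h'
    have h3 : (τ k : ℝ) = i k / 2 ^ k := by simp [τ]
    rw [abs_sub_comm, abs_of_nonneg (sub_nonneg.2 h1), h3, one_div, inv_pow, ← one_div]
    rw [sub_le_iff_le_add, ← add_div, le_div_iff₀' (by positivity)]
    linarith
  have hgeo : Tendsto (fun k : ℕ => (1 / 2 : ℝ) ^ k) atTop (𝓝 0) :=
    tendsto_pow_atTop_nhds_zero_of_lt_one (by norm_num) (by norm_num)
  have hτt : Tendsto τ atTop (𝓝 t) := by
    rw [← NNReal.tendsto_coe, tendsto_iff_norm_sub_tendsto_zero]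
    exact squeeze_zero (fun _ => norm_nonneg _) hτ' hgeo
  have h1 : TendstoInMeasure P (fun k => B (τ k)) atTop (B t) := by
    rw [tendstoInMeasure_iff_measureReal_dist]
    intro ε hε
    have h2 : Tendsto (fun k : ℕ => 16 * ((1 / 2 : ℝ) ^ k) ^ 2 / ε ^ 4) atTop (𝓝 0) := by
      simpa using ((hgeo.pow 2).const_mul 16).div_const (ε ^ 4)
    refine squeeze_zero (fun _ => measureReal_nonneg) (fun k => ?_) h2
    simp_rw [Real.dist_eq]
    refine (measureReal_abs_sub_ge_le hB _ _ hε).trans ?_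
    gcongr
    exact hτ' k
  have h2 : TendstoInMeasure P (fun k => B (τ k)) atTop (fun ω => dyadicLimit B ω t) := by
    refine tendstoInMeasure_of_tendsto_ae (fun k => (hB.aemeasurable _).aestronglyMeasurable) ?_
    filter_upwards [ae_tendsto_dyadicPolygon hB, hB.eval_zero_ae_eq_zero] with ω hω h0
    obtain ⟨T, hT⟩ := exists_nat_gt t
    have h3 : ∀ᶠ k in atTop, B (τ k) ω = dyadicPolygon B k ω (τ k) := by
      filter_upwards [eventually_ge_atTop T] with k hk
      have hik : i k < 2 ^ k * k := by
        refine (Nat.floor_lt zero_le).2 ?_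
        push_cast
        gcongr
        exact hT.trans_le (by exact_mod_cast hk)
      have e : ((2 ^ k : ℕ) : ℝ) * (τ k : ℝ) = i k := by
        simp only [τ]
        push_cast
        field_simp
      unfold dyadicPolygon
      rw [CadlagPath.polygon_apply_eq _ hik e.ge (by rw [e]; linarith), e, sub_self, zero_mul,
        add_zero]
      unfold dyadicIncr
      rw [Finset.sum_range_sub fun j : ℕ => B ((j : ℝ≥0) / 2 ^ k) ω, Nat.cast_zero, zero_div, h0,
        sub_zero]
    refine Tendsto.congr' (h3.mono fun k hk => hk.symm) ?_
    rw [Metric.tendsto_nhds]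
    intro ε hε
    have h4 := ((continuous_dyadicLimit B ω).tendsto t).comp hτt
    filter_upwards [CadlagPath.tendsto_iff.1 hω T (ε / 2) (by positivity),
      Metric.tendsto_nhds.1 h4 (ε / 2) (by positivity)] with k h5 h6
    have h7 := h5 (τ k) ((hτ k).trans hT.le)
    rw [← Real.dist_eq] at h7
    calc _ ≤ _ := dist_triangle _ (dyadicLimit B ω (τ k)) _
      _ < ε / 2 + ε / 2 := add_lt_add h7 h6
      _ = ε := by ring
  exact tendstoInMeasure_ae_unique h1 h2

theorem isBrownianReal_dyadicLimit (hB : IsPreBrownianReal B P) :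
    IsBrownianReal (fun t ω => dyadicLimit B ω t) P where
  toIsPreBrownianReal := hB.congr (ae_eq_dyadicLimit hB)
  cont := ae_of_all _ (continuous_dyadicLimit B)

end Brownian

end

noncomputable section

/-! ### The functional central limit theorem along a regular path -/

namespace CadlagPath

theorem scale_polygon (A : ℝ) (m K : ℕ) (d : ℕ → ℝ) :
    scale A (polygon m K d) = polygon m K fun j => A * d j := by
  have : ∀ t, scale A (polygon m K d) t = polygon m K (fun j => A * d j) t := fun t => by
    change A * polygon m K d t = _
    rw [polygon_apply, polygon_apply, Finset.mul_sum]
    exact Finset.sum_congr rfl fun j _ => by ring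
  exact Subtype.ext (funext this)

end CadlagPath

/-- The extension by zero of a vector to a sequence. -/
def vecSeq {K : ℕ} (y : EuclideanSpace ℝ (Fin K)) (j : ℕ) : ℝ := if h : j < K then y ⟨j, h⟩ else 0

theorem vecSeq_coe {K : ℕ} (y : EuclideanSpace ℝ (Fin K)) (j : Fin K) :
    vecSeq y j = y j := by
  rw [vecSeq, dif_pos j.2]

theorem continuous_vecSeq (K : ℕ) :
    Continuous (vecSeq : EuclideanSpace ℝ (Fin K) → ℕ → ℝ) := by
  refine continuous_pi fun j => ?_
  unfold vecSeq
  by_cases h : j < K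
  · simp only [h, dif_pos]; fun_prop
  · simp only [h, dif_neg, not_false_iff]; fun_prop

section FirstVectors

variable {E : Type*} [MeasurableSpace E] {μ : Measure E} [IsProbabilityMeasure μ]

/-- The vector of the first `K` terms of a sequence. -/
def firstVec (K : ℕ) (Z : ℕ → E → ℝ) (x : E) : EuclideanSpace ℝ (Fin K) :=
  WithLp.toLp 2 fun j : Fin K => Z j x

theorem aemeasurable_firstVec (K : ℕ) {Z : ℕ → E → ℝ} (hZ : ∀ j, AEMeasurable (Z j) μ) :
    AEMeasurable (firstVec K Z) μ :=
  (WithLp.measurable_toLp 2 (Fin K → ℝ)).comp_aemeasurable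
    (aemeasurable_pi_lambda _ fun j => hZ j)

/-- The Cramér–Wold device: joint convergence reduces to scalar linear combinations. -/
theorem charFun_firstVec (K : ℕ) {Z : ℕ → E → ℝ} (hZ : ∀ j, AEMeasurable (Z j) μ)
    (y : EuclideanSpace ℝ (Fin K)) :
    charFun (μ.map (firstVec K Z)) y =
      charFun (μ.map fun x => ∑ j ∈ Finset.range K, vecSeq y j * Z j x) 1 := by
  have h1 : AEMeasurable (fun x => ∑ j ∈ Finset.range K, vecSeq y j * Z j x) μ :=
    Finset.aemeasurable_fun_sum _ fun j _ => (hZ j).const_mul _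
  rw [charFun_apply, charFun_apply_real, integral_map (aemeasurable_firstVec K hZ) (by fun_prop),
    integral_map h1 (by fun_prop)]
  congr 1
  ext x
  congr 2
  rw [Complex.ofReal_one, one_mul, ← Fin.sum_univ_eq_sum_range (fun j => vecSeq y j * Z j x) K]
  congr 1
  simp [firstVec, PiLp.inner_apply, vecSeq_coe]

theorem charFun_firstVec_gaussian (K : ℕ) {D : ℕ → E → ℝ} (hD : ∀ j, AEMeasurable (D j) μ)
    {v : ℝ≥0} (hlaw : ∀ j, μ.map (D j) = gaussianReal 0 v) (hind : iIndepFun D μ) (b : ℝ)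
    (y : EuclideanSpace ℝ (Fin K)) :
    charFun (μ.map (firstVec K fun j x => b * D j x)) y =
      Complex.exp (-((∑ j ∈ Finset.range K, vecSeq y j ^ 2) * b ^ 2 * v / 2 : ℝ)) := by
  rw [charFun_firstVec K fun j => (hD j).const_mul b]
  simp_rw [← mul_assoc]
  have h1 : iIndepFun (fun j x => vecSeq y j * b * D j x) μ :=
    hind.comp (fun j x => vecSeq y j * b * x) fun j => measurable_const_mul _
  rw [(h1.restrict (Finset.range K)).charFun_map_fun_finsetSum_eq_prod
    (fun j _ => (hD j).const_mul _), Finset.prod_apply]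
  rw [Finset.sum_mul, Finset.sum_mul, Finset.sum_div, Complex.ofReal_sum,
    ← Finset.sum_neg_distrib, Complex.exp_sum]
  refine Finset.prod_congr rfl fun j _ => ?_
  rw [charFun_map_mul_comp (hD j), hlaw j, charFun_gaussianReal]
  congr 1
  push_cast
  ring

/-- Weak convergence of the vectors of first terms implies that of the polygonal paths. -/
theorem tendsto_integral_polygon {E' : Type*} [MeasurableSpace E'] {ν : Measure E'}
    [IsProbabilityMeasure ν] {Z : ℕ → ℕ → E → ℝ} (hZ : ∀ n j, AEMeasurable (Z n j) μ)
    {D : ℕ → E' → ℝ} (hD : ∀ j, AEMeasurable (D j) ν) (m K : ℕ)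
    (h : ∀ y, Tendsto (fun n => charFun (μ.map (firstVec K (Z n))) y) atTop
      (𝓝 (charFun (ν.map (firstVec K D)) y)))
    {F : CadlagPath → ℝ} (hF : Continuous F) (hb : ∃ C, ∀ f, |F f| ≤ C) :
    Tendsto (fun n => ∫ x, F (CadlagPath.polygon m K fun j => Z n j x) ∂μ) atTop
      (𝓝 (∫ x, F (CadlagPath.polygon m K fun j => D j x) ∂ν)) := by
  obtain ⟨C, hC⟩ := hb
  let ρ : ℕ → ProbabilityMeasure (EuclideanSpace ℝ (Fin K)) := fun n =>
    ⟨μ.map (firstVec K (Z n)), Measure.isProbabilityMeasure_map (aemeasurable_firstVec K (hZ n))⟩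
  let ρ₀ : ProbabilityMeasure (EuclideanSpace ℝ (Fin K)) :=
    ⟨ν.map (firstVec K D), Measure.isProbabilityMeasure_map (aemeasurable_firstVec K hD)⟩
  have h1 : Tendsto ρ atTop (𝓝 ρ₀) := ProbabilityMeasure.tendsto_iff_tendsto_charFun.2 h
  have hc : Continuous fun y : EuclideanSpace ℝ (Fin K) =>
      F (CadlagPath.polygon m K (vecSeq y)) :=
    hF.comp ((CadlagPath.continuous_polygon m K).comp (continuous_vecSeq K))
  let G : BoundedContinuousFunction (EuclideanSpace ℝ (Fin K)) ℝ :=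
    BoundedContinuousFunction.ofNormedAddCommGroup _ hc C fun y => hC _
  have h2 := ProbabilityMeasure.tendsto_iff_forall_integral_tendsto.1 h1 G
  have e : ∀ {E'' : Type _} (Z : ℕ → E'' → ℝ) (x : E''),
      G (firstVec K Z x) = F (CadlagPath.polygon m K fun j => Z j x) := by
    intro E'' Z x
    change F (CadlagPath.polygon m K (vecSeq (firstVec K Z x))) = _
    congr 1
    refine CadlagPath.polygon_congr fun j hj => ?_
    rw [vecSeq, dif_pos hj]
    rfl
  have e1 : ∀ n, ∫ y, G y ∂(ρ n : Measure (EuclideanSpace ℝ (Fin K))) =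
      ∫ x, F (CadlagPath.polygon m K fun j => Z n j x) ∂μ := by
    intro n
    refine (integral_map (aemeasurable_firstVec K (hZ n))
      G.continuous.aestronglyMeasurable).trans ?_
    exact integral_congr_ae (ae_of_all _ fun x => e (Z n) x)
  have e2 : ∫ y, G y ∂(ρ₀ : Measure (EuclideanSpace ℝ (Fin K))) =
      ∫ x, F (CadlagPath.polygon m K fun j => D j x) ∂ν := by
    refine (integral_map (aemeasurable_firstVec K hD) G.continuous.aestronglyMeasurable).trans ?_
    refine integral_congr_ae (ae_of_all _ fun x => ?_)
    change F (CadlagPath.polygon m K (vecSeq (firstVec K D x))) = _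
    congr 1
    refine CadlagPath.polygon_congr fun j hj => ?_
    rw [vecSeq, dif_pos hj]
    rfl
  rw [e2] at h2
  exact h2.congr e1

end FirstVectors

section Path

variable {E : Type*} [MeasurableSpace E] {μ : Measure E} [IsProbabilityMeasure μ]
  {X : ZSq → E → ℝ} {z : ℕ → ZSq} {c : ℝ}

/-- The normalized increments of the sums along a path on a grid. -/
def gridIncr (X : ZSq → E → ℝ) (z : ℕ → ZSq) (m n j : ℕ) (x : E) : ℝ :=
  segSum X z (grid m n j) (grid m n (j + 1)) x / scl n

theorem sum_gridIncr (X : ZSq → E → ℝ) (z : ℕ → ZSq) (m n i : ℕ) (x : E) :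
    ∑ j ∈ Finset.range i, gridIncr X z m n j x = segSum X z 0 (grid m n i) x / scl n := by
  induction i with
  | zero => simp [grid_zero, segSum]
  | succ i ih =>
    rw [Finset.sum_range_succ, ih, gridIncr, ← add_div,
      segSum_add X z (Nat.zero_le _) (grid_mono m n (Nat.le_succ i))]

/-- On the cell containing `t` both paths are within `ε` of the common value at its left end. The
horizon `T + 1` ensures that the cell of `t = T` is among those controlled. -/
theorem abs_sub_polygon_lt {m n K T : ℕ} (hm : 0 < m) (hn : 2 ≤ n) {ε : ℝ}
    (hK : m * (T + 1) ≤ K) {x : E} (hx : x ∉ oscEvent X z m n (m * (T + 1)) (ε * scl n))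
    {t : ℝ≥0} (ht : t ≤ T) :
    |sumAlong X z ⌊(n : ℝ≥0) * t⌋₊ x / scl n -
      CadlagPath.polygon m K (fun j => gridIncr X z m n j x) t| < 2 * ε := by
  have hs := scl_pos hn
  have hm' : (0 : ℝ) < m := by exact_mod_cast hm
  have ht' : (t : ℝ) ≤ T := by exact_mod_cast ht
  set i := ⌊(m : ℝ) * t⌋₊ with hi
  set k := ⌊(n : ℝ≥0) * t⌋₊ with hk
  have hk' : k = ⌊(n : ℝ) * t⌋₊ := by
    have h := Nonneg.nat_floor_coe (α := ℝ) ((n : ℝ≥0) * t)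
    rw [hk]
    exact h.symm
  have h0 : (i : ℝ) ≤ m * t := Nat.floor_le (by positivity)
  have h1 : (m : ℝ) * t < i + 1 := Nat.lt_floor_add_one _
  have hiT : i < m * (T + 1) := by
    have : (i : ℝ) < m * (T + 1) := by nlinarith
    exact_mod_cast this
  have hg0 : grid m n i ≤ k := by
    rw [hk', grid]
    refine Nat.floor_le_floor ?_
    gcongr
    rw [div_le_iff₀ hm']
    linarith
  have hg1 : k ≤ grid m n (i + 1) := by
    rw [hk', grid]
    refine Nat.floor_le_floor ?_
    gcongr
    rw [le_div_iff₀ hm']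
    push_cast
    linarith
  have hosc : ∀ l, grid m n i ≤ l → l ≤ grid m n (i + 1) →
      |segSum X z (grid m n i) l x / scl n| < ε := by
    intro l hl0 hl1
    rw [abs_div, abs_of_pos hs, div_lt_iff₀ hs]
    by_contra hc
    refine hx (Set.mem_iUnion₂.2 ⟨i, Finset.mem_range.2 hiT, l, Finset.mem_Icc.2 ⟨hl0, hl1⟩, ?_⟩)
    exact not_lt.1 hc
  have hsum : sumAlong X z k x = segSum X z 0 (grid m n i) x + segSum X z (grid m n i) k x := by
    rw [segSum_add X z (Nat.zero_le _) hg0, segSum, sumAlong, Finset.range_eq_Ico]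
  rw [CadlagPath.polygon_apply_eq _ (hiT.trans_le hK) h0 h1.le, sum_gridIncr, hsum, add_div]
  have h2 := hosc k hg0 hg1
  have h3 := hosc _ (grid_mono m n (Nat.le_succ i)) le_rfl
  have e : segSum X z 0 (grid m n i) x / scl n + segSum X z (grid m n i) k x / scl n -
      (segSum X z 0 (grid m n i) x / scl n + (m * t - i) * gridIncr X z m n i x) =
      segSum X z (grid m n i) k x / scl n - (m * t - i) * gridIncr X z m n i x := by ring
  rw [e]
  have h4 : |(m * t - i) * gridIncr X z m n i x| ≤ |gridIncr X z m n i x| := by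
    rw [abs_mul, abs_of_nonneg (sub_nonneg.2 h0)]
    exact mul_le_of_le_one_left (abs_nonneg _) (by linarith)
  have h5 : |gridIncr X z m n i x| < ε := h3
  have h6 := abs_sub (segSum X z (grid m n i) k x / scl n) ((m * t - i) * gridIncr X z m n i x)
  linarith

namespace IsIIDField

theorem aemeasurable_normalizedSum (h : IsIIDField μ X) {a : ZSq → ℝ} (z : ℕ → ZSq) (n : ℕ) :
    AEMeasurable (normalizedSum (movingAverage a X) z n) μ :=
  (CadlagPath.continuous_step n).measurable.comp_aemeasurable
    (aemeasurable_pi_lambda _ fun k => (h.aemeasurable_sumAlong z k).div_const _)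

theorem aemeasurable_gridIncr (h : IsIIDField μ X) (z : ℕ → ZSq) (m n j : ℕ) :
    AEMeasurable (gridIncr X z m n j) μ :=
  ((h.measurable_segSum z _ _).div_const _).aemeasurable

/-- Both limits are centered Gaussian with independent components of variance `A² c / m`. -/
theorem tendsto_charFun_gridIncr (h : IsIIDField μ X) (hz : IsRegularPath z c) (hc : 0 ≤ c)
    {m : ℕ} (hm : 0 < m) (A : ℝ) (K : ℕ) {Ω : Type*} [MeasurableSpace Ω] {P : Measure Ω}
    [IsProbabilityMeasure P] {D : ℕ → Ω → ℝ} (hD : ∀ j, AEMeasurable (D j) P)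
    (hlaw : ∀ j, P.map (D j) = gaussianReal 0 (1 / m)) (hind : iIndepFun D P)
    (y : EuclideanSpace ℝ (Fin K)) :
    Tendsto (fun n => charFun (μ.map (firstVec K fun j x => A * gridIncr X z m n j x)) y) atTop
      (𝓝 (charFun (P.map (firstVec K fun j ω => √(|A| ^ 2 * c) * D j ω)) y)) := by
  rw [charFun_firstVec_gaussian K hD hlaw hind, Real.sq_sqrt (by positivity)]
  have h1 := h.tendsto_charFun_blocks hz hm K (fun j => vecSeq y j * A) 1
  have e : (∑ j ∈ Finset.range K, (vecSeq y j * A) ^ 2) * (c / m) * 1 ^ 2 / 2 =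
      (∑ j ∈ Finset.range K, vecSeq y j ^ 2) * (|A| ^ 2 * c) * ((1 / m : ℝ≥0) : ℝ) / 2 := by
    simp_rw [mul_pow]
    rw [← Finset.sum_mul, sq_abs]
    push_cast
    ring
  rw [e] at h1
  refine h1.congr fun n => ?_
  rw [charFun_firstVec K fun j => (h.aemeasurable_gridIncr z m n j).const_mul A]
  simp_rw [← mul_assoc]
  rfl

variable {a : ZSq → ℝ}

/-- Off two rare events, oscillation on the grid and deviation of the moving average from the
rescaled field, the path is uniformly close on `[0, T]` to a multiple of the polygon. Uniform
continuity of `F` involves only such a `T`. -/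
theorem eventually_integral_normalizedSum_sub_le (h : IsIIDField μ X) (hz : IsRegularPath z c)
    (ha : Summable fun q => |a q|) {F : CadlagPath → ℝ} (hF : CadlagPath.IsUniform F) {C : ℝ}
    (hC : ∀ f, |F f| ≤ C) {ε : ℝ} (hε : 0 < ε) :
    ∃ M, ∀ m ≥ M, 0 < m ∧ ∀ L ≥ M, ∀ᶠ n in atTop,
      |∫ x, F (normalizedSum (movingAverage a X) z n x) ∂μ -
        ∫ x, F (CadlagPath.polygon m (m * L) fun j => (∑' q, a q) * gridIncr X z m n j x) ∂μ| ≤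
        ε := by
  set A := ∑' q, a q with hA
  have hC0 : 0 ≤ C := (abs_nonneg _).trans (hC (CadlagPath.ofContinuous 0 continuous_const))
  obtain ⟨T, δ, hδ, hFδ⟩ := hF (ε / 2) (by positivity)
  -- Each rare event costs at most `2 C` times this probability, together at most `ε / 2`. The
  -- distance `δ` is shared equally by the polygonal and the moving average errors.
  have hη : 0 < ε / (8 * (C + 1)) := by positivity
  have hε' : 0 < δ / (4 * (|A| + 1)) := by positivity
  obtain ⟨M, hM⟩ := h.exists_oscEvent_le hz (T + 1) hε' hη
  refine ⟨max M (T + 1), fun m hm => ?_⟩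
  obtain ⟨hm0, hosc⟩ := hM m ((le_max_left _ _).trans hm)
  refine ⟨hm0, fun L hL => ?_⟩
  have hTL : T + 1 ≤ L := (le_max_right _ _).trans hL
  have havg := h.tendsto_movingAverage_sub hz ha (T := T + 1) (by omega)
    (show 0 < δ / 2 by positivity)
  filter_upwards [hosc, havg.eventually_lt_const hη, eventually_ge_atTop 2] with n h1 h2 hn
  have hs := scl_pos hn
  set S₁ := oscEvent X z m n (m * (T + 1)) (δ / (4 * (|A| + 1)) * scl n) with hS₁
  set S₂ := {x | ∃ k ≤ n * (T + 1), δ / 2 * scl n ≤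
    |sumAlong (movingAverage a X) z k x - A * sumAlong X z k x|} with hS₂
  have hFc := hF.continuous.measurable
  have h3 := abs_integral_sub_integral_le (μ := μ) (B := C) (ε := ε / 2)
    (f := fun x => F (normalizedSum (movingAverage a X) z n x))
    (g := fun x => F (CadlagPath.polygon m (m * L) fun j => A * gridIncr X z m n j x))
    (hFc.comp_aemeasurable (h.aemeasurable_normalizedSum z n)).aestronglyMeasurable
    (hFc.comp_aemeasurable ((CadlagPath.continuous_polygon m (m * L)).measurable.comp_aemeasurable
      (aemeasurable_pi_lambda _ fun j =>
        (h.aemeasurable_gridIncr z m n j).const_mul A))).aestronglyMeasurable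
    (fun x => hC _) (fun x => hC _) (by positivity) (S₁ ∪ S₂) (ae_of_all _ fun x hx => ?_)
  · refine h3.trans ?_
    have h4 : μ.real (S₁ ∪ S₂) ≤ ε / (8 * (C + 1)) + ε / (8 * (C + 1)) :=
      (measureReal_union_le _ _).trans (add_le_add h1 h2.le)
    have h5 : 2 * C * μ.real (S₁ ∪ S₂) ≤ 2 * (C + 1) * (ε / (8 * (C + 1)) + ε / (8 * (C + 1))) := by
      gcongr
      linarith
    have h6 : 2 * (C + 1) * (ε / (8 * (C + 1)) + ε / (8 * (C + 1))) = ε / 2 := by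
      have : C + 1 ≠ 0 := by positivity
      field_simp
      ring
    linarith
  · rw [Set.mem_union, not_or] at hx
    refine (hFδ _ _ fun t ht => ?_).le
    rw [← CadlagPath.scale_polygon]
    change |sumAlong (movingAverage a X) z ⌊(n : ℝ≥0) * t⌋₊ x / scl n -
      A * CadlagPath.polygon m (m * L) (fun j => gridIncr X z m n j x) t| < δ
    have h4 := abs_sub_polygon_lt hm0 hn (Nat.mul_le_mul_left m hTL) hx.1 ht
    set p := CadlagPath.polygon m (m * L) (fun j => gridIncr X z m n j x) t
    set k := ⌊(n : ℝ≥0) * t⌋₊ with hk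
    have hkn : k ≤ n * (T + 1) := by
      refine Nat.floor_le_of_le ?_
      push_cast
      gcongr
      exact ht.trans (by simp)
    have h5 : |sumAlong (movingAverage a X) z k x - A * sumAlong X z k x| < δ / 2 * scl n := by
      by_contra hc
      exact hx.2 ⟨k, hkn, not_lt.1 hc⟩
    have h6 : |(sumAlong (movingAverage a X) z k x - A * sumAlong X z k x) / scl n| < δ / 2 := by
      rwa [abs_div, abs_of_pos hs, div_lt_iff₀ hs]
    have h7 : |A * (sumAlong X z k x / scl n - p)| ≤ δ / 2 := by
      rw [abs_mul]
      calc |A| * |sumAlong X z k x / scl n - p| ≤ (|A| + 1) * (2 * (δ / (4 * (|A| + 1)))) := by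
            gcongr
            linarith
        _ = δ / 2 := by
            have : |A| + 1 ≠ 0 := by positivity
            field_simp
            ring
    have e : sumAlong (movingAverage a X) z k x / scl n - A * p =
        (sumAlong (movingAverage a X) z k x - A * sumAlong X z k x) / scl n +
          A * (sumAlong X z k x / scl n - p) := by ring
    rw [e]
    have h8 := abs_add_le ((sumAlong (movingAverage a X) z k x - A * sumAlong X z k x) / scl n)
      (A * (sumAlong X z k x / scl n - p))
    linarith

/-- The functional central limit theorem for moving averages along a regular path. -/
theorem satisfiesFCLT (h : IsIIDField μ X) (hz : IsRegularPath z c) (hc : 0 ≤ c)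
    (ha : Summable fun q => |a q|) :
    SatisfiesFCLT μ (normalizedSum (movingAverage a X) z) (|∑' q, a q| ^ 2 * c) := by
  obtain ⟨Ω, _, P, _, B, hB⟩ := exists_isPreBrownianReal
  set A := ∑' q, a q with hA
  set b := √(|A| ^ 2 * c) with hb
  have hscale : Measurable (CadlagPath.scale b) := (CadlagPath.continuous_scale b).measurable
  have hW : AEMeasurable (fun ω => (dyadicLimit B ω).scale b) P :=
    hscale.comp_aemeasurable (aemeasurable_dyadicLimit hB)
  refine ⟨Ω, _, P, inferInstance, dyadicLimit B, isBrownianReal_dyadicLimit hB,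
    h.aemeasurable_normalizedSum z, hW, ?_⟩
  refine CadlagPath.tendsto_probabilityMeasure fun F hF hFb => ?_
  change Tendsto (fun n => ∫ f, F f ∂(μ.map (normalizedSum (movingAverage a X) z n))) atTop
    (𝓝 (∫ f, F f ∂(P.map fun ω => (dyadicLimit B ω).scale b)))
  have hFc := hF.continuous
  rw [integral_map hW hFc.aestronglyMeasurable]
  simp_rw [fun n => integral_map (h.aemeasurable_normalizedSum (a := a) z n)
    hFc.aestronglyMeasurable]
  obtain ⟨C, hC⟩ := hFb
  have hlim : Tendsto (fun k => ∫ ω, F ((dyadicPolygon B k ω).scale b) ∂P) atTop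
      (𝓝 (∫ ω, F ((dyadicLimit B ω).scale b) ∂P)) := by
    refine tendsto_integral_of_dominated_convergence (fun _ => C) (fun k => ?_)
      (integrable_const C) (fun k => ae_of_all _ fun ω => hC _) ?_
    · exact (hFc.measurable.comp_aemeasurable
        (hscale.comp_aemeasurable (aemeasurable_dyadicPolygon hB k))).aestronglyMeasurable
    · filter_upwards [ae_tendsto_dyadicPolygon hB] with ω hω
      exact ((hFc.comp (CadlagPath.continuous_scale b)).tendsto _).comp hω
  rw [Metric.tendsto_nhds]
  intro ε hε
  obtain ⟨M, hM⟩ := h.eventually_integral_normalizedSum_sub_le hz ha hF hC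
    (show 0 < ε / 4 by positivity)
  -- One index `k` fixes both the mesh `2⁻ᵏ` and the horizon `k`, so the polygons of the sums have
  -- exactly the shape of `dyadicPolygon B k`. The limit in `n` is taken with `k` fixed.
  obtain ⟨k, hk, hkM⟩ := ((Metric.tendsto_nhds.1 hlim (ε / 4) (by positivity)).and
    (eventually_ge_atTop M)).exists
  have h2k : k ≤ 2 ^ k := Nat.lt_two_pow_self.le
  obtain ⟨hm, hMn⟩ := hM (2 ^ k) (hkM.trans h2k)
  have hpoly : Tendsto (fun n => ∫ x, F (CadlagPath.polygon (2 ^ k) (2 ^ k * k)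
      fun j => A * gridIncr X z (2 ^ k) n j x) ∂μ) atTop
      (𝓝 (∫ ω, F ((dyadicPolygon B k ω).scale b) ∂P)) := by
    unfold dyadicPolygon
    simp_rw [CadlagPath.scale_polygon]
    refine tendsto_integral_polygon
      (fun n j => (h.aemeasurable_gridIncr z _ n j).const_mul A)
      (fun j => (aemeasurable_dyadicIncr hB k j).const_mul b) _ _ (fun y => ?_) hFc ⟨C, hC⟩
    refine h.tendsto_charFun_gridIncr hz hc hm A _ (aemeasurable_dyadicIncr hB k) (fun j => ?_)
      (iIndepFun_dyadicIncr hB k) y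
    rw [map_dyadicIncr hB]
    push_cast
    rfl
  filter_upwards [hMn k hkM, Metric.tendsto_nhds.1 hpoly (ε / 4) (by positivity)] with n h1 h2
  rw [← Real.dist_eq] at h1
  refine lt_of_le_of_lt ((dist_triangle _ _ _).trans
    (add_le_add h1 ((dist_triangle _ _ _).trans (add_le_add h2.le hk.le)))) ?_
  linarith

end IsIIDField

end Path

theorem theorem3p1
    {Ω : Type*} [MeasurableSpace Ω] (P : Measure Ω) [IsProbabilityMeasure P]
    -- i.i.d. steps of the walk
    (ζ : ℕ → Ω → ZSq) (hζ_meas : ∀ i, Measurable (ζ i))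
    (hζ_indep : iIndepFun ζ P) (hζ_ident : ∀ i, IdentDistrib (ζ i) (ζ 0) P P)
    -- the walk is centered, aperiodic, with a finite moment of order 2
    (hζ_moment : ∀ j, MemLp (fun ω => (ζ 0 ω j : ℝ)) 2 P)
    (hζ_mean : ∀ j, ∫ ω, (ζ 0 ω j : ℝ) ∂P = 0)
    (hζ_aper : IsAperiodicStep P (ζ 0))
    {E : Type*} [MeasurableSpace E] (μ : Measure E) [IsProbabilityMeasure μ]
    -- i.i.d. centered real random field with unit L² norm
    (X : ZSq → E → ℝ) (hX_meas : ∀ l, Measurable (X l))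
    (hX_indep : iIndepFun X μ) (hX_ident : ∀ l, IdentDistrib (X l) (X 0) μ μ)
    (hX_mean : ∫ x, X 0 x ∂μ = 0) (hX_norm : eLpNorm (X 0) 2 μ = 1)
    -- the coefficients of the moving average
    (a : ZSq → ℝ) (ha_sum : Summable fun q => |a q|) (ha_ne : (∑' q, a q) ≠ 0) :
    ∀ᵐ ω ∂P, SatisfiesFCLT μ
      (normalizedSum (movingAverage a X) (fun k => randomWalk ζ k ω))
      (|∑' q, a q| ^ 2 * (Real.pi * √(stepCov P (ζ 0)).det)⁻¹) := by
  have hw : IsCenteredWalk P ζ := ⟨hζ_meas, hζ_indep, hζ_ident, hζ_moment, hζ_mean, hζ_aper⟩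
  have hX : IsIIDField μ X := ⟨hX_meas, hX_indep, hX_ident, hX_mean, hX_norm⟩
  -- The exceptional null set is that of paths which are not regular; it does not depend on the
  -- field or on the coefficients.
  filter_upwards [hw.ae_isRegularPath] with ω hω
  exact hX.satisfiesFCLT hω (by positivity) ha_sum

end
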